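/- Let $k$ be an algebraically closed field of characteristic different from $3$. The dual Hesse hypergraph has the 12 vertices $m,n,p,1,2,3,a,b,c,\alpha,\beta,\gamma$ and the nine hyperedges $$\Gamma_1=\{p,1,b,\gamma\},\quad \Gamma_2=\{p,2,c,\beta\},\quad \Gamma_3=\{p,3,a,\alpha\},$$ $$\Gamma_4=\{n,2,a,\gamma\},\quad \Gamma_5=\{n,3,b,\beta\},\quad \Gamma_6=\{n,1,c,\alpha\},$$ $$\Gamma_7=\{m,1,2,3\},\quad \Gamma_8=\{m,\alpha,\beta,\gamma\},\quad \Gamma_9=\{m,a,b,c\};$$ put also $\Gamma_0=\{m,n,p,1,a\}$. A dual Hesse configuration is a family of 12 points of $\mathbb P^2_k$, labelled by the vertices, such that any three of them with distinct labels are collinear if and only if their labels belong to a common hyperedge $\Gamma_j$ with $1\le j\le 9$. Label the marked points of $M_{0,12}$ by the 12 vertices, and let $$\pi:\ M_{0,12}\longrightarrow M_\Gamma=\prod_{j=1}^{9}M_{0,\Gamma_j}\times M_{0,\Gamma_0}\cong (M_{0,4})^9\times M_{0,5}$$ be the product of the forgetful morphisms which drop the points with labels not in $\Gamma_j$. Let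 $E\subset M_{0,12}$ be the exceptional locus of $\pi$, i.e. the union of all positive-dimensional irreducible components of fibers of $\pi$, and let $\overline{E}$ be its closure in $\overline{M}_{0,12}$. A dual Hesse configuration exists. For every dual Hesse configuration $(p_i)$ there is a unique conic through the five points with labels $m,n,p,1,a$. Let $U\subset\mathbb P^2$ be the complement of the union of the lines joining the points $p_i$; the projection of the points $p_i$ from a variable point of $U$ defines a morphism $F:U\to M_{0,12}$. Let $C$ be the proper transform of this conic in $\overline{M}_{0,12}$, i.e. the closure in $\overline{M}_{0,12}$ of the image under $F$ of the part of the conic contained in $U$ (equivalently, the image of the proper transform of the conic in $\operatorname{Bl}_{12}\mathbb P^2$ under the extension $\operatorname{Bl}_{12}\mathbb P^2\to\overline{M}_{0,12}$ of $F$). Then: (1) $C$ is a connected component of $\overline{E}$; (2) $C$ is irreducible of dimension $1$ and meets $M_{0,12}$; (3) $C$ is a rigid curve on $\overline{M}_{0,12}$, that is, there are no proper surjection $q:S\to B$ from an (irreducible) surface $S$ over $k$ to a nonsingular curve $B$ and morphism $h:S\to\overline{M}_{0,12}$ such that $h(S)$ is two-dimensional and $h$ maps some fiber of $q$ over a closed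 point onto $C$. -/

import Mathlib

open CategoryTheory CategoryTheory.Limits AlgebraicGeometry

universe u

noncomputable section

namespace HypergraphCurve

/-! ### Configurations of vectors in the plane and the moduli space `M_{0,N}` -/

/-- The bracket `[i j] = x_i y_j - y_i x_j` of a family of vectors `v_i = (x_i, y_i)`. It is a unit
in the coefficient ring iff `v_i` and `v_j` define disjoint points of the projective line. -/
def bracket {N : Type} {R : Type u} [CommRing R] (v : N → Fin 2 → R) (i j : N) : R :=
  v i 0 * v j 1 - v i 1 * v j 0

/-- The family of vectors `v` defines pairwise disjoint points of the projective line over `R`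
(over a field: pairwise distinct points). -/
def IsConfiguration {N : Type} {R : Type u} [CommRing R] (v : N → Fin 2 → R) : Prop :=
  ∀ i j, i ≠ j → IsUnit (bracket v i j)

section Moduli

variable (k : Type u) [Field k] (N : Type)

/-- The generic family of vectors, with indeterminate coordinates. -/
def genericVector : N → Fin 2 → MvPolynomial (N × Fin 2) k :=
  fun i e => MvPolynomial.X (i, e)

/-- The multiplicative set generated by the brackets `[i j]`, `i ≠ j`. -/
def bracketSubmonoid : Submonoid (MvPolynomial (N × Fin 2) k) :=
  Submonoid.closure {b | ∃ i j, i ≠ j ∧ b = bracket (genericVector k N) i j}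

/-- The coordinate ring of the space of `N`-tuples of pairwise linearly independent
vectors of the plane. -/
abbrev ConfigRing : Type u := Localization (bracketSubmonoid k N)

variable {k N}

theorem bracket_mem_bracketSubmonoid {i j : N} (h : i ≠ j) :
    bracket (genericVector k N) i j ∈ bracketSubmonoid k N :=
  Submonoid.subset_closure ⟨i, j, h, rfl⟩

theorem isUnit_aeval {R : Type u} [CommRing R] [Algebra k R] {v : N → Fin 2 → R}
    (hv : IsConfiguration v) (y : bracketSubmonoid k N) :
    IsUnit (MvPolynomial.aeval (fun q : N × Fin 2 => v q.1 q.2)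
      (y : MvPolynomial (N × Fin 2) k)) := by
  have hle : bracketSubmonoid k N ≤ (IsUnit.submonoid R).comap
      ((MvPolynomial.aeval (fun q : N × Fin 2 => v q.1 q.2) :
        MvPolynomial (N × Fin 2) k →ₐ[k] R) : MvPolynomial (N × Fin 2) k →* R) := by
    refine (Submonoid.closure_le).2 ?_
    rintro b ⟨i, j, hij, rfl⟩
    simpa [bracket, genericVector, IsUnit.mem_submonoid_iff] using hv i j hij
  exact hle y.2

/-- The homomorphism from the coordinate ring of the configuration space that evaluates the generic
vectors at a configuration of vectors over a `k`-algebra `R`. -/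
def ConfigRing.eval {R : Type u} [CommRing R] [Algebra k R] (v : N → Fin 2 → R)
    (hv : IsConfiguration v) : ConfigRing k N →ₐ[k] R :=
  IsLocalization.liftAlgHom (M := bracketSubmonoid k N)
    (f := MvPolynomial.aeval (fun q : N × Fin 2 => v q.1 q.2)) (isUnit_aeval hv)

theorem ConfigRing.eval_algebraMap {R : Type u} [CommRing R] [Algebra k R] (v : N → Fin 2 → R)
    (hv : IsConfiguration v) (f : MvPolynomial (N × Fin 2) k) :
    ConfigRing.eval v hv (algebraMap _ (ConfigRing k N) f) =
      MvPolynomial.aeval (fun q : N × Fin 2 => v q.1 q.2) f :=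
  IsLocalization.lift_eq (M := bracketSubmonoid k N) (isUnit_aeval hv) f

variable (k) in
/-- The cross-ratio `[q₀ q₂][q₁ q₃] / ([q₀ q₃][q₁ q₂])` of four distinct labels, as a function on
the configuration space. -/
def crossRatio (q : Fin 4 ↪ N) : ConfigRing k N :=
  Localization.mk
    (bracket (genericVector k N) (q 0) (q 2) * bracket (genericVector k N) (q 1) (q 3))
    ⟨bracket (genericVector k N) (q 0) (q 3) * bracket (genericVector k N) (q 1) (q 2),
      mul_mem (bracket_mem_bracketSubmonoid (q.injective.ne (by decide)))
        (bracket_mem_bracketSubmonoid (q.injective.ne (by decide)))⟩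

variable (k N) in
/-- The coordinate ring of `M_{0,N}`: the functions on the configuration space which are
polynomials in the cross-ratios (these are the functions invariant under projective transformations
and under rescaling of the vectors). If three of the points are moved to `∞, 0, 1`, then this is the
ring generated over `k` by the coordinates `z_i` of the other points and the inverses of `z_i`,
`z_i - 1` and `z_i - z_j`, i.e. the coordinate ring of the space of pairwise distinct points `z_i`
of the projective line without `∞, 0, 1`. -/
def moduliRing : Subalgebra k (ConfigRing k N) :=
  Algebra.adjoin k (Set.range (crossRatio k))

variable (k N) in
/-- The moduli space `M_{0,N}` of configurations of pairwise distinct points of the projective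
line, labelled by `N`, modulo projective transformations. -/
abbrev M0 : Scheme.{u} := Spec (CommRingCat.of (moduliRing k N))

variable (k N) in
/-- The structure morphism of `M_{0,N}`. -/
def M0.toBase : M0 k N ⟶ Spec (CommRingCat.of k) :=
  Spec.map (CommRingCat.ofHom (algebraMap k (moduliRing k N)))

/-- The point of `M_{0,N}` given by a configuration over `k`. -/
def M0.point (v : N → Fin 2 → k) (hv : IsConfiguration v) : M0 k N :=
  Spec.map (CommRingCat.ofHom
    ((ConfigRing.eval v hv).comp (moduliRing k N).val : moduliRing k N →ₐ[k] k).toRingHom)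
    (IsLocalRing.closedPoint k)

/-! ### Forgetful morphisms and hypergraph morphisms -/

theorem isConfiguration_restrict (I : Finset N) :
    IsConfiguration (fun (i : I) (e : Fin 2) =>
      algebraMap (MvPolynomial (N × Fin 2) k) (ConfigRing k N) (genericVector k N i e)) := by
  intro i j hij
  have h := IsLocalization.map_units (ConfigRing k N) (⟨_, bracket_mem_bracketSubmonoid
    (k := k) (fun h => hij (Subtype.ext h) : (i : N) ≠ j)⟩ : bracketSubmonoid k N)
  simpa [bracket] using h

variable (k) in
/-- The pull-back of functions along the map which drops the vectors with labels not in `I`. -/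
def ConfigRing.forget (I : Finset N) : ConfigRing k I →ₐ[k] ConfigRing k N :=
  ConfigRing.eval _ (isConfiguration_restrict I)

theorem crossRatio_mul (q : Fin 4 ↪ N) :
    crossRatio k q * (algebraMap _ (ConfigRing k N)
        (bracket (genericVector k N) (q 0) (q 3) * bracket (genericVector k N) (q 1) (q 2))) =
      algebraMap _ (ConfigRing k N)
        (bracket (genericVector k N) (q 0) (q 2) * bracket (genericVector k N) (q 1) (q 3)) := by
  rw [crossRatio, Localization.mk_eq_mk']
  exact IsLocalization.mk'_spec (ConfigRing k N) _
    (⟨_, mul_mem (bracket_mem_bracketSubmonoid (q.injective.ne (by decide)))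
        (bracket_mem_bracketSubmonoid (q.injective.ne (by decide)))⟩ : bracketSubmonoid k N)

theorem ConfigRing.eval_crossRatio {R : Type u} [CommRing R] [Algebra k R] (v : N → Fin 2 → R)
    (hv : IsConfiguration v) (q : Fin 4 ↪ N) :
    ConfigRing.eval v hv (crossRatio k q) * (bracket v (q 0) (q 3) * bracket v (q 1) (q 2)) =
      bracket v (q 0) (q 2) * bracket v (q 1) (q 3) := by
  have h := congrArg (ConfigRing.eval v hv) (crossRatio_mul (k := k) q)
  rw [map_mul, ConfigRing.eval_algebraMap, ConfigRing.eval_algebraMap] at h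
  simpa [bracket, genericVector] using h

theorem ConfigRing.forget_crossRatio (I : Finset N) (q : Fin 4 ↪ I) :
    ConfigRing.forget k I (crossRatio k q) =
      crossRatio k (q.trans (Function.Embedding.subtype _)) := by
  have h1 := ConfigRing.eval_crossRatio (k := k) _ (isConfiguration_restrict (k := k) I) q
  have h2 := crossRatio_mul (k := k) (q.trans (Function.Embedding.subtype (fun i => i ∈ I)))
  have hu := ((isConfiguration_restrict (k := k) I) (q 0) (q 3) (q.injective.ne (by decide))).mul
    ((isConfiguration_restrict (k := k) I) (q 1) (q 2) (q.injective.ne (by decide)))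
  refine hu.mul_right_cancel (h1.trans ?_)
  simpa [bracket] using h2.symm

/-- The restriction of `ConfigRing.forget` to the coordinate rings of the moduli spaces. -/
def moduliRing.forget (I : Finset N) : moduliRing k I →ₐ[k] moduliRing k N :=
  ((ConfigRing.forget k I).comp (moduliRing k I).val).codRestrict (moduliRing k N) (by
    have hle : moduliRing k I ≤ (moduliRing k N).comap (ConfigRing.forget k I) := by
      refine Algebra.adjoin_le ?_
      rintro _ ⟨q, rfl⟩
      change ConfigRing.forget k I (crossRatio k q) ∈ moduliRing k N
      rw [ConfigRing.forget_crossRatio]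
      exact Algebra.subset_adjoin ⟨_, rfl⟩
    exact fun x => hle x.2)

variable (k) in
/-- The forgetful morphism `M_{0,N} → M_{0,I}`, which drops the points with labels not in `I`. -/
def M0.forget (I : Finset N) : M0 k N ⟶ M0 k I :=
  Spec.map (CommRingCat.ofHom (moduliRing.forget (k := k) I).toRingHom)

theorem M0.forget_toBase (I : Finset N) : M0.forget k I ≫ M0.toBase k I = M0.toBase k N := by
  rw [M0.forget, M0.toBase, M0.toBase, ← Spec.map_comp, ← CommRingCat.ofHom_comp]
  congr 2
  exact (moduliRing.forget (k := k) I).comp_algebraMap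

variable (k) in
/-- The product over `k` of the spaces `M_{0,Γ_j}`, where `Γ_j` runs through the hyperedges of a
hypergraph `Γ`. -/
def hypergraphModuli {J : Type} [Finite J] (Γ : J → Finset N) : Scheme.{u} :=
  widePullback (Spec (CommRingCat.of k)) (fun j => M0 k (Γ j)) (fun j => M0.toBase k (Γ j))

variable (k) in
/-- The hypergraph morphism `M_{0,N} → ∏ M_{0,Γ_j}`, the product of the forgetful morphisms. -/
def hypergraphMorphism {J : Type} [Finite J] (Γ : J → Finset N) :
    M0 k N ⟶ hypergraphModuli k Γ :=
  WidePullback.lift (M0.toBase k N) (fun j => M0.forget k (Γ j)) (fun j => M0.forget_toBase (Γ j))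

/-! ### The projective line and the compactification of `M_{0,N}` -/

attribute [local instance] MvPolynomial.gradedAlgebra

variable (k) in
/-- The projective line over `k`. -/
abbrev P1 : Scheme.{u} := Proj (MvPolynomial.homogeneousSubmodule (Fin 2) k)

variable (k) in
/-- The structure morphism of the projective line. -/
def P1.toBase : P1 k ⟶ Spec (CommRingCat.of k) :=
  Proj.toSpecZero (MvPolynomial.homogeneousSubmodule (Fin 2) k) ≫
    Spec.map (CommRingCat.ofHom (algebraMap k (MvPolynomial.homogeneousSubmodule (Fin 2) k 0)))

/-- The homomorphism `X₀ ↦ c`, `X₁ ↦ 1` to the global functions on `Spec R`. -/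
def P1.coordinates {R : Type u} [CommRing R] [Algebra k R] (c : R) :
    MvPolynomial (Fin 2) k →+* Γ(Spec (CommRingCat.of R), ⊤) :=
  (Scheme.ΓSpecIso (CommRingCat.of R)).inv.hom.comp
    (MvPolynomial.aeval ![c, 1] : MvPolynomial (Fin 2) k →ₐ[k] R).toRingHom

theorem P1.map_irrelevant {R : Type u} [CommRing R] [Algebra k R] (c : R) :
    (HomogeneousIdeal.irrelevant
      (MvPolynomial.homogeneousSubmodule (Fin 2) k)).toIdeal.map (P1.coordinates (k := k) c) = ⊤ := by
  rw [Ideal.eq_top_iff_one]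
  have h : P1.coordinates (k := k) c (MvPolynomial.X 1) = 1 := by
    simp [P1.coordinates]
  rw [← h]
  refine Ideal.mem_map_of_mem _ ?_
  exact HomogeneousIdeal.mem_irrelevant_of_mem _ one_pos (MvPolynomial.isHomogeneous_X k 1)

/-- The morphism `[c : 1]` from `Spec R` to the projective line, for a `k`-algebra `R`, `c ∈ R`. -/
def P1.ofElement {R : Type u} [CommRing R] [Algebra k R] (c : R) :
    Spec (CommRingCat.of R) ⟶ P1 k :=
  Proj.fromOfGlobalSections (MvPolynomial.homogeneousSubmodule (Fin 2) k)
    (P1.coordinates (k := k) c) (P1.map_irrelevant c)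

theorem P1.ofElement_toBase {R : Type u} [CommRing R] [Algebra k R] (c : R) :
    P1.ofElement (k := k) c ≫ P1.toBase k =
      Spec.map (CommRingCat.ofHom (algebraMap k R)) := by
  rw [P1.ofElement, P1.toBase, Proj.fromOfGlobalSections_toSpecZero_assoc,
    ← Spec.map_comp, ← CommRingCat.ofHom_comp]
  have h : ((P1.coordinates (k := k) c).comp
      (algebraMap (MvPolynomial.homogeneousSubmodule (Fin 2) k 0) (MvPolynomial (Fin 2) k))).comp
      (algebraMap k (MvPolynomial.homogeneousSubmodule (Fin 2) k 0)) =
      (Scheme.ΓSpecIso (CommRingCat.of R)).inv.hom.comp (algebraMap k R) := by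
    ext x
    exact congrArg (Scheme.ΓSpecIso (CommRingCat.of R)).inv.hom
      ((MvPolynomial.aeval ![c, 1] : MvPolynomial (Fin 2) k →ₐ[k] R).commutes x)
  rw [h, CommRingCat.ofHom_comp, Spec.map_comp]
  change (Spec (CommRingCat.of R)).toSpecΓ ≫ Spec.map (Scheme.ΓSpecIso (CommRingCat.of R)).inv ≫ _ = _
  rw [← Category.assoc, toSpecΓ_SpecMap_ΓSpecIso_inv]
  exact Category.id_comp _

section Compactification

variable (k N) [Finite N]

/-- The product over `k` of projective lines indexed by the ordered quadruples of distinct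
labels. -/
def crossRatioSpace : Scheme.{u} :=
  widePullback (Spec (CommRingCat.of k)) (fun _ : Fin 4 ↪ N => P1 k) (fun _ => P1.toBase k)

/-- The morphism given by all cross-ratios of four of the marked points. -/
def crossRatioMorphism : M0 k N ⟶ crossRatioSpace k N :=
  WidePullback.lift (M0.toBase k N)
    (fun q => P1.ofElement (k := k) (⟨crossRatio k q, Algebra.subset_adjoin ⟨q, rfl⟩⟩ :
      moduliRing k N))
    (fun _ => P1.ofElement_toBase _)

/-- The moduli space of stable `N`-pointed rational curves, in its standard embedding by
cross-ratios: the scheme-theoretic closure of `M_{0,N}` in the product of projective lines indexed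
by the quadruples of distinct labels. -/
def MBar : Scheme.{u} := (crossRatioMorphism k N).image

/-- The structure morphism of the compactification. -/
def MBar.toBase : MBar k N ⟶ Spec (CommRingCat.of k) :=
  (crossRatioMorphism k N).imageι ≫ WidePullback.base _

/-- The inclusion of `M_{0,N}` in its compactification. -/
def M0.toMBar : M0 k N ⟶ MBar k N := (crossRatioMorphism k N).toImage

end Compactification

end Moduli

/-! ### Exceptional loci and rigid curves -/

/-- The exceptional locus of a morphism: the set-theoretical union of the positive-dimensional
irreducible components of its fibres. -/
def exceptionalLocus {X Y : Scheme.{u}} (f : X ⟶ Y) : Set X :=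
  {x | ∃ (y : Y) (Z : Set (f.fiber y)), Z ∈ irreducibleComponents (f.fiber y) ∧
    0 < topologicalKrullDim Z ∧ x ∈ f.fiberι y '' Z}

/-- `C` is a connected component of the subset `E` of a topological space. -/
def IsConnectedComponentOf {T : Type u} [TopologicalSpace T] (C E : Set T) : Prop :=
  ∃ x ∈ E, C = connectedComponentIn E x

section Rigid

variable {k : Type u} [Field k]

/-- An (irreducible and reduced) variety over `k`. -/
structure IsVariety {X : Scheme.{u}} (f : X ⟶ Spec (CommRingCat.of k)) : Prop where
  isIntegral : IsIntegral X
  isSeparated : IsSeparated f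
  locallyOfFiniteType : LocallyOfFiniteType f
  quasiCompact : QuasiCompact f

/-- A curve `C` on a `k`-scheme `X` moves if there are a proper surjection `p : S ⟶ B` from a
surface `S` to a nonsingular curve `B` and a morphism `h : S ⟶ X` whose image is a surface, such
that `h` maps some fibre of `p` (over a closed point) onto `C`. -/
def Moves {X : Scheme.{u}} (f : X ⟶ Spec (CommRingCat.of k)) (C : Set X) : Prop :=
  ∃ (S B : Scheme.{u}) (s : S ⟶ Spec (CommRingCat.of k)) (b : B ⟶ Spec (CommRingCat.of k))
    (p : S ⟶ B) (h : S ⟶ X),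
    IsVariety s ∧ topologicalKrullDim S = 2 ∧
    IsVariety b ∧ topologicalKrullDim B = 1 ∧ Smooth b ∧
    p ≫ b = s ∧ IsProper p ∧ Function.Surjective p ∧
    h ≫ f = s ∧ topologicalKrullDim (Set.range h) = 2 ∧
    ∃ y : B, IsClosed {y} ∧ h '' (p ⁻¹' {y}) = C

/-- `C` is a rigid curve on the `k`-scheme `X`: a proper irreducible curve which does not move. -/
structure IsRigidCurve {X : Scheme.{u}} (f : X ⟶ Spec (CommRingCat.of k)) (C : Set X) :
    Prop where
  isClosed : IsClosed C
  isIrreducible : IsIrreducible C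
  dim_eq_one : topologicalKrullDim C = 1
  not_moves : ¬ Moves f C

end Rigid

/-! ### The dual Hesse configuration -/

/-- The twelve vertices of the dual Hesse hypergraph. -/
inductive HesseVertex : Type
  | m | n | p | one | two | three | a | b | c | alpha | beta | gamma
  deriving DecidableEq

open HesseVertex in
instance : Fintype HesseVertex :=
  ⟨{m, n, p, one, two, three, a, b, c, alpha, beta, gamma}, by intro x; cases x <;> decide⟩

open HesseVertex in
/-- The nine hyperedges of the dual Hesse hypergraph. -/
def dualHesseEdge : Fin 9 → Finset HesseVertex :=
  ![{p, one, b, gamma}, {p, two, c, beta}, {p, three, a, alpha},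
    {n, two, a, gamma}, {n, three, b, beta}, {n, one, c, alpha},
    {m, one, two, three}, {m, alpha, beta, gamma}, {m, a, b, c}]

open HesseVertex in
/-- The additional hyperedge. -/
def conicEdge : Finset HesseVertex := {m, n, p, one, a}

/-- The dual Hesse hypergraph together with the additional hyperedge of five vertices. -/
def hesseHypergraph : Fin 10 → Finset HesseVertex :=
  Fin.cons conicEdge dualHesseEdge

section Configuration

variable {k : Type u} [Field k]

/-- The vectors `P i` represent twelve points of the projective plane which form a dual Hesse
configuration: three of them are collinear iff they belong to a common hyperedge of the dual Hesse
hypergraph. -/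
def IsDualHesseConfiguration (P : HesseVertex → Fin 3 → k) : Prop :=
  ∀ i j l, i ≠ j → i ≠ l → j ≠ l →
    ((Matrix.of ![P i, P j, P l]).det = 0 ↔
      ∃ e, i ∈ dualHesseEdge e ∧ j ∈ dualHesseEdge e ∧ l ∈ dualHesseEdge e)

/-- `Q` is an equation of a conic passing through the points `P i`, `i ∈ I`. -/
def IsConicThrough {N : Type} (P : N → Fin 3 → k) (I : Finset N)
    (Q : MvPolynomial (Fin 3) k) : Prop :=
  Q.IsHomogeneous 2 ∧ Q ≠ 0 ∧ ∀ i ∈ I, MvPolynomial.eval (P i) Q = 0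

/-- `v` is obtained by the linear projection of the points `P i` of the projective plane to a
projective line from the point `[x]`. -/
def IsProjectionFrom {N : Type} (P : N → Fin 3 → k) (x : Fin 3 → k) (v : N → Fin 2 → k) : Prop :=
  ∃ L : (Fin 3 → k) →ₗ[k] (Fin 2 → k), LinearMap.ker L = Submodule.span k {x} ∧ ∀ i, v i = L (P i)

variable {N : Type} [Finite N]

/-- Projecting the points `P i` of the projective plane from the points of the complement `U` of
the lines which join them defines a morphism from `U` to `M_{0,N}`, hence identifies `U` (and the
blow-up of the plane in the points `P i`) with a surface in the compactification of `M_{0,N}`. This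
is the proper transform in that surface of the plane curve `Q = 0`: the closure of the set of all
configurations obtained by projecting from the points of the curve which lie in `U`. -/
def properTransform (P : N → Fin 3 → k) (Q : MvPolynomial (Fin 3) k) : Set (MBar k N) :=
  closure (M0.toMBar k N '' {z | ∃ x : Fin 3 → k, x ≠ 0 ∧ MvPolynomial.eval x Q = 0 ∧
    ∃ (v : N → Fin 2 → k) (hv : IsConfiguration v), IsProjectionFrom P x v ∧ z = M0.point v hv})

end Configuration

end HypergraphCurve

end

/-! A curve contracted by the hypergraph morphism is a one-parameter family of twelve points of the
line with constant cross-ratios on all hyperedges. Move `1`, `a`, `p` to `∞`, `0`, `1`; the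
hyperedge with five vertices then fixes `n` and `m` at constants `u` and `v`. The points `b`, `γ`,
`2`, `3`, `α`, `c` form a hexagon: two neighbours, one of `∞`, `0` and one of `1`, `u`, `v` make up
a hyperedge. So all six are Möbius functions of the coordinate of `γ`, and closing up the hexagon is
a condition on the constants. The three long diagonals are hyperedges through `β` and give three
expressions of `β` as a quotient of quadratic forms, or of linear forms if a factor cancels.
`IsHesseSolution.isHesseFamily` analyses them. If no factor cancels in the first two, they are
proportional, which forces a polynomial relation between the constants. If a factor cancels in one
of these two, it cancels in all three, since otherwise `β` would coincide with a marked point. Then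
the constants are forced: `u` is a primitive cube root of unity, `v = u²`, and the family is
`hesseVector`. The polynomial `hesseObstruction` collects the conditions of genericity; at the
constants of the family it is nonzero because `3` is invertible. On the other hand, every dual Hesse
configuration is projectively equivalent to `hessePoint w`, and `conicProjection_hessePoint`
identifies its projections from the points of the conic with `hesseVector w s`.

In terms of schemes, a point of the exceptional locus is a specialization of a point `η` which has a
proper specialization in the same fibre. Then the residue field of `η` is not algebraic over the
functions pulled back from the target (`not_isAlgebraic_of_lt`), and the analysis above, over the
relative algebraic closure of those functions, shows that `η` is the generic point `hessePrime` of
one of the two families, provided that `hesseGenericity` does not vanish at the given point.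

For the connected component, eleven cross-ratios are constant and finite on the closed curve
`hesseCurve`, boundary included. Finiteness of these and non-vanishing of the obstruction define an
open neighbourhood, in which the closed exceptional locus consists of the two curves belonging to
the two cube roots of unity. These are disjoint, since the value of one cross-ratio separates them.

For rigidity, suppose that the curve is the image of a fibre of a proper map from a surface to a
curve. The cross-ratios on the hyperedges have no poles on that fibre, so by properness they are
integral over functions on an affine curve and algebraic over some `k(τ)`. If the image were a
surface, some function would not be algebraic over `k(τ)`, and the same analysis would show that the
generic point of the image is a `hessePrime`, whose closure has dimension one. -/

noncomputable section

namespace HypergraphCurve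

/-! ### Binary forms evaluated at a transcendental element -/

section BinaryForms

variable {K L : Type*} [Field K] [Field L] [Algebra K L]

/-- `f` is the function on the affine plane of a binary form of degree `d`, whose value at `(x, 1)`
is `F`. -/
def IsForm (x : L) (d : ℕ) (f : K → K → K) (F : L) : Prop :=
  (∃ G : MvPolynomial (Fin 2) K, (∀ a b, MvPolynomial.eval ![a, b] G = f a b) ∧
    MvPolynomial.aeval ![x, 1] G = F) ∧ ∀ t a b, f (t * a) (t * b) = t ^ d * f a b

theorem IsForm.linear (x : L) (r s : K) :
    IsForm x 1 (fun a b => r * a + s * b) (algebraMap K L r * x + algebraMap K L s) := by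
  refine ⟨⟨MvPolynomial.C r * MvPolynomial.X 0 + MvPolynomial.C s * MvPolynomial.X 1, ?_, ?_⟩, ?_⟩
  · intro a b; simp
  · simp
  · intro t a b; ring

theorem IsForm.mul {x : L} {d e : ℕ} {f g : K → K → K} {F G : L} (hf : IsForm x d f F)
    (hg : IsForm x e g G) : IsForm x (d + e) (fun a b => f a b * g a b) (F * G) := by
  obtain ⟨⟨P, h1, h2⟩, h3⟩ := hf
  obtain ⟨⟨Q, k1, k2⟩, k3⟩ := hg
  exact ⟨⟨P * Q, fun a b => by simp [h1, k1], by simp [h2, k2]⟩,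
    fun t a b => by simp only [h3, k3]; ring⟩

theorem IsForm.add {x : L} {d : ℕ} {f g : K → K → K} {F G : L} (hf : IsForm x d f F)
    (hg : IsForm x d g G) : IsForm x d (fun a b => f a b + g a b) (F + G) := by
  obtain ⟨⟨P, h1, h2⟩, h3⟩ := hf
  obtain ⟨⟨Q, k1, k2⟩, k3⟩ := hg
  exact ⟨⟨P + Q, fun a b => by simp [h1, k1], by simp [h2, k2]⟩,
    fun t a b => by simp only [h3, k3]; ring⟩

theorem IsForm.sub {x : L} {d : ℕ} {f g : K → K → K} {F G : L} (hf : IsForm x d f F)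
    (hg : IsForm x d g G) : IsForm x d (fun a b => f a b - g a b) (F - G) := by
  obtain ⟨⟨P, h1, h2⟩, h3⟩ := hf
  obtain ⟨⟨Q, k1, k2⟩, k3⟩ := hg
  exact ⟨⟨P - Q, fun a b => by simp [h1, k1], by simp [h2, k2]⟩,
    fun t a b => by simp only [h3, k3]; ring⟩

theorem IsForm.smul {x : L} {d : ℕ} {f : K → K → K} {F : L} (r : K) (hf : IsForm x d f F) :
    IsForm x d (fun a b => r * f a b) (algebraMap K L r * F) := by
  obtain ⟨⟨P, h1, h2⟩, h3⟩ := hf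
  exact ⟨⟨MvPolynomial.C r * P, fun a b => by simp [h1], by simp [h2]⟩,
    fun t a b => by simp only [h3]; ring⟩

/-- Transfers identities from the extension field to binary forms: an identity between functions of
a transcendental element holds identically, so it can be evaluated at any zero of any form. The
zeros at infinity are included. -/
theorem IsForm.eq_zero [Infinite K] {x : L} (hx : Transcendental K x) {d : ℕ} {f : K → K → K}
    (hf : IsForm x d f 0) (a b : K) : f a b = 0 := by
  obtain ⟨⟨G, h1, h2⟩, h3⟩ := hf
  have key : ∀ t : K, f t 1 = 0 := by
    let e : MvPolynomial (Fin 2) K →ₐ[K] Polynomial K := MvPolynomial.aeval ![Polynomial.X, 1]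
    have he : Polynomial.aeval x (e G) = 0 := by
      rw [← h2]
      have : (Polynomial.aeval x).comp e = MvPolynomial.aeval ![x, 1] := by
        ext i; fin_cases i <;> simp [e]
      exact DFunLike.congr_fun this G
    have h0 : e G = 0 := by
      by_contra hne
      exact hx ⟨e G, hne, he⟩
    intro t
    have : ((Polynomial.aeval t).comp e : MvPolynomial (Fin 2) K →ₐ[K] K) =
        MvPolynomial.aeval ![t, 1] := by
      ext i; fin_cases i <;> simp [e]
    have h := DFunLike.congr_fun this G
    rw [AlgHom.comp_apply, h0, map_zero] at h
    rw [← h1, ← MvPolynomial.coe_aeval_eq_eval]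
    exact h.symm
  -- Homogeneity is only known for the function `f`. It reduces points with nonzero second
  -- coordinate to `(t, 1)`; the factor `X 1` takes care of the others.
  have h4 : G * MvPolynomial.X 1 = 0 := by
    apply MvPolynomial.funext
    intro p
    rw [map_mul, MvPolynomial.eval_X, map_zero]
    by_cases hp : p 1 = 0
    · rw [hp, mul_zero]
    · have hp' : p = ![p 1 * (p 0 / p 1), p 1 * 1] := by
        ext i; fin_cases i <;> simp [mul_div_cancel₀, hp]
      rw [hp', h1, h3, key, mul_zero, zero_mul]
  rcases mul_eq_zero.1 h4 with h | h
  · rw [← h1, h, map_zero]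
  · exact absurd h (MvPolynomial.X_ne_zero 1)

end BinaryForms

/-! ### Maps of degree two from the projective line to itself. -/

section

variable {K : Type*} [Field K]

/-- A quadratic form which vanishes at two distinct points of the projective line is a multiple of
the product of the linear forms vanishing there. -/
theorem exists_eq_mul_of_vanishing {f : K → K → K} {q0 q1 q2 : K}
    (hf : ∀ a b, f a b = q0 * a ^ 2 + q1 * (a * b) + q2 * b ^ 2) {r s r' s' : K}
    (hne : r * s' - r' * s ≠ 0) (h : f s (-r) = 0) (h' : f s' (-r') = 0) :
    ∃ t, ∀ a b, f a b = t * ((r * a + s * b) * (r' * a + s' * b)) := by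
  rw [hf] at h h'
  -- Up to sign, the polarization of `f` at the two zeros, divided by the square of the determinant
  -- of the two linear forms.
  refine ⟨-(2 * q0 * s * s' - q1 * (s * r' + s' * r) + 2 * q2 * r * r') / (r * s' - r' * s) ^ 2, ?_⟩
  intro a b
  rw [hf]
  field_simp
  grind

theorem exists_linear_forms_ne_zero [Infinite K] {w1 w2 w3 w4 : K × K} (h1 : w1 ≠ 0) (h2 : w2 ≠ 0)
    (h3 : w3 ≠ 0) (h4 : w4 ≠ 0) : ∃ a b : K, w1.1 * a + w1.2 * b ≠ 0 ∧ w2.1 * a + w2.2 * b ≠ 0 ∧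
      w3.1 * a + w3.2 * b ≠ 0 ∧ w4.1 * a + w4.2 * b ≠ 0 := by
  let q (w : K × K) : Polynomial K := Polynomial.C w.1 * Polynomial.X + Polynomial.C w.2
  have hq : ∀ w, w ≠ 0 → q w ≠ 0 := by
    intro w hw h
    apply hw
    have e0 := congrArg (Polynomial.coeff · 0) h
    have e1 := congrArg (Polynomial.coeff · 1) h
    simp [q] at e0 e1
    exact Prod.ext e1 e0
  have hne : q w1 * q w2 * q w3 * q w4 ≠ 0 :=
    mul_ne_zero (mul_ne_zero (mul_ne_zero (hq _ h1) (hq _ h2)) (hq _ h3)) (hq _ h4)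
  obtain ⟨a, ha⟩ : ∃ a, (q w1 * q w2 * q w3 * q w4).eval a ≠ 0 := by
    by_contra! h
    exact hne (Polynomial.funext (by simpa using h))
  refine ⟨a, 1, ?_⟩
  simpa [q, not_or, and_assoc] using ha

/-- Two pairs of quadratic forms without common zeros which define the same map from the projective
line to itself are proportional. -/
theorem exists_ratio_of_wedge_eq_zero [Infinite K] {N M N' M' : K → K → K} {u v : K} (huv : u ≠ v)
    {l m l' m' : K × K}
    (hN : ∃ q0 q1 q2, ∀ a b, N a b = q0 * a ^ 2 + q1 * (a * b) + q2 * b ^ 2)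
    (hM : ∃ q0 q1 q2, ∀ a b, M a b = q0 * a ^ 2 + q1 * (a * b) + q2 * b ^ 2)
    (hN' : ∃ q0 q1 q2, ∀ a b, N' a b = q0 * a ^ 2 + q1 * (a * b) + q2 * b ^ 2)
    (hM' : ∃ q0 q1 q2, ∀ a b, M' a b = q0 * a ^ 2 + q1 * (a * b) + q2 * b ^ 2)
    (hw : ∀ a b, N a b * M' a b = N' a b * M a b)
    (h : ∀ a b, N a b - u * M a b = (l.1 * a + l.2 * b) * (m.1 * a + m.2 * b))
    (h' : ∀ a b, N' a b - v * M' a b = (l'.1 * a + l'.2 * b) * (m'.1 * a + m'.2 * b))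
    (hb : l.1 * m.2 - m.1 * l.2 ≠ 0) (hb' : l'.1 * m'.2 - m'.1 * l'.2 ≠ 0)
    (hl : M l.2 (-l.1) ≠ 0) (hm : M m.2 (-m.1) ≠ 0)
    (hl' : M' l'.2 (-l'.1) ≠ 0) (hm' : M' m'.2 (-m'.1) ≠ 0) :
    ∃ r, r ≠ 0 ∧ ∀ a b, N' a b = r * N a b ∧ M' a b = r * M a b := by
  obtain ⟨n0, n1, n2, hN⟩ := hN
  obtain ⟨m0, m1, m2, hM⟩ := hM
  obtain ⟨n0', n1', n2', hN'⟩ := hN'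
  obtain ⟨m0', m1', m2', hM'⟩ := hM'
  -- Both pairs define the same map, so they have the same fibres: the fibre over `v` is known from
  -- the second pair, the fibre over `u` from the first. This determines `N - v M` and `N' - u M'`
  -- up to constants `t` and `t'`.
  have v1 : ∀ a b, M' a b ≠ 0 → N' a b - v * M' a b = 0 → N a b - v * M a b = 0 := by
    intro a b h1 h2
    apply mul_right_cancel₀ h1
    linear_combination hw a b + M a b * h2
  have v2 : ∀ a b, M a b ≠ 0 → N a b - u * M a b = 0 → N' a b - u * M' a b = 0 := by
    intro a b h1 h2
    apply mul_right_cancel₀ h1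
    linear_combination -hw a b + M' a b * h2
  obtain ⟨t, ht⟩ := exists_eq_mul_of_vanishing (f := fun a b => N a b - v * M a b)
    (q0 := n0 - v * m0) (q1 := n1 - v * m1) (q2 := n2 - v * m2)
    (by intro a b; simp only [hN, hM]; ring) hb'
    (v1 _ _ hl' (by rw [h']; ring)) (v1 _ _ hm' (by rw [h']; ring))
  obtain ⟨t', ht'⟩ := exists_eq_mul_of_vanishing (f := fun a b => N' a b - u * M' a b)
    (q0 := n0' - u * m0') (q1 := n1' - u * m1') (q2 := n2' - u * m2')
    (by intro a b; simp only [hN', hM']; ring) hb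
    (v2 _ _ hl (by rw [h]; ring)) (v2 _ _ hm (by rw [h]; ring))
  have hl0 : l ≠ 0 := by rintro rfl; simp at hb
  have hm0 : m ≠ 0 := by rintro rfl; simp at hb
  have hl0' : l' ≠ 0 := by rintro rfl; simp at hb'
  have hm0' : m' ≠ 0 := by rintro rfl; simp at hb'
  obtain ⟨a, b, g1, g2, g3, g4⟩ := exists_linear_forms_ne_zero hl0 hm0 hl0' hm0'
  -- Compare the two factorizations at a point where none of the four linear forms vanishes. Since
  -- `u ≠ v`, two members of each pencil then determine the proportionality factor of the pencils.
  have htt : t * t' = 1 := by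
    have hw := hw a b
    have k1 := h a b
    have k2 := h' a b
    have k3 := ht a b
    have k4 := ht' a b
    apply mul_right_cancel₀ (mul_ne_zero (mul_ne_zero g1 g2) (mul_ne_zero g3 g4))
    have : (N a b - u * M a b) * (N' a b - v * M' a b) =
        (N a b - v * M a b) * (N' a b - u * M' a b) := by linear_combination (u - v) * hw
    rw [k1, k2, k3, k4] at this
    linear_combination -this
  have huv' := sub_ne_zero.2 huv
  refine ⟨t', right_ne_zero_of_mul_eq_one htt, fun a b => ?_⟩
  have k1 := h a b
  have k2 := h' a b
  have k3 := ht a b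
  have k4 := ht' a b
  have c1 : N' a b - u * M' a b = t' * (N a b - u * M a b) := by rw [k4, k1]
  have c2 : N' a b - v * M' a b = t' * (N a b - v * M a b) := by
    rw [k3, k2]; linear_combination (-(l'.1 * a + l'.2 * b) * (m'.1 * a + m'.2 * b)) * htt
  constructor
  · apply mul_left_cancel₀ huv'; linear_combination u * c2 - v * c1
  · apply mul_left_cancel₀ huv'; linear_combination c2 - c1

end

/-! ### The hexagon of moving points and its diagonals. -/

section Hexagon

variable {K : Type*} [Field K]

/-- The binary forms of a hexagon of points moving on the projective line with constant cross-ratios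
`y₀, …, y₅` on its sides: the vertices are `n₀/b, a/b, a/D₁, P₁/D₁, P₁/D₂, P₂/D₂`, and the fixed
points on the sides are `∞, 0` in turn and `1, u, v` in turn. -/
structure IsHexagon (u v y0 y1 y2 y3 y4 y5 c : K) (n0 D1 P1 D2 P2 : K → K → K) : Prop where
  u_ne : u ≠ 0
  v_ne : v ≠ 0
  u_ne_one : u ≠ 1
  v_ne_one : v ≠ 1
  u_ne_v : u ≠ v
  y0_ne : y0 ≠ 0
  y1_ne : y1 ≠ 0
  y2_ne : y2 ≠ 0
  y3_ne : y3 ≠ 0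
  y4_ne : y4 ≠ 0
  y5_ne : y5 ≠ 0
  c_ne : c ≠ 0
  y0_ne_one : y0 ≠ 1
  y1_ne_one : y1 ≠ 1
  y2_ne_one : y2 ≠ 1
  y3_ne_one : y3 ≠ 1
  y4_ne_one : y4 ≠ 1
  y5_ne_one : y5 ≠ 1
  side0 : ∀ a b, a = y0 * n0 a b + (1 - y0) * b
  side1 : ∀ a b, u * D1 a b = u * y1 * b + (1 - y1) * a
  side2 : ∀ a b, P1 a b = y2 * a + v * (1 - y2) * D1 a b
  side3 : ∀ a b, D2 a b = y3 * D1 a b + (1 - y3) * P1 a b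
  side4 : ∀ a b, P2 a b = y4 * P1 a b + u * (1 - y4) * D2 a b
  side5 : ∀ a b, v * b = c * (v * y5 * D2 a b + (1 - y5) * P2 a b)
  scale : ∀ a b, n0 a b = c * P2 a b

variable {u v y0 y1 y2 y3 y4 y5 c : K} {n0 D1 P1 D2 P2 : K → K → K}

/-- The quadratic expressions of `β` from the first two diagonals are proportional with factor `r`.
At four well-chosen points most terms vanish: two of them compare `1 - A1` with `r (1 - A0)`, the
other two compare `A1` with `r A0`. Each pair yields an equation for `c` alone, and eliminating `c`
gives the relation. -/
theorem IsHexagon.relation_of_proportional (H : IsHexagon u v y0 y1 y2 y3 y4 y5 c n0 D1 P1 D2 P2)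
    {A0 A1 r : K} (hr : r ≠ 0) (hA0 : A0 ≠ 0) (hA0' : 1 - A0 ≠ 0)
    (hN : ∀ a b, A1 * (P1 a b - v * D2 a b) * a + (1 - A1) * (a - v * b) * P1 a b =
      r * (A0 * (P1 a b - u * D1 a b) * n0 a b + (1 - A0) * (n0 a b - u * b) * P1 a b))
    (hD : ∀ a b, A1 * (P1 a b - v * D2 a b) * b + (1 - A1) * (a - v * b) * D2 a b =
      r * (A0 * (P1 a b - u * D1 a b) * b + (1 - A0) * (n0 a b - u * b) * D1 a b))
    (hg : P1 1 1 ≠ D1 1 1) :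
    (1 - y1) * (1 - y2) * y3 * y5 * v ^ 3 = (1 - y4) * (1 - y5) * y0 * y2 * u ^ 3 := by
  obtain ⟨hu, hv, hu1, hv1, huv, hy0, hy1, hy2, hy3, hy4, hy5, hc, hz0, hz1, hz2, hz3, hz4, hz5,
    S0, S1, S2, S3, S4, S5, hs⟩ := H
  have linD : ∀ a b, D1 a b = D1 1 0 * a + D1 0 1 * b := by
    intro a b
    have h1 := S1 a b
    have h2 := S1 1 0
    have h3 := S1 0 1
    apply mul_left_cancel₀ hu; linear_combination h1 - a * h2 - b * h3
  have lin : ∀ a b, P1 a b = P1 1 0 * a + P1 0 1 * b := by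
    intro a b
    rw [S2 a b, S2 1 0, S2 0 1, linD a b]; ring
  -- the point where `b = 0`
  have e1 : (1 - A1) * (1 - y5) * u = - (r * (1 - A0) * c * (1 - y1) * y5 * v) := by
    have h := hD 1 0
    have a0 := S0 1 0
    have a1 := S1 1 0
    have a5 := S5 1 0
    have as := hs 1 0
    have hn : n0 1 0 ≠ 0 := by rintro h; rw [h] at a0; simp at a0
    have h5 : v * y5 * D2 1 0 = - (1 - y5) * P2 1 0 := by
      apply mul_left_cancel₀ hc; linear_combination -a5
    apply mul_left_cancel₀ hn
    linear_combination (-c * u * v * y5) * h + (1 - A1) * u * (1 - y5) * as + (1 - A1) * c * u * h5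
      - r * (1 - A0) * c * v * y5 * n0 1 0 * a1
  -- At `(1, 1)` the first two vertices both lie at `1`; the difference of the two equations leaves
  -- multiples of `P1 - D1`, which does not vanish there by `hg`.
  have e2 : (1 - A1) * (1 - v) * y3 = r * (1 - A0) * (1 - u) := by
    have hN := hN 1 1
    have hD := hD 1 1
    have a0 : n0 1 1 = 1 := by apply mul_left_cancel₀ hy0; linear_combination - S0 1 1
    have a3 := S3 1 1
    rw [a0] at hN hD
    have hg' : P1 1 1 - D1 1 1 ≠ 0 := sub_ne_zero.2 hg
    apply mul_left_cancel₀ hg'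
    linear_combination hN - hD + (1 - A1) * (1 - v) * a3
  have hind : ∀ a b, P1 a b = 0 → D1 a b = 0 → a = 0 ∧ b = 0 := by
    intro a b h1 h2
    have k2 := S2 a b
    have k1 := S1 a b
    rw [h1, h2] at k2
    have ha : a = 0 := by apply mul_left_cancel₀ hy2; linear_combination -k2
    rw [h2, ha] at k1
    exact ⟨ha, by apply mul_left_cancel₀ (mul_ne_zero hu hy1); linear_combination -k1⟩
  have hP01 : P1 0 1 ≠ 0 := by
    rw [S2 0 1]
    have k1 : D1 0 1 = y1 := by apply mul_left_cancel₀ hu; linear_combination S1 0 1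
    rw [k1]
    simp [hv, hy1, sub_ne_zero.2 (Ne.symm hz2)]
  -- the point where `P₁ = 0`
  have e3 : A1 * v ^ 2 * (1 - y2) = - (r * A0 * c * u ^ 2 * (1 - y4) * y2) := by
    have hP : P1 (P1 0 1) (-P1 1 0) = 0 := by rw [lin]; ring
    have hne : D1 (P1 0 1) (-P1 1 0) ≠ 0 := fun h => hP01 (hind _ _ hP h).1
    generalize P1 0 1 = a, -P1 1 0 = b at hP hne
    have hN := hN a b
    have k2 := S2 a b
    have k3 := S3 a b
    have k4 := S4 a b
    have ks := hs a b
    rw [hP] at hN k2 k3 k4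
    generalize D1 a b = d at *
    rw [ks, k4, k3] at hN
    apply mul_left_cancel₀ (mul_ne_zero hy3 (mul_ne_zero hne hne))
    linear_combination y2 * hN - A1 * v * y3 * d * k2
  -- the point where `P₁ = D₁`
  have e4 : A1 * (1 - v) * y0 = r * A0 * (1 - u) := by
    obtain ⟨a, b, hab, hP⟩ : ∃ a b, a - b ≠ 0 ∧ P1 a b = D1 a b := by
      refine ⟨P1 0 1 - D1 0 1, -(P1 1 0 - D1 1 0), ?_, ?_⟩
      · have h1 := lin 1 1
        have h2 := linD 1 1
        intro h
        exact hg (by rw [h1, h2]; linear_combination h)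
      · rw [lin, linD (_ - _)]; ring
    have hne : D1 a b ≠ 0 := by
      intro h
      obtain ⟨rfl, rfl⟩ := hind a b (hP.trans h) h
      simp at hab
    have hN := hN a b
    have hD := hD a b
    have k3 := S3 a b
    have k0 := S0 a b
    rw [hP] at hN hD k3
    generalize D1 a b = d at *
    have k3' : D2 a b = d := by linear_combination k3
    rw [k3'] at hN hD
    apply mul_left_cancel₀ (mul_ne_zero hne hab)
    linear_combination y0 * hN - y0 * hD - r * A0 * d * (1 - u) * k0
  have f1 : (1 - u) * (1 - y5) * u = - (c * (1 - y1) * y3 * y5 * v * (1 - v)) := by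
    apply mul_left_cancel₀ (mul_ne_zero hr hA0')
    linear_combination (1 - v) * y3 * e1 - (1 - y5) * u * e2
  have f2 : (1 - u) * v ^ 2 * (1 - y2) = - (c * u ^ 2 * (1 - y4) * y2 * y0 * (1 - v)) := by
    apply mul_left_cancel₀ (mul_ne_zero hr hA0)
    linear_combination (1 - v) * y0 * e3 - v ^ 2 * (1 - y2) * e4
  apply mul_left_cancel₀ (mul_ne_zero hc (mul_ne_zero (sub_ne_zero.2 hu1.symm)
    (sub_ne_zero.2 hv1.symm)))
  linear_combination (c * (1 - y1) * y3 * y5 * v * (1 - v)) * f2 -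
    (c * u ^ 2 * (1 - y4) * y2 * y0 * (1 - v)) * f1

/-- Serves to separate coefficients of two linear forms with different zeros. -/
theorem eq_zero_of_smul_eq_smul {x y : K} {f g : K → K → K} (h : ∀ a b, x * f a b = y * g a b)
    (h1 : ∃ a b, f a b = 0 ∧ g a b ≠ 0) (h2 : ∃ a b, f a b ≠ 0) : x = 0 ∧ y = 0 := by
  obtain ⟨a, b, h3, h4⟩ := h1
  have hy : y = 0 := by
    have := h a b
    rw [h3, mul_zero] at this
    exact (mul_eq_zero.1 this.symm).resolve_right h4
  obtain ⟨a, b, h3⟩ := h2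
  have := h a b
  rw [hy, zero_mul] at this
  exact ⟨(mul_eq_zero.1 this).resolve_right h3, hy⟩

/-- Let `Hᵢ` be the pair of numerator and denominator of the `i`-th vertex. The hypotheses say that
`w₀H₀ + w₃H₃ = w₁H₁ + w₄H₄ = w₂H₂ + w₅H₅`, each being a representation of `β`. Opposite sides of the
hexagon contain the same point among `1`, `u`, `v`; the functional which vanishes at this point,
applied to one of the equalities, leaves a multiple of one linear form for each of the two sides.
These forms are independent by `hg`, `hg'`, `hg''`, so both multiples vanish: consecutive weights
have ratio `yᵢ`, up to `c`. Then all linear forms are combinations of `b` and `D1`, and comparison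
of coefficients determines the constants. -/
theorem IsHexagon.dualHesse_of_linear (H : IsHexagon u v y0 y1 y2 y3 y4 y5 c n0 D1 P1 D2 P2)
    (hg : P1 1 1 ≠ D1 1 1) (hg' : P1 u 1 ≠ u * D2 u 1)
    (hg'' : ∃ a b, a - v * D1 a b = 0 ∧ n0 a b - v * b ≠ 0)
    {w0 w1 w2 w3 w4 w5 s0 s1 s2 A : K} (hw0 : w0 ≠ 0) (hw3 : w3 ≠ 0) (hw5 : w5 ≠ 0)
    (n01 : ∀ a b, w0 * n0 a b + w3 * P1 a b = w1 * a + w4 * P1 a b)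
    (d01 : ∀ a b, w0 * b + w3 * D1 a b = w1 * b + w4 * D2 a b)
    (n12 : ∀ a b, w1 * a + w4 * P1 a b = w2 * a + w5 * P2 a b)
    (d12 : ∀ a b, w1 * b + w4 * D2 a b = w2 * D1 a b + w5 * D2 a b)
    (h0 : ∀ a b, n0 a b - u * b = s0 * (P1 a b - u * D1 a b))
    (h1 : ∀ a b, a - v * b = s1 * (P1 a b - v * D2 a b))
    (h2 : ∀ a b, a - D1 a b = s2 * (P2 a b - D2 a b))
    (hA : w3 * A = (1 - A) * s0 * w0) :
    u ^ 2 + u + 1 = 0 ∧ v = u ^ 2 ∧ y0 = -u ∧ y1 = -u ^ 2 ∧ y2 = -u ∧ y3 = -u ^ 2 ∧ y4 = -u ∧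
      A = -u := by
  obtain ⟨hu, hv, hu1, hv1, huv, hy0, hy1, hy2, hy3, hy4, hy5, hc, hz0, hz1, hz2, hz3, hz4, hz5,
    S0, S1, S2, S3, S4, S5, hs⟩ := H
  have hz0' := sub_ne_zero.2 hz0
  have hz1' := sub_ne_zero.2 hz1
  have hz2' := sub_ne_zero.2 hz2
  have hz3' := sub_ne_zero.2 hz3
  have hz4' := sub_ne_zero.2 hz4
  have hz5' := sub_ne_zero.2 hz5
  -- The difference of numerator and denominator kills the point `1`, which lies on sides 0 and 3.
  -- The next two blocks use `u` on sides 1 and 4 and `v` on sides 2 and 5.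
  obtain ⟨m0, m3⟩ : w0 - w1 * y0 = 0 ∧ w4 * y3 - w3 = 0 := by
    refine eq_zero_of_smul_eq_smul (f := fun a b => n0 a b - b) (g := fun a b => P1 a b - D1 a b)
      (fun a b => ?_) ⟨1, 1, ?_, sub_ne_zero.2 hg⟩ ⟨1, 0, ?_⟩
    · linear_combination n01 a b - d01 a b - w4 * S3 a b + w1 * S0 a b
    · apply mul_left_cancel₀ hy0; linear_combination -S0 1 1
    · intro h; have := S0 1 0; simp at this h; rw [h] at this; simp at this
  obtain ⟨m1, m4⟩ : w1 - w2 * y1 = 0 ∧ w5 * y4 - w4 = 0 := by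
    refine eq_zero_of_smul_eq_smul (f := fun a b => a - u * b) (g := fun a b => P1 a b - u * D2 a b)
      (fun a b => ?_) ⟨u, 1, ?_, sub_ne_zero.2 hg'⟩ ⟨1, 0, ?_⟩
    · linear_combination n12 a b - u * d12 a b + w5 * S4 a b - w2 * S1 a b
    · ring
    · simp
  obtain ⟨m2, m5⟩ : w2 - w3 * y2 = 0 ∧ w0 * c * y5 - w5 = 0 := by
    obtain ⟨a, b, q1, q2⟩ := hg''
    have e : ∀ a b, n0 a b - v * b = c * y5 * (P2 a b - v * D2 a b) := by
      intro a b; linear_combination hs a b - S5 a b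
    have k1 : D1 1 0 = (1 - y1) / u := by rw [eq_div_iff hu]; linear_combination S1 1 0
    have k2 : D1 0 1 = y1 := by apply mul_left_cancel₀ hu; linear_combination S1 0 1
    refine eq_zero_of_smul_eq_smul (f := fun a b => a - v * D1 a b)
      (g := fun a b => P2 a b - v * D2 a b)
      (fun a b => ?_) ⟨a, b, q1, ?_⟩ ⟨0, 1, ?_⟩
    · linear_combination -n12 a b - n01 a b + v * d12 a b + v * d01 a b + w3 * S2 a b +
        w0 * e a b
    · intro h; apply q2; rw [e, h, mul_zero]
    · simp [k2, hv, hy1]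
  have hw4 : w4 ≠ 0 := by rintro rfl; apply hw3; linear_combination -m3
  have hw1 : w1 ≠ 0 := by rintro rfl; apply hw0; linear_combination m0
  have hw2 : w2 ≠ 0 := by rintro rfl; apply hw1; linear_combination m1
  have hm : w4 * (1 - y3) ≠ 0 := mul_ne_zero hw4 (sub_ne_zero.2 hz3.symm)
  have hm1 : w2 * (y1 - 1) ≠ 0 := mul_ne_zero hw2 hz1'
  have hm5 : w0 * c * (1 - y5) ≠ 0 :=
    mul_ne_zero (mul_ne_zero hw0 hc) (sub_ne_zero.2 hz5.symm)
  -- With the weights known, the remaining component of each equality is a proportionality of two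
  -- linear forms.
  obtain ⟨Y, hY⟩ : ∃ Y, ∀ a b, P1 a b = Y * b := by
    refine ⟨(w0 - w1) / (w4 * (1 - y3)), fun a b => ?_⟩
    rw [div_mul_eq_mul_div, eq_div_iff hm]
    linear_combination -d01 a b - w4 * S3 a b - D1 a b * m3
  obtain ⟨W, hW⟩ : ∃ W, ∀ a b, a = W * D2 a b := by
    refine ⟨u * (w5 - w4) / (w2 * (y1 - 1)), fun a b => ?_⟩
    rw [div_mul_eq_mul_div, eq_div_iff hm1]
    linear_combination n12 a b + w5 * S4 a b + (P1 a b - u * D2 a b) * m4 - a * m1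
  obtain ⟨Z, hZ⟩ : ∃ Z, ∀ a b, P2 a b = Z * D1 a b := by
    refine ⟨v * (w2 - w3) / (w0 * c * (1 - y5)), fun a b => ?_⟩
    rw [div_mul_eq_mul_div, eq_div_iff hm5]
    linear_combination n01 a b + n12 a b - w0 * hs a b - P2 a b * m5 - w3 * S2 a b +
      (a - v * D1 a b) * m2
  -- comparison of the coefficients of `b` and `D₁`
  have key : ∀ p q : K, (∀ a b, p * b = q * D1 a b) → p = 0 ∧ q = 0 := by
    intro p q h
    have k1 := S1 1 0
    have k2 := h 1 0
    have hq : q = 0 := by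
      apply mul_right_cancel₀ hz1'
      linear_combination u * k2 + q * k1
    refine ⟨?_, hq⟩
    have := h 0 1
    rw [hq] at this
    linear_combination this
  have D2e : ∀ a b, D2 a b = y3 * D1 a b + (1 - y3) * Y * b := by
    intro a b; rw [S3, hY]; ring
  obtain ⟨a1, b1⟩ := key (u * y1 + (1 - y1) * (W * ((1 - y3) * Y))) (u - (1 - y1) * (W * y3)) (by
    intro a b
    have h1 := S1 a b
    have h2 := hW a b
    rw [D2e] at h2
    linear_combination -h1 - (1 - y1) * h2)
  obtain ⟨a2, b2⟩ := key (Y - y2 * (W * ((1 - y3) * Y))) (y2 * (W * y3) + v * (1 - y2)) (by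
    intro a b
    have h1 := S2 a b
    have h2 := hW a b
    rw [hY] at h1
    rw [D2e] at h2
    linear_combination h1 + y2 * h2)
  obtain ⟨a4, b4⟩ := key (y4 * Y + u * (1 - y4) * ((1 - y3) * Y)) (Z - u * (1 - y4) * y3) (by
    intro a b
    have h1 := S4 a b
    rw [hY, hZ, D2e] at h1
    linear_combination -h1)
  obtain ⟨a0, b0⟩ := key (W * ((1 - y3) * Y) - (1 - y0)) (y0 * (c * Z) - W * y3) (by
    intro a b
    have h1 := S0 a b
    have h2 := hW a b
    rw [hs, hZ] at h1
    rw [D2e] at h2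
    linear_combination h1 - h2)
  obtain ⟨l0, l0'⟩ := key (u + s0 * Y) (c * Z + s0 * u) (by
    intro a b
    have h1 := h0 a b
    rw [hs, hZ, hY] at h1
    linear_combination -h1)
  obtain ⟨l1, l1'⟩ := key (-v - s1 * (Y - v * ((1 - y3) * Y)) + W * ((1 - y3) * Y))
      (-s1 * v * y3 - W * y3) (by
    intro a b
    have k1 := h1 a b
    have k2 := hW a b
    rw [hY, D2e] at k1
    rw [D2e] at k2
    linear_combination k1 - k2)
  obtain ⟨l2, l2'⟩ := key (W * ((1 - y3) * Y) + s2 * ((1 - y3) * Y))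
      (1 + s2 * (Z - y3) - W * y3) (by
    intro a b
    have k1 := h2 a b
    have k2 := hW a b
    rw [hZ, D2e] at k1
    rw [D2e] at k2
    linear_combination k1 - k2)
  obtain ⟨d1, d1'⟩ := key (w0 - w1 - w4 * ((1 - y3) * Y)) (w4 * y3 - w3) (by
    intro a b
    have k1 := d01 a b
    rw [D2e] at k1
    linear_combination k1)
  obtain ⟨d2, d2'⟩ := key (w1 - (w5 - w4) * ((1 - y3) * Y)) (w2 + (w5 - w4) * y3) (by
    intro a b
    have k1 := d12 a b
    rw [D2e] at k1
    linear_combination k1)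
  have hY0 : Y ≠ 0 := by rintro rfl; apply hu; linear_combination l0
  have hz3'' : 1 - y3 ≠ 0 := sub_ne_zero.2 hz3.symm
  -- From here on everything is elimination among the coefficient equations, ending with `W = u`, `Z
  -- = v`, `Y = 1` and `v² = u`.
  have c1 : c * Z * Y = u ^ 2 := by linear_combination Y * l0' - u * l0
  have hs1 : s1 * v + W = 0 := by apply mul_right_cancel₀ hy3; linear_combination -l1'
  have c2 : W * Y = v ^ 2 := by
    linear_combination v * l1 + (Y - (1 - y3) * Y * v) * hs1
  have hs2 : s2 + W = 0 := by
    apply mul_right_cancel₀ (mul_ne_zero hz3'' hY0); linear_combination l2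
  have c3 : W * Z = 1 := by linear_combination -l2' + (Z - y3) * hs2
  have x1 : y4 * (1 - y2) = 1 := by
    apply mul_left_cancel₀ (mul_ne_zero hw5 hy3)
    linear_combination -d2' + m2 - y2 * m3 + (1 - y2) * y3 * m4
  have x2 : y1 * y3 = -((1 - y3) * Y) := by
    apply mul_left_cancel₀ (mul_ne_zero hw5 (mul_ne_zero hy4 hy2))
    linear_combination d2 - m1 - y1 * m2 + y1 * y2 * m3 + y1 * y2 * y3 * m4 -
      (1 - y3) * Y * w5 * x1 + (1 - y3) * Y * m4
  have x3 : (y0 - 1) * y2 = -1 := by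
    apply mul_left_cancel₀ (mul_ne_zero (mul_ne_zero hw4 hy3) hy1)
    linear_combination d1 - m0 + w4 * x2 + (y0 - 1) * (-m1 - y1 * m2 + y1 * y2 * m3)
  have x4 : u * y2 * (1 - y3) = 1 := by
    apply mul_left_cancel₀ hy4
    apply mul_left_cancel₀ hY0
    linear_combination -a4 - u * (1 - y3) * Y * x1
  have x5 : W = u := by
    apply mul_left_cancel₀ (mul_ne_zero hy2 hz3'')
    apply mul_left_cancel₀ hY0
    linear_combination -a2 - Y * x4
  subst x5
  have x6 : Z = v := by linear_combination b4 - y4 * b2 + (v - W * y3) * x1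
  subst x6
  have x7 : Y = 1 := by
    apply mul_left_cancel₀ (mul_ne_zero hu hz3'')
    apply mul_left_cancel₀ hy2
    linear_combination y2 * a0 - x3 - x4
  subst x7
  have x8 : Z ^ 2 = W := by linear_combination -c2
  have x9 : Z = W ^ 2 := by
    have : Z ^ 3 = 1 := by linear_combination Z * x8 + c3
    rw [← x8]; linear_combination -Z * this
  subst x9
  have hu1' := sub_ne_zero.2 hu1
  have e : W ^ 2 + W + 1 = 0 := by
    apply mul_left_cancel₀ hu1'; linear_combination c3
  have u3 : W ^ 3 = 1 := by linear_combination c3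
  have f2' : y2 * W = 1 + W := by
    apply mul_left_cancel₀ hu1'; linear_combination -b2 - x4
  have f2 : y2 = -W := by
    apply mul_left_cancel₀ hu; linear_combination f2' + e
  subst f2
  have f3 : y3 = -W ^ 2 := by
    apply mul_left_cancel₀ (pow_ne_zero 2 hu); linear_combination x4 + (W ^ 2 - W + 1) * e
  subst f3
  have f4 : y4 = -W := by
    apply mul_left_cancel₀ (pow_ne_zero 2 hu); linear_combination -x1 + y4 * e + u3
  have f0 : y0 = -W := by
    apply mul_left_cancel₀ hu; linear_combination -x3 + e
  have f1 : y1 = -W ^ 2 := by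
    apply mul_left_cancel₀ (pow_ne_zero 2 hu); linear_combination -x2 + (W ^ 2 - W + 1) * e
  refine ⟨e, rfl, f0, f1, rfl, rfl, f4, ?_⟩
  have q : w0 = -W * w3 := by
    linear_combination m0 + w1 * f0 - W * m1 - W * w2 * f1 + W ^ 3 * m2 - W * w3 * u3
  apply mul_left_cancel₀ (mul_ne_zero hw3 hu)
  linear_combination -hA + w3 * A * e - (1 - A) * w0 * l0 + (1 - A) * W * q

end Hexagon

/-! ### Linear forms, and the degenerate and nondegenerate diagonals. -/

section LinearForms

variable {K L : Type*} [Field K] [Field L] [Algebra K L]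

/-- `f` is the function on the affine plane of a binary linear form, whose value at `(x, 1)`
is `F`. -/
def IsLinearForm (x : L) (f : K → K → K) (F : L) : Prop :=
  ∃ r s, (∀ a b, f a b = r * a + s * b) ∧ F = algebraMap K L r * x + algebraMap K L s

variable {x : L} {f g : K → K → K} {F G : L}

theorem IsLinearForm.isForm (hf : IsLinearForm x f F) : IsForm x 1 f F := by
  obtain ⟨r, s, h, rfl⟩ := hf
  obtain rfl : f = fun a b => r * a + s * b := by funext a b; exact h a b
  exact IsForm.linear x r s

theorem isLinearForm_fst (x : L) : IsLinearForm x (fun a _ : K => a) x :=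
  ⟨1, 0, by simp, by simp⟩

theorem isLinearForm_snd (x : L) : IsLinearForm x (fun _ b : K => b) 1 :=
  ⟨0, 1, by simp, by simp⟩

theorem IsLinearForm.comb (hf : IsLinearForm x f F) (hg : IsLinearForm x g G) (p q : K) :
    IsLinearForm x (fun a b => p * f a b + q * g a b) (algebraMap K L p * F + algebraMap K L q * G) := by
  obtain ⟨r, s, h, rfl⟩ := hf
  obtain ⟨r', s', h', rfl⟩ := hg
  exact ⟨p * r + q * r', p * s + q * s', fun a b => by simp only [h, h']; ring,
    by simp; ring⟩

theorem IsLinearForm.exists_root (hf : IsLinearForm x f F) (hF : F ≠ 0) :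
    ∃ a b, f a b = 0 ∧ (a ≠ 0 ∨ b ≠ 0) := by
  obtain ⟨r, s, h, rfl⟩ := hf
  refine ⟨s, -r, by rw [h]; ring, ?_⟩
  by_contra! hc
  apply hF
  rw [hc.1, neg_eq_zero.1 hc.2]; simp

/-- A linear form which vanishes at the zero of a nonzero linear form is a multiple of it. -/
theorem IsLinearForm.eq_smul_of_root (hf : IsLinearForm x f F) (hg : IsLinearForm x g G)
    {a b : K} (hab : a ≠ 0 ∨ b ≠ 0) (h : f a b = 0) (h' : g a b = 0) (hF : F ≠ 0) :
    ∃ t, (∀ a b, g a b = t * f a b) ∧ G = algebraMap K L t * F := by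
  obtain ⟨r, s, h1, rfl⟩ := hf
  obtain ⟨r', s', h2, rfl⟩ := hg
  rw [h1] at h
  rw [h2] at h'
  have hrs : r ≠ 0 ∨ s ≠ 0 := by
    by_contra! hc
    rw [hc.1, hc.2] at hF
    simp at hF
  have hdet : r * s' = r' * s := by
    rcases hab with ha | hb
    · apply mul_left_cancel₀ ha; linear_combination s' * h - s * h'
    · apply mul_left_cancel₀ hb; linear_combination r * h' - r' * h
  obtain ⟨t, ht, ht'⟩ : ∃ t, r' = t * r ∧ s' = t * s := by
    rcases hrs with hr | hs
    · exact ⟨r' / r, by field_simp, by field_simp; linear_combination hdet⟩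
    · exact ⟨s' / s, by field_simp; linear_combination -hdet, by field_simp⟩
  exact ⟨t, fun a b => by rw [h1, h2, ht, ht']; ring, by rw [ht, ht']; simp; ring⟩

variable [Infinite K]

theorem IsLinearForm.ext (hx : Transcendental K x) (hf : IsLinearForm x f F)
    (hg : IsLinearForm x g F) (a b : K) : f a b = g a b := by
  have := (hf.isForm.sub hg.isForm)
  rw [sub_self] at this
  exact sub_eq_zero.1 (this.eq_zero hx a b)

/-- A point `β` of the line through the moving points `n/d` and `n'/d'` and the constant point `w`
cannot be given by linear forms unless the movements of the two points are related. -/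
theorem eq_of_linear_of_bracket_ne_zero (hx : Transcendental K x) {n d n' d' N D : K → K → K}
    {nL dL n'L d'L NL DL β : L} {w A : K}
    (hn : IsLinearForm x n nL) (hd : IsLinearForm x d dL) (hn' : IsLinearForm x n' n'L)
    (hd' : IsLinearForm x d' d'L) (hN : IsLinearForm x N NL) (hD : IsLinearForm x D DL)
    (hDL : DL ≠ 0) (hβ : β * DL = NL)
    (hA0 : A ≠ 0) (hA1 : 1 - A ≠ 0)
    (hrel : β * (algebraMap K L A * (n'L - algebraMap K L w * d'L) * dL + (1 - algebraMap K L A) * (nL - algebraMap K L w * dL) * d'L) =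
      algebraMap K L A * (n'L - algebraMap K L w * d'L) * nL + (1 - algebraMap K L A) * (nL - algebraMap K L w * dL) * n'L)
    (h0 : ∀ a b, n a b = 0 → d a b = 0 → a = 0 ∧ b = 0)
    (h0' : ∀ a b, n' a b = 0 → d' a b = 0 → a = 0 ∧ b = 0)
    (hl : nL - algebraMap K L w * dL ≠ 0) (hl' : n'L - algebraMap K L w * d'L ≠ 0)
    (hne : ¬ ∃ s, (∀ a b, n a b - w * d a b = s * (n' a b - w * d' a b)) ∧
      nL - algebraMap K L w * dL = algebraMap K L s * (n'L - algebraMap K L w * d'L)) :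
    β = algebraMap K L w := by
  have k := hn.comb hd 1 (-w)
  have k' := hn'.comb hd' 1 (-w)
  have kT := hN.comb hD 1 (-w)
  have e : ∀ p q : L, algebraMap K L (1 : K) * p + algebraMap K L (-w) * q = p - algebraMap K L w * q := by intro p q; simp; ring
  simp only [e, one_mul] at k k' kT
  -- The relation defining `β`, with `β - w` cleared of denominators. On its right side the product
  -- of `n - w d` and `n' - w d'` appears.
  have hform : ∀ a b, (N a b - w * D a b) * (A * (n' a b - w * d' a b) * d a b +
      (1 - A) * (n a b - w * d a b) * d' a b) =
      (n a b - w * d a b) * (n' a b - w * d' a b) * D a b := by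
    intro a b
    have F1 := kT.isForm.mul ((((k'.isForm.mul hd.isForm).smul A)).add
      ((k.isForm.mul hd'.isForm).smul (1 - A)))
    have F2 := (k.isForm.mul k'.isForm).mul hD.isForm
    have F3 := F1.sub (d := 3) F2
    have hz : (NL - algebraMap K L w * DL) * (algebraMap K L A * ((n'L - algebraMap K L w * d'L) * dL) +
        algebraMap K L (1 - A) * ((nL - algebraMap K L w * dL) * d'L)) -
        (nL - algebraMap K L w * dL) * (n'L - algebraMap K L w * d'L) * DL = 0 := by
      rw [← hβ, map_sub, map_one]
      linear_combination DL * hrel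
    rw [hz] at F3
    have := F3.eq_zero hx a b
    linear_combination this
  obtain ⟨a, b, hr, hab⟩ := k.exists_root hl
  obtain ⟨a', b', hr', hab'⟩ := k'.exists_root hl'
  have hra : n a b - w * d a b = 0 := by linear_combination hr
  have hra' : n' a' b' - w * d' a' b' = 0 := by linear_combination hr'
  -- `N - w D` vanishes at the zeros of `n - w d` and of `n' - w d'`. These zeros are distinct by
  -- `hne`, and a linear form with two distinct zeros is zero; hence `β = w`.
  have hroot : N a b - w * D a b = 0 := by
    have := hform a b
    rw [hra] at this
    have h2 : n' a b - w * d' a b ≠ 0 := by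
      intro h2
      obtain ⟨t, h3, h4⟩ := k'.eq_smul_of_root k hab (by linear_combination h2) hr hl'
      exact hne ⟨t, fun a b => by linear_combination h3 a b, h4⟩
    have h3 : d a b ≠ 0 := by
      intro h3
      rw [h3] at hra
      have := h0 a b (by linear_combination hra) h3
      tauto
    have h4 : (N a b - w * D a b) * (A * (n' a b - w * d' a b) * d a b) = 0 := by
      linear_combination this
    exact (mul_eq_zero.1 h4).resolve_right (mul_ne_zero (mul_ne_zero hA0 h2) h3)
  have hroot' : N a' b' - w * D a' b' = 0 := by
    have := hform a' b'
    rw [hra'] at this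
    have h2 : n a' b' - w * d a' b' ≠ 0 := by
      intro h2
      obtain ⟨t, h3, h4⟩ := k'.eq_smul_of_root k hab' hr' (by linear_combination h2) hl'
      exact hne ⟨t, fun a b => by linear_combination h3 a b, h4⟩
    have h3 : d' a' b' ≠ 0 := by
      intro h3
      rw [h3] at hra'
      have := h0' a' b' (by linear_combination hra') h3
      tauto
    have h4 : (N a' b' - w * D a' b') * ((1 - A) * (n a' b' - w * d a' b') * d' a' b') = 0 := by
      linear_combination this
    exact (mul_eq_zero.1 h4).resolve_right (mul_ne_zero (mul_ne_zero hA1 h2) h3)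
  obtain ⟨t, h3, h4⟩ := k.eq_smul_of_root kT hab hr (by linear_combination hroot) hl
  have ht : t = 0 := by
    by_contra ht
    have h5 : n a' b' - w * d a' b' = 0 := by
      have := h3 a' b'
      refine (mul_eq_zero.1 (?_ : t * (n a' b' - w * d a' b') = 0)).resolve_left ht
      linear_combination -this + hroot'
    obtain ⟨t, h3, h4⟩ := k'.eq_smul_of_root k hab' hr' (by linear_combination h5) hl'
    exact hne ⟨t, fun a b => by linear_combination h3 a b, h4⟩
  rw [ht, map_zero, zero_mul, ← hβ] at h4
  apply mul_right_cancel₀ hDL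
  linear_combination h4

/-- Two representations of a nonconstant function by quotients of linear forms are proportional. -/
theorem IsLinearForm.exists_ratio (hx : Transcendental K x) {N D N' D' : K → K → K}
    {NL DL N'L D'L β : L} {w : K}
    (hN : IsLinearForm x N NL) (hD : IsLinearForm x D DL)
    (hN' : IsLinearForm x N' N'L) (hD' : IsLinearForm x D' D'L) (hDL : D'L ≠ 0)
    (hβ : β * DL = NL) (hβ' : β * D'L = N'L) {a b : K} (hab : a ≠ 0 ∨ b ≠ 0)
    (h0 : N a b - w * D a b = 0) (h1 : D a b ≠ 0) (h2 : NL - algebraMap K L w * DL ≠ 0) :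
    ∃ t, t ≠ 0 ∧ (∀ a b, N' a b = t * N a b) ∧ ∀ a b, D' a b = t * D a b := by
  have k := hN.comb hD 1 (-w)
  have k' := hN'.comb hD' 1 (-w)
  have e : ∀ p q : L, algebraMap K L (1 : K) * p + algebraMap K L (-w) * q = p - algebraMap K L w * q := by intro p q; simp; ring
  simp only [e, one_mul] at k k'
  have hform : ∀ a b, (N a b - w * D a b) * D' a b = (N' a b - w * D' a b) * D a b := by
    intro a b
    have F := (k.isForm.mul hD'.isForm).sub (k'.isForm.mul hD.isForm)
    have hz : (NL - algebraMap K L w * DL) * D'L - (N'L - algebraMap K L w * D'L) * DL = 0 := by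
      rw [← hβ, ← hβ']; ring
    rw [hz] at F
    linear_combination F.eq_zero hx a b
  have hr : N' a b - w * D' a b = 0 := by
    have := hform a b
    rw [h0, zero_mul] at this
    exact (mul_eq_zero.1 this.symm).resolve_right h1
  obtain ⟨t, h3, h4⟩ := k.eq_smul_of_root k' hab (by linear_combination h0)
    (by linear_combination hr) h2
  -- The numerators minus `w` times the denominators agree up to `t`, and they are nonzero, so the
  -- denominators agree up to the same factor.
  have h5 : D'L = algebraMap K L t * DL := by
    apply mul_left_cancel₀ h2
    have h6 : (NL - algebraMap K L w * DL) * D'L = (N'L - algebraMap K L w * D'L) * DL := by rw [← hβ, ← hβ']; ring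
    rw [h6, h4]; ring
  have hDt := hD.comb hD t 0
  have h6 : ∀ a b, D' a b = t * D a b := by
    intro a b
    have := IsLinearForm.ext hx hD' (g := fun a b => t * D a b + 0 * D a b)
      (by rw [h5]; simpa using hDt) a b
    simpa using this
  refine ⟨t, ?_, fun a b => ?_, h6⟩
  · rintro rfl
    simp [h5] at hDL
  · have := h3 a b
    linear_combination this + w * h6 a b

omit [Infinite K] in
theorem IsLinearForm.bracket_ne_zero {r s r' s' : K} (hF : algebraMap K L r' * x + algebraMap K L s' ≠ 0)
    (hne : ¬ ∃ t, (∀ a b, r * a + s * b = t * (r' * a + s' * b)) ∧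
      algebraMap K L r * x + algebraMap K L s = algebraMap K L t * (algebraMap K L r' * x + algebraMap K L s')) : r * s' - r' * s ≠ 0 := by
  intro h
  apply hne
  have hf : IsLinearForm x (fun a b => r * a + s * b) (algebraMap K L r * x + algebraMap K L s) := ⟨r, s, by simp, rfl⟩
  have hg : IsLinearForm x (fun a b => r' * a + s' * b) (algebraMap K L r' * x + algebraMap K L s') := ⟨r', s', by simp, rfl⟩
  refine hg.eq_smul_of_root hf (a := s') (b := -r') ?_ (by ring) (by linear_combination h) hF
  by_contra! hc
  rw [hc.1, neg_eq_zero.1 hc.2] at hF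
  simp at hF

/-- If `N` and `M` are the quadratic numerator and denominator of `β` from the first diagonal, then
`N - u M = (n - u d)(n' - u d')`: the moving point `β` reaches the fixed point `u` exactly when one
of the end points of the diagonal does. The analogous factorization holds for the second diagonal
and `v`, so `exists_ratio_of_wedge_eq_zero` applies. -/
theorem exists_ratio_of_bracket_ne_zero (hx : Transcendental K x)
    {n d n' d' m e m' e' : K → K → K} {nL dL n'L d'L mL eL m'L e'L β : L} {u v A B : K}
    (huv : u ≠ v)
    (hn : IsLinearForm x n nL) (hd : IsLinearForm x d dL) (hn' : IsLinearForm x n' n'L)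
    (hd' : IsLinearForm x d' d'L)
    (hm : IsLinearForm x m mL) (he : IsLinearForm x e eL) (hm' : IsLinearForm x m' m'L)
    (he' : IsLinearForm x e' e'L)
    (hA0 : A ≠ 0) (hA1 : 1 - A ≠ 0) (hB0 : B ≠ 0) (hB1 : 1 - B ≠ 0)
    (hrel : β * (algebraMap K L A * (n'L - algebraMap K L u * d'L) * dL + (1 - algebraMap K L A) * (nL - algebraMap K L u * dL) * d'L) =
      algebraMap K L A * (n'L - algebraMap K L u * d'L) * nL + (1 - algebraMap K L A) * (nL - algebraMap K L u * dL) * n'L)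
    (hrel' : β * (algebraMap K L B * (m'L - algebraMap K L v * e'L) * eL + (1 - algebraMap K L B) * (mL - algebraMap K L v * eL) * e'L) =
      algebraMap K L B * (m'L - algebraMap K L v * e'L) * mL + (1 - algebraMap K L B) * (mL - algebraMap K L v * eL) * m'L)
    (h0 : ∀ a b, n a b = 0 → d a b = 0 → a = 0 ∧ b = 0)
    (h0' : ∀ a b, n' a b = 0 → d' a b = 0 → a = 0 ∧ b = 0)
    (h1 : ∀ a b, m a b = 0 → e a b = 0 → a = 0 ∧ b = 0)
    (h1' : ∀ a b, m' a b = 0 → e' a b = 0 → a = 0 ∧ b = 0)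
    (hl' : n'L - algebraMap K L u * d'L ≠ 0) (hk' : m'L - algebraMap K L v * e'L ≠ 0)
    (hne : ¬ ∃ s, (∀ a b, n a b - u * d a b = s * (n' a b - u * d' a b)) ∧
      nL - algebraMap K L u * dL = algebraMap K L s * (n'L - algebraMap K L u * d'L))
    (hne' : ¬ ∃ s, (∀ a b, m a b - v * e a b = s * (m' a b - v * e' a b)) ∧
      mL - algebraMap K L v * eL = algebraMap K L s * (m'L - algebraMap K L v * e'L)) :
    ∃ r, r ≠ 0 ∧ ∀ a b,
      B * (m' a b - v * e' a b) * m a b + (1 - B) * (m a b - v * e a b) * m' a b =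
        r * (A * (n' a b - u * d' a b) * n a b + (1 - A) * (n a b - u * d a b) * n' a b) ∧
      B * (m' a b - v * e' a b) * e a b + (1 - B) * (m a b - v * e a b) * e' a b =
        r * (A * (n' a b - u * d' a b) * d a b + (1 - A) * (n a b - u * d a b) * d' a b) := by
  have e0 : ∀ p q : L, algebraMap K L (1 : K) * p + algebraMap K L (-u) * q = p - algebraMap K L u * q := by intro p q; simp; ring
  have e1 : ∀ p q : L, algebraMap K L (1 : K) * p + algebraMap K L (-v) * q = p - algebraMap K L v * q := by intro p q; simp; ring
  have k := hn.comb hd 1 (-u)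
  have k' := hn'.comb hd' 1 (-u)
  have c := hm.comb he 1 (-v)
  have c' := hm'.comb he' 1 (-v)
  simp only [e0, one_mul, neg_mul, ← sub_eq_add_neg] at k k'
  simp only [e1, one_mul, neg_mul, ← sub_eq_add_neg] at c c'
  have FN := ((k'.isForm.mul hn.isForm).smul A).add ((k.isForm.mul hn'.isForm).smul (1 - A))
  have FD := ((k'.isForm.mul hd.isForm).smul A).add ((k.isForm.mul hd'.isForm).smul (1 - A))
  have GN := ((c'.isForm.mul hm.isForm).smul B).add ((c.isForm.mul hm'.isForm).smul (1 - B))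
  have GD := ((c'.isForm.mul he.isForm).smul B).add ((c.isForm.mul he'.isForm).smul (1 - B))
  have hF := (FN.mul GD).sub (GN.mul FD)
  have hz : ∀ a b, _ := fun a b => IsForm.eq_zero hx (by
    convert hF using 1
    rw [map_sub, map_sub, map_one]
    symm
    linear_combination (-(algebraMap K L B * (m'L - algebraMap K L v * e'L) * eL + (1 - algebraMap K L B) * (mL - algebraMap K L v * eL) * e'L)) * hrel +
      (algebraMap K L A * (n'L - algebraMap K L u * d'L) * dL + (1 - algebraMap K L A) * (nL - algebraMap K L u * dL) * d'L) * hrel') a b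
  -- Expands the numerators and denominators into explicit quadratic forms, as
  -- `exists_ratio_of_wedge_eq_zero` requires.
  have quad := fun {f g f' g' : K → K → K} {F G F' G' : L} (t t' : K) (h1 : IsLinearForm x f F)
    (h2 : IsLinearForm x g G) (h3 : IsLinearForm x f' F') (h4 : IsLinearForm x g' G') =>
    (show ∃ q0 q1 q2, ∀ a b, t * f a b * g a b + t' * f' a b * g' a b =
      q0 * a ^ 2 + q1 * (a * b) + q2 * b ^ 2 by
      obtain ⟨p1, q1, e1, -⟩ := h1
      obtain ⟨p2, q2, e2, -⟩ := h2
      obtain ⟨p3, q3, e3, -⟩ := h3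
      obtain ⟨p4, q4, e4, -⟩ := h4
      refine ⟨t * p1 * p2 + t' * p3 * p4, t * (p1 * q2 + q1 * p2) + t' * (p3 * q4 + q3 * p4),
        t * q1 * q2 + t' * q3 * q4, fun a b => ?_⟩
      rw [e1, e2, e3, e4]
      ring)
  have Q1 := quad A (1 - A) k' hn k hn'
  have Q2 := quad A (1 - A) k' hd k hd'
  have Q3 := quad B (1 - B) c' hm c hm'
  have Q4 := quad B (1 - B) c' he c he'
  obtain ⟨r, s, hk, hkL⟩ := k
  obtain ⟨r', s', hk', hkL'⟩ := k'
  obtain ⟨p, q, hc, hcL⟩ := c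
  obtain ⟨p', q', hc', hcL'⟩ := c'
  beta_reduce at hk hk' hc hc'
  have b0 : r * s' - r' * s ≠ 0 := by
    refine IsLinearForm.bracket_ne_zero (x := x) (by rwa [← hkL']) ?_
    simpa only [← hk, ← hk', ← hkL, ← hkL'] using hne
  have b1 : p * q' - p' * q ≠ 0 := by
    refine IsLinearForm.bracket_ne_zero (x := x) (by rwa [← hcL']) ?_
    simpa only [← hc, ← hc', ← hcL, ← hcL'] using hne'
  have root : ∀ {n d : K → K → K} {p q w : K}, (∀ a b, n a b = 0 → d a b = 0 → a = 0 ∧ b = 0) →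
      (∀ a b, n a b - w * d a b = p * a + q * b) → (p ≠ 0 ∨ q ≠ 0) → d q (-p) ≠ 0 := by
    intro n d p q w h1 h2 h3 h4
    have h5 := h1 q (-p) (by have := h2 q (-p); rw [h4] at this; linear_combination this) h4
    rcases h3 with h | h
    · exact h (neg_eq_zero.1 h5.2)
    · exact h h5.1
  have or1 : r ≠ 0 ∨ s ≠ 0 := by by_contra! h; rw [h.1, h.2] at b0; simp at b0
  have or2 : r' ≠ 0 ∨ s' ≠ 0 := by by_contra! h; rw [h.1, h.2] at b0; simp at b0
  have or3 : p ≠ 0 ∨ q ≠ 0 := by by_contra! h; rw [h.1, h.2] at b1; simp at b1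
  have or4 : p' ≠ 0 ∨ q' ≠ 0 := by by_contra! h; rw [h.1, h.2] at b1; simp at b1
  refine exists_ratio_of_wedge_eq_zero huv (l := (r, s)) (m := (r', s')) (l' := (p, q))
    (m' := (p', q')) Q1 Q2 Q3 Q4 (fun a b => ?_) (fun a b => ?_) (fun a b => ?_) b0 b1 ?_ ?_ ?_ ?_
  · linear_combination hz a b
  · simp only [← hk, ← hk']; ring
  · simp only [← hc, ← hc']; ring
  · have h2 : n s (-r) - u * d s (-r) = 0 := by rw [hk]; ring
    simp only [h2, hk', mul_zero, zero_mul, add_zero]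
    refine mul_ne_zero (mul_ne_zero hA0 ?_) (root h0 hk or1)
    intro h; apply b0; linear_combination -h
  · have h2 : n' s' (-r') - u * d' s' (-r') = 0 := by rw [hk']; ring
    simp only [h2, hk, mul_zero, zero_mul, zero_add]
    refine mul_ne_zero (mul_ne_zero hA1 ?_) (root h0' hk' or2)
    intro h; apply b0; linear_combination h
  · have h2 : m q (-p) - v * e q (-p) = 0 := by rw [hc]; ring
    simp only [h2, hc', mul_zero, zero_mul, add_zero]
    refine mul_ne_zero (mul_ne_zero hB0 ?_) (root h1 hc or3)
    intro h; apply b1; linear_combination -h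
  · have h2 : m' q' (-p') - v * e' q' (-p') = 0 := by rw [hc']; ring
    simp only [h2, hc, mul_zero, zero_mul, zero_add]
    refine mul_ne_zero (mul_ne_zero hB1 ?_) (root h1' hc' or4)
    intro h; apply b1; linear_combination h

end LinearForms

/-! ### Classification of the families with constant cross-ratios. -/

section HessePoints

variable {K L : Type*} [Field K] [Field L] [Algebra K L]

/-- The coordinates of twelve points of the projective line (three of them are moved to `∞, 0, 1`;
`1, u, v` are the points `p, n, m`, the points `h₀, …, h₅` form a hexagon) with given cross-ratios
on the nine hyperedges of the dual Hesse hypergraph: `yᵢ` on the sides of the hexagon and `Aᵢ` on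
its diagonals, which all contain `β`. -/
structure IsHesseSolution (u v y0 y1 y2 y3 y4 y5 A0 A1 A2 : K) (h0 h1 h2 h3 h4 h5 β : L) : Prop where
  u_ne : u ≠ 0
  v_ne : v ≠ 0
  u_ne_one : u ≠ 1
  v_ne_one : v ≠ 1
  u_ne_v : u ≠ v
  y_ne : y0 ≠ 0 ∧ y1 ≠ 0 ∧ y2 ≠ 0 ∧ y3 ≠ 0 ∧ y4 ≠ 0 ∧ y5 ≠ 0
  y_ne_one : y0 ≠ 1 ∧ y1 ≠ 1 ∧ y2 ≠ 1 ∧ y3 ≠ 1 ∧ y4 ≠ 1 ∧ y5 ≠ 1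
  A_ne : A0 ≠ 0 ∧ A1 ≠ 0 ∧ A2 ≠ 0
  A_ne_one : A0 ≠ 1 ∧ A1 ≠ 1 ∧ A2 ≠ 1
  h_ne : h0 ≠ 0 ∧ h1 ≠ 0 ∧ h2 ≠ 0 ∧ h3 ≠ 0 ∧ h4 ≠ 0 ∧ h5 ≠ 0
  h_ne_one : h2 ≠ 1 ∧ h5 ≠ 1
  h_ne_u : h0 ≠ algebraMap K L u ∧ h3 ≠ algebraMap K L u
  h_ne_v : h1 ≠ algebraMap K L v ∧ h4 ≠ algebraMap K L v
  β_ne : β ≠ 1 ∧ β ≠ algebraMap K L u ∧ β ≠ algebraMap K L v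
  side0 : h1 - 1 = algebraMap K L y0 * (h0 - 1)
  side1 : (h2 - algebraMap K L u) * h1 = algebraMap K L y1 * (h2 * (h1 - algebraMap K L u))
  side2 : h3 - algebraMap K L v = algebraMap K L y2 * (h2 - algebraMap K L v)
  side3 : (h4 - 1) * h3 = algebraMap K L y3 * (h4 * (h3 - 1))
  side4 : h5 - algebraMap K L u = algebraMap K L y4 * (h4 - algebraMap K L u)
  side5 : (h0 - algebraMap K L v) * h5 = algebraMap K L y5 * (h0 * (h5 - algebraMap K L v))
  diag0 : (h0 - algebraMap K L u) * (β - h3) = algebraMap K L A0 * ((β - algebraMap K L u) * (h0 - h3))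
  diag1 : (h1 - algebraMap K L v) * (β - h4) = algebraMap K L A1 * ((β - algebraMap K L v) * (h1 - h4))
  diag2 : (h2 - 1) * (β - h5) = algebraMap K L A2 * ((β - 1) * (h2 - h5))

/-- The coordinates of the projection of the points of a dual Hesse configuration from a point of
a conic, depending on a primitive third root of unity `u` and on a parameter `s`. -/
structure IsHesseFamily (u s h0 h1 h2 h3 h4 h5 β : L) : Prop where
  h0_eq : h0 = u * s
  h1_eq : h1 = -(u ^ 2 * (1 + s))
  h2_eq : h2 * s = -(1 + s)
  h3_eq : h3 * s = u
  h4_eq : h4 * (1 + s) = -u ^ 2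
  h5_eq : h5 * (1 + s) = -s
  β_eq : β * (s - u ^ 2) = u - s

/-- The polynomial whose non-vanishing characterizes the general cross-ratios. -/
def hesseObstruction {R : Type*} [CommRing R] (u v y0 y1 y2 y3 y4 y5 A0 : R) : R :=
  ((1 - y1) * (1 - y2) * y3 * y5 * v ^ 3 - (1 - y4) * (1 - y5) * y0 * y2 * u ^ 3) *
  (u * y2 + (v * (1 - y2) - 1) * (u * y1 + (1 - y1))) *
  (y2 * u + v * (1 - y2) - u * (y3 + (1 - y3) * (y2 * u + v * (1 - y2)))) *
  (u * v * y1 - (u - v * (1 - y1)) * ((1 - y0) + v * y0)) *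
  (A0 * y0 * (y2 * u + (v * (1 - y2) - u) * (1 - y1)) +
    (1 - A0) * (y1 * u + (1 - y1) * (1 - y0 * (1 - u))))

variable {u v y0 y1 y2 y3 y4 y5 A0 A1 A2 : K} {h0 h1 h2 h3 h4 h5 β : L}

/-- If both end points of a diagonal reach the fixed point `w` at the same parameter, the common
linear factor cancels from the quadratic expression, which leaves `β` as a quotient of linear forms.
-/
theorem linear_of_proportional {n d n' d' β : L} {A s w : K}
    (h : n - algebraMap K L w * d = algebraMap K L s * (n' - algebraMap K L w * d')) (h0 : n - algebraMap K L w * d ≠ 0) (h1 : n' - algebraMap K L w * d' ≠ 0)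
    (hrel : β * (algebraMap K L A * (n' - algebraMap K L w * d') * d + (1 - algebraMap K L A) * (n - algebraMap K L w * d) * d') =
      algebraMap K L A * (n' - algebraMap K L w * d') * n + (1 - algebraMap K L A) * (n - algebraMap K L w * d) * n') :
    s ≠ 0 ∧ (algebraMap K L A * d + algebraMap K L ((1 - A) * s) * d') ≠ 0 ∧
      β * (algebraMap K L A * d + algebraMap K L ((1 - A) * s) * d') = algebraMap K L A * n + algebraMap K L ((1 - A) * s) * n' ∧
      (algebraMap K L A * n + algebraMap K L ((1 - A) * s) * n') - algebraMap K L w * (algebraMap K L A * d + algebraMap K L ((1 - A) * s) * d') ≠ 0 := by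
  have e : β * (algebraMap K L A * d + algebraMap K L ((1 - A) * s) * d') = algebraMap K L A * n + algebraMap K L ((1 - A) * s) * n' := by
    rw [h] at hrel
    apply mul_left_cancel₀ h1
    simp only [map_mul, map_sub, map_one]
    linear_combination hrel
  have e' : (algebraMap K L A * n + algebraMap K L ((1 - A) * s) * n') - algebraMap K L w * (algebraMap K L A * d + algebraMap K L ((1 - A) * s) * d') ≠ 0 := by
    have : (algebraMap K L A * n + algebraMap K L ((1 - A) * s) * n') - algebraMap K L w * (algebraMap K L A * d + algebraMap K L ((1 - A) * s) * d') =
        n - algebraMap K L w * d := by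
      simp only [map_mul, map_sub, map_one]
      linear_combination -(1 - algebraMap K L A) * h
    rwa [this]
  refine ⟨?_, ?_, e, e'⟩
  · rintro rfl
    rw [map_zero, zero_mul] at h
    exact h0 h
  · intro h
    rw [h, mul_zero] at e
    rw [← e, h] at e'
    simp at e'

/-- The algebraic heart of the proof. The five factors of `hesseObstruction` are used once each: the
first excludes two nondegenerate diagonals, the next three provide the independence needed in
`IsHexagon.dualHesse_of_linear`, and the last ensures that the linear numerator and denominator of
`β` have no common zero. -/
theorem IsHesseSolution.isHesseFamily [Infinite K]
    (H : IsHesseSolution u v y0 y1 y2 y3 y4 y5 A0 A1 A2 h0 h1 h2 h3 h4 h5 β)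
    (hx : Transcendental K h1) (hg : hesseObstruction u v y0 y1 y2 y3 y4 y5 A0 ≠ 0) :
    u ^ 2 + u + 1 = 0 ∧ v = u ^ 2 ∧ ∃ s : L, Transcendental K s ∧
      IsHesseFamily (algebraMap K L u) s h0 h1 h2 h3 h4 h5 β := by
  obtain ⟨hu, hv, hu1, hv1, huv, ⟨hy0, hy1, hy2, hy3, hy4, hy5⟩, ⟨hz0, hz1, hz2, hz3, hz4, hz5⟩,
    ⟨hA0, hA1, hA2⟩, ⟨hB0, hB1, hB2⟩, ⟨hh0, hh1, hh2, hh3, hh4, hh5⟩, ⟨g2, g5⟩, ⟨g0, g3⟩, ⟨g1, g4⟩,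
    ⟨β1, βu, βv⟩, S0, S1, S2, S3, S4, S5, E0, E1, E2⟩ := H
  have hz0' := sub_ne_zero.2 hz0
  have hz1' := sub_ne_zero.2 hz1
  have hz5' := sub_ne_zero.2 hz5
  have hB0' := sub_ne_zero.2 hB0.symm
  have hB1' := sub_ne_zero.2 hB1.symm
  have hB2' := sub_ne_zero.2 hB2.symm
  have inj : ∀ {t : K}, t ≠ 0 → algebraMap K L t ≠ 0 := fun h => (map_ne_zero _).2 h
  unfold hesseObstruction at hg
  simp only [mul_ne_zero_iff, ne_eq] at hg
  obtain ⟨⟨⟨⟨q1, q2⟩, q5⟩, q4⟩, q3⟩ := hg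
  -- the linear forms
  obtain ⟨n0, hn0⟩ : ∃ f : K → K → K, f = fun a b => y0⁻¹ * a + (-(y0⁻¹ * (1 - y0))) * b := ⟨_, rfl⟩
  obtain ⟨D1, hD1⟩ : ∃ f : K → K → K, f = fun a b => ((1 - y1) / u) * a + y1 * b := ⟨_, rfl⟩
  obtain ⟨P1, hP1⟩ : ∃ f : K → K → K, f = fun a b => y2 * a + (v * (1 - y2)) * D1 a b := ⟨_, rfl⟩
  obtain ⟨D2, hD2⟩ : ∃ f : K → K → K, f = fun a b => y3 * D1 a b + (1 - y3) * P1 a b := ⟨_, rfl⟩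
  obtain ⟨P2, hP2⟩ : ∃ f : K → K → K, f = fun a b => y4 * P1 a b + (u * (1 - y4)) * D2 a b :=
    ⟨_, rfl⟩
  have T0 : ∀ a b, a = y0 * n0 a b + (1 - y0) * b := by intro a b; rw [hn0]; field_simp; ring
  have T1 : ∀ a b, u * D1 a b = u * y1 * b + (1 - y1) * a := by
    intro a b; rw [hD1]; field_simp; ring
  have T2 : ∀ a b, P1 a b = y2 * a + v * (1 - y2) * D1 a b := by intro a b; rw [hP1]
  have T3 : ∀ a b, D2 a b = y3 * D1 a b + (1 - y3) * P1 a b := by intro a b; rw [hD2]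
  have T4 : ∀ a b, P2 a b = y4 * P1 a b + u * (1 - y4) * D2 a b := by intro a b; rw [hP2]
  have la := isLinearForm_fst (K := K) h1
  have lb := isLinearForm_snd (K := K) h1
  have ln0 : IsLinearForm h1 n0 h0 := by
    have := la.comb lb y0⁻¹ (-(y0⁻¹ * (1 - y0)))
    rw [← hn0] at this
    convert this using 1
    have := inj hy0
    simp
    field_simp
    linear_combination -S0
  obtain ⟨d1, lD1, hd1⟩ : ∃ d, IsLinearForm h1 D1 d ∧
      algebraMap K L u * d = (1 - algebraMap K L y1) * h1 + algebraMap K L u * algebraMap K L y1 := by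
    have := la.comb lb ((1 - y1) / u) y1
    rw [← hD1] at this
    refine ⟨_, this, ?_⟩
    have := inj hu
    simp
    field_simp
  have k1 : h2 * d1 = h1 := by
    apply mul_left_cancel₀ (inj hu)
    linear_combination h2 * hd1 + S1
  obtain ⟨p1, lP1, hp1⟩ : ∃ p, IsLinearForm h1 P1 p ∧ p = algebraMap K L y2 * h1 + algebraMap K L v * (1 - algebraMap K L y2) * d1 := by
    have := la.comb lD1 y2 (v * (1 - y2))
    rw [← hP1] at this
    exact ⟨_, this, by simp⟩
  have k2 : h3 * d1 = p1 := by linear_combination d1 * S2 - hp1 + algebraMap K L y2 * k1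
  obtain ⟨d2, lD2, hd2⟩ : ∃ p, IsLinearForm h1 D2 p ∧ p = algebraMap K L y3 * d1 + (1 - algebraMap K L y3) * p1 := by
    have := lD1.comb lP1 y3 (1 - y3)
    rw [← hD2] at this
    exact ⟨_, this, by simp⟩
  have hd1' : d1 ≠ 0 := by rintro h; rw [h, mul_zero] at k1; exact hh1 k1.symm
  have k3 : h4 * d2 = p1 := by linear_combination h4 * hd2 + d1 * S3 + (1 - h4 * (1 - algebraMap K L y3)) * k2
  obtain ⟨p2, lP2, hp2⟩ : ∃ p, IsLinearForm h1 P2 p ∧ p = algebraMap K L y4 * p1 + algebraMap K L u * (1 - algebraMap K L y4) * d2 := by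
    have := lP1.comb lD2 y4 (u * (1 - y4))
    rw [← hP2] at this
    exact ⟨_, this, by simp⟩
  have hp1' : p1 ≠ 0 := by rw [← k2]; exact mul_ne_zero hh3 hd1'
  have hd2' : d2 ≠ 0 := by rintro h; rw [h, mul_zero] at k3; exact hp1' k3.symm
  have k4 : h5 * d2 = p2 := by linear_combination d2 * S4 - hp2 + algebraMap K L y4 * k3
  have hp2' : p2 ≠ 0 := by rw [← k4]; exact mul_ne_zero hh5 hd2'
  have k5 : p2 * (algebraMap K L v - (1 - algebraMap K L y5) * h0) = algebraMap K L y5 * algebraMap K L v * h0 * d2 := by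
    linear_combination -d2 * S5 + (-algebraMap K L v + (1 - algebraMap K L y5) * h0) * k4
  -- `P₂` is a multiple of `n₀`
  obtain ⟨c, hc, hs, hsL⟩ : ∃ c, c ≠ 0 ∧ (∀ a b, n0 a b = c * P2 a b) ∧ h0 = algebraMap K L c * p2 := by
    have F := (lP2.isForm.mul ((lb.comb ln0 v (-(1 - y5))).isForm)).sub
      ((ln0.isForm.mul lD2.isForm).smul (y5 * v))
    have hz : p2 * (algebraMap K L v * 1 + algebraMap K L (-(1 - y5)) * h0) - algebraMap K L (y5 * v) * (h0 * d2) = 0 := by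
      simp; linear_combination k5
    rw [hz] at F
    -- The point `(1 - y0, 1)` is the zero of `n0`; there the closing condition reduces to `v P2 =
    -- 0`.
    have h1 := F.eq_zero hx (1 - y0) 1
    have h2 : n0 (1 - y0) 1 = 0 := by
      apply mul_left_cancel₀ hy0; linear_combination -T0 (1 - y0) 1
    rw [h2] at h1
    have h3 : P2 (1 - y0) 1 = 0 := by
      apply mul_right_cancel₀ hv; linear_combination h1
    obtain ⟨c, h4, h5⟩ := lP2.eq_smul_of_root ln0 (Or.inr one_ne_zero) h3 h2 hp2'
    refine ⟨c, ?_, h4, h5⟩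
    rintro rfl
    simp [hh0] at h5
  have T5 : ∀ a b, v * b = c * (v * y5 * D2 a b + (1 - y5) * P2 a b) := by
    intro a b
    have hl := lb.comb lb v 0
    have hr := lD2.comb lP2 (c * (v * y5)) (c * (1 - y5))
    have e : algebraMap K L v * 1 + algebraMap K L 0 * 1 = algebraMap K L (c * (v * y5)) * d2 + algebraMap K L (c * (1 - y5)) * p2 := by
      apply mul_left_cancel₀ hp2'
      rw [hsL] at k5
      simp only [map_mul, map_sub, map_one, map_zero, add_zero, mul_one]
      linear_combination k5
    rw [e] at hl
    have := hl.ext hx hr a b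
    linear_combination this
  have H : IsHexagon u v y0 y1 y2 y3 y4 y5 c n0 D1 P1 D2 P2 :=
    ⟨hu, hv, hu1, hv1, huv, hy0, hy1, hy2, hy3, hy4, hy5, hc, hz0, hz1, hz2, hz3, hz4, hz5,
      T0, T1, T2, T3, T4, T5, hs⟩
  -- genericity
  have r2 : P1 1 1 ≠ D1 1 1 := by
    intro h
    apply q2
    linear_combination u * h - u * T2 1 1 - (v * (1 - y2) - 1) * T1 1 1
  have D1u : D1 u 1 = 1 := by
    apply mul_left_cancel₀ hu; linear_combination T1 u 1
  have r5 : P1 u 1 ≠ u * D2 u 1 := by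
    intro h
    apply q5
    have t2 := T2 u 1
    have t3 := T3 u 1
    rw [D1u] at t2 t3
    linear_combination h + u * t3 + (u * (1 - y3) - 1) * t2
  have r4 : ∃ a b, a - v * D1 a b = 0 ∧ n0 a b - v * b ≠ 0 := by
    refine ⟨u * v * y1, u - v * (1 - y1), ?_, ?_⟩
    · apply mul_left_cancel₀ hu
      linear_combination -v * T1 (u * v * y1) (u - v * (1 - y1))
    · intro h
      apply q4
      linear_combination y0 * h + T0 (u * v * y1) (u - v * (1 - y1))
  -- the diagonals
  have i0 : ∀ a b, n0 a b = 0 → b = 0 → a = 0 ∧ b = 0 := by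
    intro a b h h'
    have := T0 a b
    rw [h, h'] at this
    exact ⟨by linear_combination this, h'⟩
  have i3 : ∀ a b, P1 a b = 0 → D1 a b = 0 → a = 0 ∧ b = 0 := by
    intro a b h h'
    have t1 := T1 a b
    have t2 := T2 a b
    rw [h, h'] at t2
    rw [h'] at t1
    have : a = 0 := by apply mul_left_cancel₀ hy2; linear_combination -t2
    refine ⟨this, ?_⟩
    apply mul_left_cancel₀ (mul_ne_zero hu hy1); linear_combination -t1 - (1 - y1) * this
  have i4 : ∀ a b, P1 a b = 0 → D2 a b = 0 → a = 0 ∧ b = 0 := by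
    intro a b h h'
    refine i3 a b h ?_
    apply mul_left_cancel₀ hy3; linear_combination h' - T3 a b - (1 - y3) * h
  have i5 : ∀ a b, P2 a b = 0 → D2 a b = 0 → a = 0 ∧ b = 0 := by
    intro a b h h'
    refine i4 a b ?_ h'
    apply mul_left_cancel₀ hy4; linear_combination h - T4 a b - u * (1 - y4) * h'
  have i2 : ∀ a b, a = 0 → D1 a b = 0 → a = 0 ∧ b = 0 := by
    intro a b h h'
    refine ⟨h, ?_⟩
    apply mul_left_cancel₀ (mul_ne_zero hu hy1); linear_combination u * h' - T1 a b - (1 - y1) * h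
  have G0 : h0 - algebraMap K L u * 1 ≠ 0 := by rw [mul_one]; exact sub_ne_zero.2 g0
  have G1 : h1 - algebraMap K L v * 1 ≠ 0 := by rw [mul_one]; exact sub_ne_zero.2 g1
  have G2 : h1 - algebraMap K L 1 * d1 ≠ 0 := by
    rw [map_one, one_mul]; intro h; apply g2; apply mul_right_cancel₀ hd1'; linear_combination k1 + h
  have G3 : p1 - algebraMap K L u * d1 ≠ 0 := by
    intro h; apply g3; apply mul_right_cancel₀ hd1'; linear_combination k2 + h
  have G4 : p1 - algebraMap K L v * d2 ≠ 0 := by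
    intro h; apply g4; apply mul_right_cancel₀ hd2'; linear_combination k3 + h
  have G5 : p2 - algebraMap K L 1 * d2 ≠ 0 := by
    rw [map_one, one_mul]; intro h; apply g5; apply mul_right_cancel₀ hd2'; linear_combination k4 + h
  have R0 : β * (algebraMap K L A0 * (p1 - algebraMap K L u * d1) * 1 + (1 - algebraMap K L A0) * (h0 - algebraMap K L u * 1) * d1) =
      algebraMap K L A0 * (p1 - algebraMap K L u * d1) * h0 + (1 - algebraMap K L A0) * (h0 - algebraMap K L u * 1) * p1 := by
    rw [← k2]; linear_combination d1 * E0
  have R1 : β * (algebraMap K L A1 * (p1 - algebraMap K L v * d2) * 1 + (1 - algebraMap K L A1) * (h1 - algebraMap K L v * 1) * d2) =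
      algebraMap K L A1 * (p1 - algebraMap K L v * d2) * h1 + (1 - algebraMap K L A1) * (h1 - algebraMap K L v * 1) * p1 := by
    rw [← k3]; linear_combination d2 * E1
  have R2 : β * (algebraMap K L A2 * (p2 - algebraMap K L 1 * d2) * d1 + (1 - algebraMap K L A2) * (h1 - algebraMap K L 1 * d1) * d2) =
      algebraMap K L A2 * (p2 - algebraMap K L 1 * d2) * h1 + (1 - algebraMap K L A2) * (h1 - algebraMap K L 1 * d1) * p2 := by
    rw [← k4, ← k1, map_one]; linear_combination d2 * d1 * E2
  have j1 : ∀ a b : K, a = 0 → b = 0 → a = 0 ∧ b = 0 := fun _ _ => And.intro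
  -- `c0`, `c1`, `c2` say that a diagonal degenerates. Without `c0` and `c1` the first factor of the
  -- obstruction vanishes. As soon as one of `c0`, `c1` holds, `β` is a quotient of linear forms,
  -- and any nondegenerate diagonal forces `β` to equal the fixed point on it.
  by_cases c0 : ∃ s, (∀ a b, n0 a b - u * b = s * (P1 a b - u * D1 a b)) ∧
      h0 - algebraMap K L u * 1 = algebraMap K L s * (p1 - algebraMap K L u * d1)
  swap
  · by_cases c1 : ∃ s, (∀ a b, a - v * b = s * (P1 a b - v * D2 a b)) ∧
        h1 - algebraMap K L v * 1 = algebraMap K L s * (p1 - algebraMap K L v * d2)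
    · obtain ⟨s, -, hs⟩ := c1
      obtain ⟨-, t1, t2, -⟩ := linear_of_proportional hs G1 G4 R1
      exact absurd (eq_of_linear_of_bracket_ne_zero hx ln0 lb lP1 lD1
        (la.comb lP1 A1 ((1 - A1) * s)) (lb.comb lD2 A1 ((1 - A1) * s)) t1 t2
        hA0 hB0' R0 i0 i3 G0 G3 c0) βu
    · obtain ⟨r, hr, hND⟩ := exists_ratio_of_bracket_ne_zero hx huv ln0 lb lP1 lD1 la lb lP1 lD2
        hA0 hB0' hA1 hB1' R0 R1 i0 i3 j1 i4 G3 G4 c0 c1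
      refine absurd ?_ q1
      rw [H.relation_of_proportional hr hA0 hB0' (fun a b => (hND a b).1) (fun a b => (hND a b).2) r2,
        sub_self]
  obtain ⟨s0, hs0, hs0L⟩ := c0
  obtain ⟨s0n, t0, t0', t0''⟩ := linear_of_proportional hs0L G0 G3 R0
  have lN := ln0.comb lP1 A0 ((1 - A0) * s0)
  have lD := lb.comb lD1 A0 ((1 - A0) * s0)
  by_cases c1 : ∃ s, (∀ a b, a - v * b = s * (P1 a b - v * D2 a b)) ∧
        h1 - algebraMap K L v * 1 = algebraMap K L s * (p1 - algebraMap K L v * d2)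
  swap
  · exact absurd (eq_of_linear_of_bracket_ne_zero hx la lb lP1 lD2 lN lD t0 t0' hA1 hB1' R1 j1 i4
      G1 G4 c1) βv
  by_cases c2 : ∃ s, (∀ a b, a - 1 * D1 a b = s * (P2 a b - 1 * D2 a b)) ∧
        h1 - algebraMap K L 1 * d1 = algebraMap K L s * (p2 - algebraMap K L 1 * d2)
  swap
  · refine absurd (eq_of_linear_of_bracket_ne_zero hx la lD1 lP2 lD2 lN lD t0 t0' hA2 hB2' R2 i2 i5
      G2 G5 c2) ?_
    rwa [map_one]
  obtain ⟨s1, hs1, hs1L⟩ := c1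
  obtain ⟨s2, hs2, hs2L⟩ := c2
  obtain ⟨s1n, t1, t1', t1''⟩ := linear_of_proportional hs1L G1 G4 R1
  obtain ⟨s2n, t2, t2', t2''⟩ := linear_of_proportional hs2L G2 G5 R2
  -- comparison of the three representations of `β`
  have rt : n0 ((1 - y0) + y0 * u) 1 - u = 0 := by
    apply mul_left_cancel₀ hy0
    linear_combination -T0 ((1 - y0) + y0 * u) 1
  have w0 : (A0 * n0 ((1 - y0) + y0 * u) 1 + (1 - A0) * s0 * P1 ((1 - y0) + y0 * u) 1) -
      u * (A0 * 1 + (1 - A0) * s0 * D1 ((1 - y0) + y0 * u) 1) = 0 := by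
    linear_combination rt - (1 - A0) * hs0 ((1 - y0) + y0 * u) 1
  have w1 : A0 * 1 + (1 - A0) * s0 * D1 ((1 - y0) + y0 * u) 1 ≠ 0 := by
    intro h
    apply q3
    have e1 := T1 ((1 - y0) + y0 * u) 1
    have e2 := hs0 1 0
    have e3 := T0 1 0
    have e4 := T2 1 0
    have e5 := T1 1 0
    -- Comparing coefficients of the first variable in `hs0` gives `s0`; substituting it turns a
    -- zero of the denominator into a zero of the last factor of the obstruction.
    have e6 : s0 * (y0 * (y2 * u + (v * (1 - y2) - u) * (1 - y1))) = u := by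
      linear_combination -u * y0 * e2 - u * e3 - s0 * y0 * u * e4 - s0 * y0 * (v * (1 - y2) - u) * e5
    apply mul_left_cancel₀ (mul_ne_zero hu s0n)
    linear_combination u * A0 * e6 + u ^ 2 * h - u * (1 - A0) * s0 * e1
  obtain ⟨ra, ran, M1, M1'⟩ := lN.exists_ratio hx lD (la.comb lP1 A1 ((1 - A1) * s1))
    (lb.comb lD2 A1 ((1 - A1) * s1)) t1 t0' t1' (Or.inr one_ne_zero) w0 w1 t0''
  obtain ⟨rb, rbn, M2, M2'⟩ := lN.exists_ratio hx lD (la.comb lP2 A2 ((1 - A2) * s2))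
    (lD1.comb lD2 A2 ((1 - A2) * s2)) t2 t0' t2' (Or.inr one_ne_zero) w0 w1 t0''
  obtain ⟨e, rfl, f0, f1, f2, f3, f4, f5⟩ := H.dualHesse_of_linear r2 r5 r4 (w0 := A0)
    (w3 := (1 - A0) * s0) (w1 := A1 / ra) (w4 := (1 - A1) * s1 / ra) (w2 := A2 / rb)
    (w5 := (1 - A2) * s2 / rb) hA0 (mul_ne_zero hB0' s0n)
    (div_ne_zero (mul_ne_zero hB2' s2n) rbn)
    (fun a b => by have := M1 a b; field_simp; linear_combination -this)
    (fun a b => by have := M1' a b; field_simp; linear_combination -this)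
    (fun a b => by have h1 := M1 a b; have h2 := M2 a b; field_simp;
                   linear_combination rb * h1 - ra * h2)
    (fun a b => by have h1 := M1' a b; have h2 := M2' a b; field_simp;
                   linear_combination rb * h1 - ra * h2)
    hs0 hs1 (fun a b => by linear_combination hs2 a b) (A := A0) (by ring)
  subst f0 f1 f2 f3 f4 f5
  have e' : algebraMap K L u ^ 2 + algebraMap K L u + 1 = 0 := by
    have := congrArg (algebraMap K L) e
    simpa only [map_add, map_pow, map_one, map_zero] using this
  have u3 : algebraMap K L u ^ 3 = 1 := by linear_combination (algebraMap K L u - 1) * e'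
  simp only [map_neg, map_pow] at S0 S1 S2 S3 S4 E0 βu
  -- The parameter is `s = u⁻¹ h0`, with `u⁻¹ = u²`.
  obtain ⟨s, rfl⟩ : ∃ s, h0 = algebraMap K L u * s := ⟨algebraMap K L u ^ 2 * h0, by linear_combination -h0 * u3⟩
  have E1 : h1 = -(algebraMap K L u ^ 2 * (1 + s)) := by linear_combination S0 + e'
  have hs : Transcendental K s := by
    intro hs
    apply hx
    have : h1 = algebraMap K L (-u ^ 2) * (algebraMap K L 1 + s) := by rw [E1]; simp
    rw [this]
    exact (isAlgebraic_algebraMap _).mul ((isAlgebraic_algebraMap _).add hs)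
  have s0' : s ≠ 0 := by rintro rfl; exact hs isAlgebraic_zero
  have s1' : s - 1 ≠ 0 := by intro h; rw [sub_eq_zero] at h; exact hs (h ▸ isAlgebraic_one)
  have ss : 1 + s ≠ 0 := by
    intro h
    have : s = algebraMap K L (-1) := by simp; linear_combination h
    exact hs (this ▸ isAlgebraic_algebraMap _)
  have E2 : h2 * s = -(1 + s) := by
    rw [E1] at S1
    linear_combination S1 + h2 * (1 + s) * (algebraMap K L u ^ 2 - algebraMap K L u + 1) * e' + (h2 - (1 + s)) * u3
  have E3 : h3 * s = algebraMap K L u := by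
    linear_combination s * S2 - algebraMap K L u * E2 + s * algebraMap K L u * e'
  have E4 : h4 * (1 + s) = -algebraMap K L u ^ 2 := by
    linear_combination -algebraMap K L u * (s * S3 - (h4 * (1 + algebraMap K L u ^ 2) - 1) * E3) +
      h4 * (algebraMap K L u ^ 2 - algebraMap K L u + 1) * e' - h4 * s * u3
  have E5 : h5 * (1 + s) = -s := by
    linear_combination (1 + s) * S4 - algebraMap K L u * E4 + (1 + s) * e' + u3
  refine ⟨e, rfl, s, hs, rfl, E1, E2, E3, E4, E5, ?_⟩
  apply mul_left_cancel₀ s1'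
  linear_combination -s * E0 - ((algebraMap K L u * s - algebraMap K L u) + algebraMap K L u * (β - algebraMap K L u)) * E3 +
    (β * (s ^ 2 - s) - s + 1) * e' + (1 - s ^ 2) * u3

end HessePoints

/-! ### Functions on the moduli space as a ring generated by cross-ratios. -/

section CoordRing

variable (k : Type u) [Field k] (N : Type)

/-- The coordinate ring of `M_{0,N}`, as a commutative `k`-algebra. -/
def CoordRing : Type u := moduliRing k N

instance : CommRing (CoordRing k N) := inferInstanceAs (CommRing (moduliRing k N))

instance : Algebra k (CoordRing k N) := (moduliRing k N).algebra

/-- The functions on `M_{0,N}` as functions on the configuration space. -/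
def CoordRing.val : CoordRing k N →ₐ[k] ConfigRing k N := (moduliRing k N).val

variable {k N}

theorem CoordRing.val_injective : Function.Injective (CoordRing.val k N) := Subtype.val_injective

/-- The cross-ratio of four distinct labels as a function on `M_{0,N}`. -/
def CoordRing.crossRatio (q : Fin 4 ↪ N) : CoordRing k N :=
  (⟨HypergraphCurve.crossRatio k q, Algebra.subset_adjoin ⟨_, rfl⟩⟩ : moduliRing k N)

theorem CoordRing.val_crossRatio (q : Fin 4 ↪ N) :
    CoordRing.val k N (CoordRing.crossRatio q) = HypergraphCurve.crossRatio k q := rfl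

theorem CoordRing.adjoin_crossRatio :
    Algebra.adjoin k (Set.range (CoordRing.crossRatio (k := k) (N := N))) = ⊤ := by
  rw [eq_top_iff]
  rintro x -
  have h1 : (Algebra.adjoin k (Set.range (CoordRing.crossRatio (k := k) (N := N)))).map
      (CoordRing.val k N) = moduliRing k N := by
    rw [AlgHom.map_adjoin, ← Set.range_comp]; rfl
  have h2 : CoordRing.val k N x ∈ moduliRing k N := Subtype.prop (p := fun y => y ∈ moduliRing k N) x
  rw [← h1] at h2
  obtain ⟨y, hy, hxy⟩ := h2
  rwa [← CoordRing.val_injective hxy]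

theorem CoordRing.algHom_ext {L : Type*} [CommRing L] [Algebra k L] {f g : CoordRing k N →ₐ[k] L}
    (h : ∀ q, f (CoordRing.crossRatio q) = g (CoordRing.crossRatio q)) : f = g := by
  refine AlgHom.ext_of_adjoin_eq_top CoordRing.adjoin_crossRatio ?_
  rintro _ ⟨q, rfl⟩
  exact h q

/-- The evaluation of functions on `M_{0,N}` at a configuration. -/
def CoordRing.eval {L : Type u} [CommRing L] [Algebra k L] (v : N → Fin 2 → L)
    (hv : IsConfiguration v) : CoordRing k N →ₐ[k] L :=
  (ConfigRing.eval v hv).comp (CoordRing.val k N)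

theorem CoordRing.eval_crossRatio {L : Type u} [CommRing L] [Algebra k L] (v : N → Fin 2 → L)
    (hv : IsConfiguration v) (q : Fin 4 ↪ N) :
    CoordRing.eval v hv (CoordRing.crossRatio (k := k) q) *
      (bracket v (q 0) (q 3) * bracket v (q 1) (q 2)) =
      bracket v (q 0) (q 2) * bracket v (q 1) (q 3) :=
  ConfigRing.eval_crossRatio v hv q

end CoordRing

/-! ### Affine coordinates on the moduli space after moving three points. -/

section Coordinates

variable {k : Type u} [Field k] {N : Type} {L : Type u} [CommRing L] [Algebra k L]

theorem bracket_map {R S : Type*} [CommRing R] [CommRing S] (f : R →+* S) (v : N → Fin 2 → R)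
    (i j : N) : bracket (fun i e => f (v i e)) i j = f (bracket v i j) := by
  simp [bracket]

/-- Each label occurs once in the numerator and once in the denominator of a cross-ratio, so
rescaling the vectors by `c` and all brackets by `d` has no effect. -/
theorem CoordRing.eval_eq_of_bracket {v v' : N → Fin 2 → L} (hv : IsConfiguration v)
    (hv' : IsConfiguration v') {c : N → L} {d : L}
    (h : ∀ i j, bracket v' i j = c i * c j * d * bracket v i j) :
    CoordRing.eval (k := k) v' hv' = CoordRing.eval v hv := by
  refine CoordRing.algHom_ext fun q => ?_
  have h1 := CoordRing.eval_crossRatio (k := k) v hv q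
  have h2 := CoordRing.eval_crossRatio (k := k) v' hv' q
  have u : IsUnit (bracket v' (q 0) (q 3) * bracket v' (q 1) (q 2)) :=
    (hv' _ _ (q.injective.ne (by decide))).mul (hv' _ _ (q.injective.ne (by decide)))
  refine u.mul_right_cancel (h2.trans ?_)
  rw [h, h, h, h]
  linear_combination (-c (q 0) * c (q 1) * c (q 2) * c (q 3) * d ^ 2) * h1

variable [DecidableEq N]

variable (k) in
/-- The cross-ratio of four labels, as an element of the coordinate ring of `M_{0,N}` (and zero,
if the labels are not distinct). -/
def cr (a b c d : N) : CoordRing k N :=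
  if h : Function.Injective ![a, b, c, d] then CoordRing.crossRatio ⟨![a, b, c, d], h⟩ else 0

omit [DecidableEq N] in
theorem injective_quadruple {a b c d : N} (hab : a ≠ b) (hac : a ≠ c) (had : a ≠ d) (hbc : b ≠ c)
    (hbd : b ≠ d) (hcd : c ≠ d) : Function.Injective ![a, b, c, d] := by
  intro i j h
  fin_cases i <;> fin_cases j <;> simp_all

/-- The generic vectors in the configuration space. -/
def universalVector (i : N) (e : Fin 2) : ConfigRing k N :=
  algebraMap (MvPolynomial (N × Fin 2) k) (ConfigRing k N) (genericVector k N i e)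

omit [DecidableEq N] in
theorem isConfiguration_universalVector : IsConfiguration (universalVector (k := k) (N := N)) := by
  intro i j hij
  have h := IsLocalization.map_units (ConfigRing k N) (⟨_, bracket_mem_bracketSubmonoid
    (k := k) hij⟩ : bracketSubmonoid k N)
  simpa [bracket, universalVector] using h

theorem cr_mul_universalVector {a b c d : N} (h : Function.Injective ![a, b, c, d]) :
    CoordRing.val k N (cr k a b c d) *
      (bracket (universalVector (k := k)) a d * bracket (universalVector (k := k)) b c) =
      bracket (universalVector (k := k)) a c * bracket (universalVector (k := k)) b d := by
  have := crossRatio_mul (k := k) ⟨![a, b, c, d], h⟩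
  rw [cr, dif_pos h]
  simpa [bracket, universalVector, CoordRing.val_crossRatio] using this

variable (k) in
/-- The coordinate of the point with label `i` if the points with labels `o`, `z` and `e` are moved
to infinity, zero and one. -/
def coordinate (o z e i : N) : CoordRing k N :=
  if i = e then 1 else if i = z then 0 else cr k i e z o

variable (k) in
/-- The vectors which represent the marked points if the points with labels `o`, `z` and `e` are
moved to infinity, zero and one. -/
def normalizedVector (o z e i : N) : Fin 2 → CoordRing k N :=
  if i = o then ![1, 0] else ![coordinate k o z e i, 1]

variable {o z e : N}

/-- The normalized vector of `i` is a unit multiple of `([i z][e o], [i o][e z])`, the image of the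
generic vector under a linear map with determinant `[e z][e o][z o]`. -/
theorem exists_bracket_normalizedVector (hoz : o ≠ z) (hoe : o ≠ e) (hze : z ≠ e) :
    ∃ (c : N → ConfigRing k N) (d : ConfigRing k N), (∀ i, IsUnit (c i)) ∧ IsUnit d ∧
      ∀ i j, bracket (fun i e' => CoordRing.val k N (normalizedVector k o z e i e')) i j =
        c i * c j * d * bracket (universalVector (k := k)) i j := by
  set V := universalVector (k := k) (N := N) with hV
  have hu := isConfiguration_universalVector (k := k) (N := N)
  rw [← hV] at hu
  obtain ⟨U, hU⟩ := hu e z hze.symm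
  obtain ⟨W, hW⟩ := hu e o hoe.symm
  obtain ⟨X, hX⟩ := hu z o hoz.symm
  have hi : ∀ i, ∃ c, IsUnit c ∧
      CoordRing.val k N (normalizedVector k o z e i 0) = c * (bracket V i z * bracket V e o) ∧
      CoordRing.val k N (normalizedVector k o z e i 1) = c * (bracket V i o * bracket V e z) := by
    intro i
    by_cases hio : i = o
    · subst hio
      refine ⟨-(↑X⁻¹ * ↑W⁻¹), (X⁻¹.isUnit.mul W⁻¹.isUnit).neg, ?_, ?_⟩
      · have h1 : bracket V i z = - X := by rw [hX]; simp [bracket]; ring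
        have h2 : CoordRing.val k N (normalizedVector k i z e i 0) = 1 := by simp [normalizedVector]
        rw [h2, h1, ← hW]
        linear_combination -((↑X⁻¹ : ConfigRing k N) * ↑X) * W.inv_mul - X.inv_mul
      · have h1 : bracket V i i = 0 := by simp [bracket]; ring
        have h2 : CoordRing.val k N (normalizedVector k i z e i 1) = 0 := by simp [normalizedVector]
        rw [h1, h2]; ring
    · obtain ⟨Y, hY⟩ := hu i o hio
      have h2 : CoordRing.val k N (normalizedVector k o z e i 1) = 1 := by
        simp [normalizedVector, hio]
      have h3 : CoordRing.val k N (normalizedVector k o z e i 0) =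
          CoordRing.val k N (coordinate k o z e i) := by
        simp [normalizedVector, hio]
      have h4 : CoordRing.val k N (coordinate k o z e i) * (Y * U) = bracket V i z * W := by
        rw [hY, hU, hW]
        by_cases hie : i = e
        · subst hie
          simp [coordinate]; ring
        by_cases hiz : i = z
        · subst hiz
          simp [coordinate, hie, bracket]; ring_nf; simp
        · simp only [coordinate, if_neg hie, if_neg hiz]
          exact cr_mul_universalVector (injective_quadruple hie hiz hio hze.symm hoe.symm hoz.symm)
      refine ⟨↑Y⁻¹ * ↑U⁻¹, (Y⁻¹.isUnit.mul U⁻¹.isUnit), ?_, ?_⟩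
      · rw [h3, ← hW, ← h4]
        linear_combination (-CoordRing.val k N (coordinate k o z e i) * ((↑Y⁻¹ : ConfigRing k N) * ↑Y)) * U.inv_mul
          - CoordRing.val k N (coordinate k o z e i) * Y.inv_mul
      · rw [h2, ← hY, ← hU]
        linear_combination (-((↑Y⁻¹ : ConfigRing k N) * ↑Y)) * U.inv_mul - Y.inv_mul
  choose c hc h0 h1 using hi
  refine ⟨c, U * W * X, hc, (U.isUnit.mul W.isUnit).mul X.isUnit, fun i j => ?_⟩
  rw [bracket, h0, h0, h1, h1, hU, hW, hX]
  simp only [bracket]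
  ring

theorem cr_mul_normalizedVector (hoz : o ≠ z) (hoe : o ≠ e) (hze : z ≠ e) {a b c d : N}
    (h : Function.Injective ![a, b, c, d]) :
    cr k a b c d * (bracket (normalizedVector k o z e) a d * bracket (normalizedVector k o z e) b c) =
      bracket (normalizedVector k o z e) a c * bracket (normalizedVector k o z e) b d := by
  obtain ⟨t, s, -, -, hb⟩ := exists_bracket_normalizedVector (k := k) hoz hoe hze
  have hb' : ∀ i j, CoordRing.val k N (bracket (normalizedVector k o z e) i j) =
      t i * t j * s * bracket (universalVector (k := k)) i j := fun i j => by
    rw [← hb]; simp [bracket]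
  apply CoordRing.val_injective
  simp only [map_mul]
  simp only [hb']
  linear_combination (t a * t b * t c * t d * s ^ 2) * cr_mul_universalVector (k := k) h

/-- Exchanging the first two labels inverts the cross-ratio, so the inverse already lies in the ring
generated by the cross-ratios. -/
theorem isUnit_cr {a b c d : N} (h : Function.Injective ![a, b, c, d]) : IsUnit (cr k a b c d) := by
  have h' : Function.Injective ![b, a, c, d] := by
    have : ![b, a, c, d] = ![a, b, c, d] ∘ (Equiv.swap 0 1) := by
      funext i; fin_cases i <;> rfl
    rw [this]
    exact h.comp (Equiv.injective _)
  refine IsUnit.of_mul_eq_one (cr k b a c d) ?_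
  have h1 := cr_mul_universalVector (k := k) h
  have h2 := cr_mul_universalVector (k := k) h'
  have hu := isConfiguration_universalVector (k := k) (N := N)
  have ne : ∀ {i j : Fin 4}, i ≠ j → ![a, b, c, d] i ≠ ![a, b, c, d] j := fun hij => h.ne hij
  apply CoordRing.val_injective
  have u := ((hu a d (ne (i := 0) (j := 3) (by decide))).mul
    (hu b c (ne (i := 1) (j := 2) (by decide)))).mul
    ((hu b d (ne (i := 1) (j := 3) (by decide))).mul (hu a c (ne (i := 0) (j := 2) (by decide))))
  refine u.mul_right_cancel ?_
  rw [map_mul, map_one]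
  linear_combination CoordRing.val k N (cr k b a c d) * (bracket universalVector b d *
    bracket universalVector a c) * h1 + bracket universalVector a c * bracket universalVector b d * h2

/-- By the Plücker relation, `1 - cr` is the cross-ratio with the two middle labels exchanged. -/
theorem isUnit_one_sub_cr {a b c d : N} (h : Function.Injective ![a, b, c, d]) :
    IsUnit (1 - cr k a b c d) := by
  have h' : Function.Injective ![a, c, b, d] := by
    have : ![a, c, b, d] = ![a, b, c, d] ∘ (Equiv.swap 1 2) := by
      funext i; fin_cases i <;> rfl
    rw [this]
    exact h.comp (Equiv.injective _)
  have : 1 - cr k a b c d = cr k a c b d := by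
    have h1 := cr_mul_universalVector (k := k) h
    have h2 := cr_mul_universalVector (k := k) h'
    have hu := isConfiguration_universalVector (k := k) (N := N)
    have ne : ∀ {i j : Fin 4}, i ≠ j → ![a, b, c, d] i ≠ ![a, b, c, d] j := fun hij => h.ne hij
    apply CoordRing.val_injective
    have u := ((hu a d (ne (i := 0) (j := 3) (by decide))).mul
      (hu b c (ne (i := 1) (j := 2) (by decide))))
    refine u.mul_right_cancel ?_
    rw [map_sub, map_one, sub_mul, h1]
    simp only [bracket] at h2 ⊢
    linear_combination h2
  rw [this]
  exact isUnit_cr h'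

/-- The brackets have to be invertible in the coordinate ring of the moduli space, not merely in the
larger `ConfigRing`. Differences of two finite coordinates are `-x_j (1 - cr)`, a product of units.
-/
theorem isConfiguration_normalizedVector (hoz : o ≠ z) (hoe : o ≠ e) (hze : z ≠ e) :
    IsConfiguration (normalizedVector k o z e) := by
  have hfin : ∀ i, i ≠ o → i ≠ z → IsUnit (coordinate k o z e i) := by
    intro i ho hz
    by_cases he : i = e
    · simp [coordinate, he]
    · simp only [coordinate, he, hz, if_false]
      exact isUnit_cr (injective_quadruple he hz ho hze.symm hoe.symm hoz.symm)
  have hdiff : ∀ i j, i ≠ j → i ≠ o → j ≠ o → i ≠ z → j ≠ z →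
      IsUnit (coordinate k o z e i - coordinate k o z e j) := by
    intro i j hij hio hjo hiz hjz
    have hq := injective_quadruple hij hiz hio hjz hjo hoz.symm
    have h := cr_mul_normalizedVector (k := k) hoz hoe hze hq
    have : coordinate k o z e i - coordinate k o z e j =
        -(coordinate k o z e j * (1 - cr k i j z o)) := by
      simp [bracket, normalizedVector, hio, hjo, hoz.symm] at h
      have hz : coordinate k o z e z = 0 := by simp [coordinate, hze]
      rw [hz] at h
      linear_combination h
    rw [this]
    exact ((hfin j hjo hjz).mul (isUnit_one_sub_cr hq)).neg
  intro i j hij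
  by_cases hio : i = o
  · subst hio
    simp [bracket, normalizedVector, hij.symm]
  by_cases hjo : j = o
  · subst hjo
    simp [bracket, normalizedVector, hij]
  have hz : coordinate k o z e z = 0 := by simp [coordinate, hze]
  simp only [bracket, normalizedVector, if_neg hio, if_neg hjo]
  simp only [Matrix.cons_val_zero, Matrix.cons_val_one, mul_one, one_mul]
  by_cases hiz : i = z
  · rw [hiz, hz, zero_sub]
    exact (hfin j hjo (fun h => hij (hiz.trans h.symm))).neg
  by_cases hjz : j = z
  · rw [hjz, hz, sub_zero]
    exact hfin i hio hiz
  exact hdiff i j hij hio hjo hiz hjz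

omit [DecidableEq N] in
theorem IsConfiguration.map {R S : Type*} [CommRing R] [CommRing S] (f : R →+* S)
    {v : N → Fin 2 → R} (hv : IsConfiguration v) : IsConfiguration (fun i e => f (v i e)) := by
  intro i j hij
  rw [bracket_map]
  exact (hv i j hij).map f

/-- A homomorphism from the coordinate ring of `M_{0,N}` is the evaluation at a configuration. -/
theorem eq_eval_normalizedVector (hoz : o ≠ z) (hoe : o ≠ e) (hze : z ≠ e)
    (f : CoordRing k N →ₐ[k] L) (r : CoordRing k N) :
    f r = CoordRing.eval (fun i e' => f (normalizedVector k o z e i e'))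
      ((isConfiguration_normalizedVector hoz hoe hze).map (f : CoordRing k N →+* L)) r := by
  set hv := ((isConfiguration_normalizedVector (k := k) hoz hoe hze).map
    (f : CoordRing k N →+* L))
  suffices f = CoordRing.eval _ hv from DFunLike.congr_fun this r
  refine CoordRing.algHom_ext fun q => ?_
  have h1 := CoordRing.eval_crossRatio (k := k) _ hv q
  have hq : Function.Injective ![q 0, q 1, q 2, q 3] :=
    injective_quadruple (q.injective.ne (by decide)) (q.injective.ne (by decide))
      (q.injective.ne (by decide)) (q.injective.ne (by decide)) (q.injective.ne (by decide))
      (q.injective.ne (by decide))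
  have h2 := congrArg f (cr_mul_normalizedVector (k := k) hoz hoe hze hq)
  have h3 : cr k (q 0) (q 1) (q 2) (q 3) =
      CoordRing.crossRatio q := by
    rw [cr, dif_pos hq]
    congr 2
    ext i
    fin_cases i <;> rfl
  have u := (hv (q 0) (q 3) (q.injective.ne (by decide))).mul
    (hv (q 1) (q 2) (q.injective.ne (by decide)))
  refine u.mul_right_cancel (Eq.trans ?_ h1.symm)
  rw [h3] at h2
  rw [map_mul, map_mul, map_mul] at h2
  simp only [bracket_map]
  exact h2

end Coordinates

/-! ### The twelve points in coordinates, and the family over the conic. -/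

section HesseCoordinates

open HesseVertex

variable {k : Type u} [Field k]

variable (k) in
/-- The coordinate of a marked point, if the points `1`, `a` and `p` are moved to `∞, 0, 1`. -/
def hesseCoordinate (i : HesseVertex) : CoordRing k HesseVertex := coordinate k one a p i

/-- The vectors which represent twelve points of the line with the given affine coordinates, if
the points `1`, `a` and `p` are `∞, 0, 1`. -/
def affineVector {R : Type*} [CommRing R] (t : HesseVertex → R) (i : HesseVertex) : Fin 2 → R :=
  if i = one then ![1, 0] else if i = a then ![0, 1] else if i = p then ![1, 1] else ![t i, 1]

theorem normalizedVector_eq (i : HesseVertex) :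
    normalizedVector k one a p i = affineVector (hesseCoordinate k) i := by
  cases i <;> simp [normalizedVector, affineVector, coordinate, hesseCoordinate]

variable {L : Type u} [Field L] [Algebra k L] (f : CoordRing k HesseVertex →ₐ[k] L)

theorem isConfiguration_affineVector :
    IsConfiguration (affineVector (fun i => f (hesseCoordinate k i))) := by
  have := (isConfiguration_normalizedVector (k := k) (o := one) (z := a) (e := p) (by decide)
    (by decide) (by decide)).map (f : CoordRing k HesseVertex →+* L)
  convert this using 3 with i e
  rw [normalizedVector_eq]
  cases i <;> fin_cases e <;> simp [affineVector]

theorem eq_eval_affineVector :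
    f = CoordRing.eval _ (isConfiguration_affineVector f) := by
  ext r
  rw [eq_eval_normalizedVector (o := one) (z := a) (e := p) (by decide) (by decide) (by decide) f r]
  congr 2
  funext i e
  rw [normalizedVector_eq]
  cases i <;> fin_cases e <;> simp [affineVector]

theorem cr_mul_affineVector {i j l r : HesseVertex} (h : Function.Injective ![i, j, l, r]) :
    f (cr k i j l r) * (bracket (affineVector (fun i => f (hesseCoordinate k i))) i r *
      bracket (affineVector (fun i => f (hesseCoordinate k i))) j l) =
      bracket (affineVector (fun i => f (hesseCoordinate k i))) i l *
        bracket (affineVector (fun i => f (hesseCoordinate k i))) j r := by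
  have := congrArg f (cr_mul_normalizedVector (k := k) (o := one) (z := a) (e := p) (by decide)
    (by decide) (by decide) h)
  rw [map_mul, map_mul, map_mul] at this
  have e : ∀ i j, f (bracket (normalizedVector k one a p) i j) =
      bracket (affineVector (fun i => f (hesseCoordinate k i))) i j := by
    intro i j
    simp only [bracket, normalizedVector_eq, map_sub, map_mul]
    cases i <;> cases j <;> simp [affineVector]
  simpa only [e] using this

/-- The quadruples of vertices on the sides and diagonals of the hexagon, and the two quadruples
which contain the vertices `1`, `a`, `p`, whose cross-ratios are constant along the curves
contracted by the hypergraph morphism. -/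
def hesseQuadruple : Fin 11 → HesseVertex × HesseVertex × HesseVertex × HesseVertex :=
  ![(n, p, a, one), (m, p, a, one), (gamma, b, p, one), (two, gamma, n, a), (three, two, m, one),
    (alpha, three, p, a), (c, alpha, n, one), (b, c, m, a), (b, beta, n, three),
    (gamma, beta, m, alpha), (two, beta, p, c)]

variable (k) in
def hesseCr (i : Fin 11) : CoordRing k HesseVertex :=
  cr k (hesseQuadruple i).1 (hesseQuadruple i).2.1 (hesseQuadruple i).2.2.1 (hesseQuadruple i).2.2.2

theorem injective_hesseQuadruple (i : Fin 11) : Function.Injective ![(hesseQuadruple i).1,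
    (hesseQuadruple i).2.1, (hesseQuadruple i).2.2.1, (hesseQuadruple i).2.2.2] := by
  revert i; decide

/-- Dictionary between the hypergraph and the hexagon: the vertices in cyclic order are `b`,
`gamma`, `two`, `three`, `alpha`, `c`, the long diagonals meet in `beta`, and the fixed points `1`,
`u`, `v` are `p`, `n`, `m`. All inequalities express that marked points are distinct. -/
theorem isHesseSolution {K : Type*} [Field K] [Algebra K L] {y : Fin 11 → K}
    (hy : ∀ i, algebraMap K L (y i) = f (hesseCr k i)) :
    IsHesseSolution (y 0) (y 1) (y 2) (y 3) (y 4) (y 5) (y 6) (y 7) (y 8) (y 9) (y 10)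
      (f (hesseCoordinate k b)) (f (hesseCoordinate k gamma)) (f (hesseCoordinate k two))
      (f (hesseCoordinate k three)) (f (hesseCoordinate k alpha)) (f (hesseCoordinate k c))
      (f (hesseCoordinate k beta)) := by
  have ne : ∀ i, y i ≠ 0 := by
    intro i h
    have := ((isUnit_cr (k := k) (injective_hesseQuadruple i)).map f).ne_zero
    apply this
    have := hy i
    rw [h, map_zero] at this
    exact this.symm
  have ne' : ∀ i, y i ≠ 1 := by
    intro i h
    have := ((isUnit_one_sub_cr (k := k) (injective_hesseQuadruple i)).map f).ne_zero
    apply this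
    have := hy i
    rw [h, map_one] at this
    rw [map_sub, map_one]
    exact sub_eq_zero.2 this
  have yn : algebraMap K L (y 0) = f (hesseCoordinate k n) := hy 0
  have ym : algebraMap K L (y 1) = f (hesseCoordinate k m) := hy 1
  have C := isConfiguration_affineVector f
  set v := affineVector (fun i => f (hesseCoordinate k i))
  have D : ∀ i j, i ≠ j → bracket v i j ≠ 0 := fun i j h => (C i j h).ne_zero
  refine ⟨ne 0, ne 1, ne' 0, ne' 1, ?_, ⟨ne 2, ne 3, ne 4, ne 5, ne 6, ne 7⟩,
    ⟨ne' 2, ne' 3, ne' 4, ne' 5, ne' 6, ne' 7⟩, ⟨ne 8, ne 9, ne 10⟩, ⟨ne' 8, ne' 9, ne' 10⟩,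
    ⟨?_, ?_, ?_, ?_, ?_, ?_⟩, ⟨?_, ?_⟩, ⟨?_, ?_⟩, ⟨?_, ?_⟩, ⟨?_, ?_, ?_⟩, ?_, ?_, ?_, ?_, ?_, ?_,
    ?_, ?_, ?_⟩
  · rw [← (algebraMap K L).injective.ne_iff, yn, ym]
    exact fun h => D n m (by decide) (by simp [bracket, affineVector, v, h])
  · exact fun h => D b a (by decide) (by simp [bracket, affineVector, v, h])
  · exact fun h => D gamma a (by decide) (by simp [bracket, affineVector, v, h])
  · exact fun h => D two a (by decide) (by simp [bracket, affineVector, v, h])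
  · exact fun h => D three a (by decide) (by simp [bracket, affineVector, v, h])
  · exact fun h => D alpha a (by decide) (by simp [bracket, affineVector, v, h])
  · exact fun h => D c a (by decide) (by simp [bracket, affineVector, v, h])
  · exact fun h => D two p (by decide) (by simp [bracket, affineVector, v, h])
  · exact fun h => D c p (by decide) (by simp [bracket, affineVector, v, h])
  · exact fun h => D b n (by decide) (by simp [bracket, affineVector, v, h, yn])
  · exact fun h => D three n (by decide) (by simp [bracket, affineVector, v, h, yn])
  · exact fun h => D gamma m (by decide) (by simp [bracket, affineVector, v, h, ym])
  · exact fun h => D alpha m (by decide) (by simp [bracket, affineVector, v, h, ym])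
  · exact fun h => D beta p (by decide) (by simp [bracket, affineVector, v, h])
  · exact fun h => D beta n (by decide) (by simp [bracket, affineVector, v, h, yn])
  · exact fun h => D beta m (by decide) (by simp [bracket, affineVector, v, h, ym])
  · have h : algebraMap K L (y 2) * (bracket v gamma one * bracket v b p) =
        bracket v gamma p * bracket v b one := by
      rw [hy]; exact cr_mul_affineVector f (injective_hesseQuadruple 2)
    simp [bracket, v, affineVector] at h
    try rw [yn]
    try rw [ym]
    linear_combination h
  · have h : algebraMap K L (y 3) * (bracket v two a * bracket v gamma n) =
        bracket v two n * bracket v gamma a := by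
      rw [hy]; exact cr_mul_affineVector f (injective_hesseQuadruple 3)
    simp [bracket, v, affineVector] at h
    try rw [yn]
    try rw [ym]
    linear_combination -h
  · have h : algebraMap K L (y 4) * (bracket v three one * bracket v two m) =
        bracket v three m * bracket v two one := by
      rw [hy]; exact cr_mul_affineVector f (injective_hesseQuadruple 4)
    simp [bracket, v, affineVector] at h
    try rw [yn]
    try rw [ym]
    linear_combination h
  · have h : algebraMap K L (y 5) * (bracket v alpha a * bracket v three p) =
        bracket v alpha p * bracket v three a := by
      rw [hy]; exact cr_mul_affineVector f (injective_hesseQuadruple 5)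
    simp [bracket, v, affineVector] at h
    try rw [yn]
    try rw [ym]
    linear_combination -h
  · have h : algebraMap K L (y 6) * (bracket v c one * bracket v alpha n) =
        bracket v c n * bracket v alpha one := by
      rw [hy]; exact cr_mul_affineVector f (injective_hesseQuadruple 6)
    simp [bracket, v, affineVector] at h
    try rw [yn]
    try rw [ym]
    linear_combination h
  · have h : algebraMap K L (y 7) * (bracket v b a * bracket v c m) =
        bracket v b m * bracket v c a := by
      rw [hy]; exact cr_mul_affineVector f (injective_hesseQuadruple 7)
    simp [bracket, v, affineVector] at h
    try rw [yn]
    try rw [ym]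
    linear_combination -h
  · have h : algebraMap K L (y 8) * (bracket v b three * bracket v beta n) =
        bracket v b n * bracket v beta three := by
      rw [hy]; exact cr_mul_affineVector f (injective_hesseQuadruple 8)
    simp [bracket, v, affineVector] at h
    try rw [yn]
    try rw [ym]
    linear_combination -h
  · have h : algebraMap K L (y 9) * (bracket v gamma alpha * bracket v beta m) =
        bracket v gamma m * bracket v beta alpha := by
      rw [hy]; exact cr_mul_affineVector f (injective_hesseQuadruple 9)
    simp [bracket, v, affineVector] at h
    try rw [yn]
    try rw [ym]
    linear_combination -h
  · have h : algebraMap K L (y 10) * (bracket v two c * bracket v beta p) =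
        bracket v two p * bracket v beta c := by
      rw [hy]; exact cr_mul_affineVector f (injective_hesseQuadruple 10)
    simp [bracket, v, affineVector] at h
    try rw [yn]
    try rw [ym]
    linear_combination -h

/-- Vectors representing the projection of the points of a dual Hesse configuration from a point
of a conic, depending on a primitive third root of unity `w` and a parameter `s` on the conic. -/
def hesseVector {R : Type*} [CommRing R] (w s : R) : HesseVertex → Fin 2 → R
  | .one => ![1, 0]
  | .a => ![0, 1]
  | .p => ![1, 1]
  | .n => ![w, 1]
  | .m => ![w ^ 2, 1]
  | .b => ![w * s, 1]
  | .gamma => ![-(w ^ 2 * (1 + s)), 1]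
  | .two => ![-(1 + s), s]
  | .three => ![w, s]
  | .alpha => ![-w ^ 2, 1 + s]
  | .c => ![-s, 1 + s]
  | .beta => ![w - s, s - w ^ 2]

theorem map_hesseVector {R S : Type*} [CommRing R] [CommRing S] (g : R →+* S) (w s : R) :
    (fun i e => g (hesseVector w s i e)) = hesseVector (g w) (g s) := by
  funext i e
  cases i <;> fin_cases e <;> simp [hesseVector]

/-- The vectors are affine-linear in `s`, so each bracket is a quadratic polynomial in `s`, whose
coefficients are computed from the values at `0` and `1`. -/
theorem bracket_hesseVector_coeff {R : Type*} [CommRing R] (w s : R) (i j : HesseVertex) :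
    bracket (hesseVector w s) i j = bracket (hesseVector w 0) i j +
      (hesseVector w 0 i 0 * (hesseVector w 1 j 1 - hesseVector w 0 j 1) +
        (hesseVector w 1 i 0 - hesseVector w 0 i 0) * hesseVector w 0 j 1 -
        hesseVector w 0 i 1 * (hesseVector w 1 j 0 - hesseVector w 0 j 0) -
        (hesseVector w 1 i 1 - hesseVector w 0 i 1) * hesseVector w 0 j 0) * s +
      ((hesseVector w 1 i 0 - hesseVector w 0 i 0) * (hesseVector w 1 j 1 - hesseVector w 0 j 1) -
        (hesseVector w 1 i 1 - hesseVector w 0 i 1) * (hesseVector w 1 j 0 - hesseVector w 0 j 0)) *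
        s ^ 2 := by
  have h : ∀ i e, hesseVector w s i e =
      hesseVector w 0 i e + (hesseVector w 1 i e - hesseVector w 0 i e) * s := by
    intro i e
    cases i <;> fin_cases e <;> simp [hesseVector] <;> ring
  simp only [bracket, h i, h j]
  ring

theorem eq_zero_of_quadratic_eq_zero {x y z : k} (h : Polynomial.C x + Polynomial.C y * Polynomial.X +
    Polynomial.C z * Polynomial.X ^ 2 = 0) : x = 0 ∧ y = 0 ∧ z = 0 := by
  have e0 := congrArg (fun q => Polynomial.coeff q 0) h
  have e1 := congrArg (fun q => Polynomial.coeff q 1) h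
  have e2 := congrArg (fun q => Polynomial.coeff q 2) h
  simp [Polynomial.coeff_X, Polynomial.coeff_C] at e0 e1 e2
  exact ⟨e0, e1, e2⟩

-- If a bracket vanished identically, its three coefficients, which are polynomials in `w`, would
-- all vanish; for each pair of distinct vertices this contradicts `w² + w + 1 = 0` and `3 ≠ 0`.
set_option maxHeartbeats 4000000 in
theorem bracket_hesseVector_ne_zero (h3 : (3 : k) ≠ 0) {w : k} (hw : w ^ 2 + w + 1 = 0)
    {i j : HesseVertex} (hij : i ≠ j) :
    bracket (hesseVector (Polynomial.C w) Polynomial.X) i j ≠ 0 := by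
  intro h
  rw [bracket_hesseVector_coeff] at h
  have hC : ∀ t : k, ∀ i e, hesseVector (Polynomial.C w) (Polynomial.C t) i e =
      Polynomial.C (hesseVector w t i e) := fun t i e =>
    (congrFun (congrFun (map_hesseVector Polynomial.C w t) i) e).symm
  have hC0 := hC 0
  have hC1 := hC 1
  rw [Polynomial.C_0] at hC0
  rw [Polynomial.C_1] at hC1
  simp only [bracket, hC0, hC1, ← Polynomial.C_mul, ← Polynomial.C_sub, ← Polynomial.C_add] at h
  obtain ⟨e0, e1, e2⟩ : _ ∧ _ ∧ _ := eq_zero_of_quadratic_eq_zero h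
  clear h hC hC0 hC1
  cases i <;> cases j <;> (first | exact absurd rfl hij | skip) <;>
    simp [hesseVector] at e0 e1 e2 <;> grind

end HesseCoordinates

/-! ### The prime ideal of the family. -/

section HesseIdeal

open HesseVertex

variable {k : Type u} [Field k]

theorem CoordRing.map_eval {N : Type} {L L' : Type u} [CommRing L] [Algebra k L] [CommRing L']
    [Algebra k L'] (g : L →ₐ[k] L') (v : N → Fin 2 → L) (hv : IsConfiguration v) :
    g.comp (CoordRing.eval v hv) = CoordRing.eval (fun i e => g (v i e)) (hv.map (g : L →+* L')) := by
  refine CoordRing.algHom_ext fun q => ?_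
  have h1 := congrArg g (CoordRing.eval_crossRatio (k := k) v hv q)
  have h2 := CoordRing.eval_crossRatio (k := k) _ (hv.map (g : L →+* L')) q
  have u := ((hv.map (g : L →+* L')) (q 0) (q 3) (q.injective.ne (by decide))).mul
    ((hv.map (g : L →+* L')) (q 1) (q 2) (q.injective.ne (by decide)))
  refine u.mul_right_cancel (Eq.trans ?_ h2.symm)
  simp only [bracket_map]
  simp only [map_mul] at h1
  exact h1

theorem CoordRing.eval_congr {N : Type} {L : Type u} [CommRing L] [Algebra k L] {v v' : N → Fin 2 → L}
    (h : v = v') (hv : IsConfiguration v) (hv' : IsConfiguration v') :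
    CoordRing.eval (k := k) v hv = CoordRing.eval v' hv' := by
  subst h; rfl

variable {L : Type u} [Field L] [Algebra k L]

theorem isConfiguration_hesseVector (h3 : (3 : k) ≠ 0) {w : k} (hw : w ^ 2 + w + 1 = 0) {s : L}
    (hs : Transcendental k s) : IsConfiguration (hesseVector (algebraMap k L w) s) := by
  intro i j hij
  have h := map_hesseVector ((Polynomial.aeval s : Polynomial k →ₐ[k] L) : Polynomial k →+* L)
    (Polynomial.C w) Polynomial.X
  simp only [RingHom.coe_coe, Polynomial.aeval_C, Polynomial.aeval_X] at h
  rw [← h]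
  have h' := bracket_map ((Polynomial.aeval s : Polynomial k →ₐ[k] L) : Polynomial k →+* L)
    (hesseVector (Polynomial.C w) Polynomial.X) i j
  simp only [RingHom.coe_coe] at h'
  rw [h', isUnit_iff_ne_zero, ne_eq, ← map_zero (Polynomial.aeval (R := k) s),
    (transcendental_iff_injective.1 hs).eq_iff]
  exact bracket_hesseVector_ne_zero h3 hw hij

theorem transcendental_X_fractionRing :
    Transcendental k (algebraMap (Polynomial k) (FractionRing (Polynomial k)) Polynomial.X) := by
  rw [transcendental_algebraMap_iff (IsFractionRing.injective _ _)]
  exact Polynomial.transcendental_X k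

/-- The prime ideal of the curve which consists of the projections of the points of a dual Hesse
configuration from the points of a conic. -/
def hesseIdeal (h3 : (3 : k) ≠ 0) {w : k} (hw : w ^ 2 + w + 1 = 0) :
    Ideal (CoordRing k HesseVertex) :=
  RingHom.ker (CoordRing.eval _ (isConfiguration_hesseVector h3 hw
    (transcendental_X_fractionRing (k := k))))

theorem hesseIdeal_isPrime (h3 : (3 : k) ≠ 0) {w : k} (hw : w ^ 2 + w + 1 = 0) : (hesseIdeal h3 hw).IsPrime :=
  RingHom.ker_isPrime (CoordRing.eval (k := k) _ (isConfiguration_hesseVector h3 hw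
    (transcendental_X_fractionRing (k := k))))

/-- The field `k(X)` embeds in `L` by `X ↦ s`, so all transcendental parameters define the same
generic point. -/
theorem ker_eval_hesseVector (h3 : (3 : k) ≠ 0) {w : k} (hw : w ^ 2 + w + 1 = 0) {s : L}
    (hs : Transcendental k s) :
    RingHom.ker (CoordRing.eval (k := k) _ (isConfiguration_hesseVector h3 hw hs)) =
      hesseIdeal h3 hw := by
  let g : FractionRing (Polynomial k) →ₐ[k] L :=
    IsFractionRing.liftAlgHom (g := (Polynomial.aeval s : Polynomial k →ₐ[k] L))
      (transcendental_iff_injective.1 hs)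
  have hg : g (algebraMap (Polynomial k) (FractionRing (Polynomial k)) Polynomial.X) = s := by
    simp [g]
  have h := CoordRing.map_eval g _ (isConfiguration_hesseVector h3 hw
    (transcendental_X_fractionRing (k := k)))
  have hv : (fun i e => g (hesseVector (algebraMap k (FractionRing (Polynomial k)) w)
      (algebraMap (Polynomial k) (FractionRing (Polynomial k)) Polynomial.X) i e)) = hesseVector (algebraMap k L w) s := by
    have := map_hesseVector (g : FractionRing (Polynomial k) →+* L)
      (algebraMap k (FractionRing (Polynomial k)) w)
      (algebraMap (Polynomial k) (FractionRing (Polynomial k)) Polynomial.X)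
    simp only [RingHom.coe_coe, hg, AlgHom.commutes] at this
    exact this
  replace h := h.trans (CoordRing.eval_congr hv _ (isConfiguration_hesseVector h3 hw hs))
  rw [← h, hesseIdeal]
  ext r
  simp [RingHom.mem_ker]

variable [IsAlgClosed k]

variable (k) in
/-- The function whose non-vanishing characterizes the configurations with general cross-ratios. -/
def hesseGenericity : CoordRing k HesseVertex :=
  hesseObstruction (hesseCr k 0) (hesseCr k 1) (hesseCr k 2) (hesseCr k 3) (hesseCr k 4)
    (hesseCr k 5) (hesseCr k 6) (hesseCr k 7) (hesseCr k 8)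

theorem map_hesseObstruction {R S : Type*} [CommRing R] [CommRing S] (g : R →+* S)
    (u v y0 y1 y2 y3 y4 y5 A0 : R) : g (hesseObstruction u v y0 y1 y2 y3 y4 y5 A0) =
      hesseObstruction (g u) (g v) (g y0) (g y1) (g y2) (g y3) (g y4) (g y5) (g A0) := by
  simp [hesseObstruction]

theorem exists_cube_root : ∃ w : k, w ^ 2 + w + 1 = 0 := by
  have hd : (Polynomial.X ^ 2 + Polynomial.X + 1 : Polynomial k).degree = 2 := by compute_degree!
  obtain ⟨w, hw⟩ := IsAlgClosed.exists_root (Polynomial.X ^ 2 + Polynomial.X + 1 : Polynomial k)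
    (by rw [hd]; decide)
  exact ⟨w, by simpa using hw⟩

/-- A one-parameter family of configurations of twelve points on the line with constant
cross-ratios on the hyperedges of the dual Hesse hypergraph and nonconstant coordinates is one
of the two families given by the conics, if the cross-ratios are sufficiently general. -/
theorem exists_eq_eval_hesseVector (h3 : (3 : k) ≠ 0) {K : Type*} [Field K] [Algebra k K]
    [Algebra K L] [IsScalarTower k K L] (f : CoordRing k HesseVertex →ₐ[k] L) {y : Fin 11 → K}
    (hy : ∀ i, algebraMap K L (y i) = f (hesseCr k i)) (hx : Transcendental K (f (hesseCoordinate k gamma)))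
    (hg : f (hesseGenericity k) ≠ 0) :
    ∃ (w : k) (hw : w ^ 2 + w + 1 = 0) (s : L) (hs : Transcendental k s),
      f = CoordRing.eval _ (isConfiguration_hesseVector h3 hw hs) := by
  have : Infinite k := IsAlgClosed.instInfinite
  have : Infinite K := Infinite.of_injective _ (algebraMap k K).injective
  have hg' : hesseObstruction (y 0) (y 1) (y 2) (y 3) (y 4) (y 5) (y 6) (y 7) (y 8) ≠ 0 := by
    intro h
    apply hg
    have := map_hesseObstruction (f : CoordRing k HesseVertex →+* L) (hesseCr k 0) (hesseCr k 1)
      (hesseCr k 2) (hesseCr k 3) (hesseCr k 4) (hesseCr k 5) (hesseCr k 6) (hesseCr k 7)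
      (hesseCr k 8)
    simp only [RingHom.coe_coe, ← hy, ← map_hesseObstruction] at this
    rw [h, map_zero] at this
    exact this
  obtain ⟨hu, hv, s, hs, F⟩ := (isHesseSolution f hy).isHesseFamily hx hg'
  -- The constant `u` of the larger field is a root of `w² + w + 1`, hence already lies in the
  -- algebraically closed field `k`.
  obtain ⟨w, hw, huw⟩ : ∃ w : k, w ^ 2 + w + 1 = 0 ∧ y 0 = algebraMap k K w := by
    obtain ⟨w, hw⟩ := exists_cube_root (k := k)
    have hW : algebraMap k K w ^ 2 + algebraMap k K w + 1 = 0 := by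
      rw [← map_pow, ← map_add, ← map_one (algebraMap k K), ← map_add, hw, map_zero]
    have : (y 0 - algebraMap k K w) * (y 0 - algebraMap k K w ^ 2) = 0 := by
      linear_combination hu + (algebraMap k K w - y 0 - 1) * hW
    rcases mul_eq_zero.1 this with h | h
    · exact ⟨w, hw, sub_eq_zero.1 h⟩
    · exact ⟨w ^ 2, by linear_combination (w ^ 2 - w + 1) * hw, by
        rw [map_pow]; exact sub_eq_zero.1 h⟩
  have hs' : Transcendental k s := fun h => hs (h.tower_top K)
  refine ⟨w, hw, s, hs', ?_⟩
  have huL : algebraMap K L (y 0) = algebraMap k L w := by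
    rw [huw, ← IsScalarTower.algebraMap_apply]
  have hn : f (hesseCoordinate k n) = algebraMap k L w := (hy 0).symm.trans huL
  have hm : f (hesseCoordinate k m) = algebraMap k L w ^ 2 := by
    have := (hy 1).symm
    rw [hv, map_pow, huL] at this
    exact this
  rw [huL] at F
  rw [eq_eval_affineVector f]
  -- The denominators of the affine coordinates, which are cleared in `hesseVector`.
  let t : HesseVertex → L := fun i => match i with
    | .two => s
    | .three => s
    | .alpha => 1 + s
    | .c => 1 + s
    | .beta => s - algebraMap k L w ^ 2
    | _ => 1
  have ht : ∀ i e, hesseVector (algebraMap k L w) s i e =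
      t i * affineVector (fun i => f (hesseCoordinate k i)) i e := by
    intro i e
    cases i <;> fin_cases e <;> simp [hesseVector, affineVector, t, hn, hm, F.h0_eq, F.h1_eq] <;>
      first
      | linear_combination -F.h2_eq
      | linear_combination -F.h3_eq
      | linear_combination -F.h4_eq
      | linear_combination -F.h5_eq
      | linear_combination -F.β_eq
  refine (CoordRing.eval_eq_of_bracket (c := t) (d := 1) _ _ fun i j => ?_).symm
  simp only [bracket, ht]
  ring

end HesseIdeal

/-! ### Dual Hesse configurations and their normal form. -/

section DualHesse

open HesseVertex

variable {k : Type u} [Field k]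

/-- The dual Hesse configuration in normal form: three coordinate points and the nine points with
coordinates in the third roots of unity. -/
def hessePoint {R : Type*} [CommRing R] (w : R) : HesseVertex → Fin 3 → R
  | .m => ![1, 0, 0]
  | .n => ![0, 1, 0]
  | .p => ![0, 0, 1]
  | .one => ![1, 1, 1]
  | .two => ![w, 1, 1]
  | .three => ![w ^ 2, 1, 1]
  | .a => ![w, w ^ 2, 1]
  | .b => ![w ^ 2, w ^ 2, 1]
  | .c => ![1, w ^ 2, 1]
  | .alpha => ![1, w, 1]
  | .beta => ![w ^ 2, w, 1]
  | .gamma => ![w, w, 1]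

/-- A triple product, as a polynomial expression. -/
def det3 {R : Type*} [CommRing R] (x y z : Fin 3 → R) : R :=
  x 0 * (y 1 * z 2 - y 2 * z 1) - x 1 * (y 0 * z 2 - y 2 * z 0) + x 2 * (y 0 * z 1 - y 1 * z 0)

theorem det_eq_det3 {R : Type*} [CommRing R] (x y z : Fin 3 → R) :
    (Matrix.of ![x, y, z]).det = det3 x y z := by
  simp [Matrix.det_fin_three, det3]; ring

theorem det3_mulVec (G : Matrix (Fin 3) (Fin 3) k) (x y z : Fin 3 → k) :
    det3 (G.mulVec x) (G.mulVec y) (G.mulVec z) = G.det * det3 x y z := by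
  simp [Matrix.det_fin_three, det3, Matrix.mulVec, dotProduct, Fin.sum_univ_three]; ring

/-- The Eisenstein integers. -/
def eisensteinMul (x y : ℤ × ℤ) : ℤ × ℤ :=
  (x.1 * y.1 - x.2 * y.2, x.1 * y.2 + x.2 * y.1 - x.2 * y.2)

def eisensteinDet (x y z : Fin 3 → ℤ × ℤ) : ℤ × ℤ :=
  eisensteinMul (x 0) (eisensteinMul (y 1) (z 2) - eisensteinMul (y 2) (z 1)) -
    eisensteinMul (x 1) (eisensteinMul (y 0) (z 2) - eisensteinMul (y 2) (z 0)) +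
    eisensteinMul (x 2) (eisensteinMul (y 0) (z 1) - eisensteinMul (y 1) (z 0))

def eisensteinPoint : HesseVertex → Fin 3 → ℤ × ℤ
  | .m => ![(1, 0), (0, 0), (0, 0)]
  | .n => ![(0, 0), (1, 0), (0, 0)]
  | .p => ![(0, 0), (0, 0), (1, 0)]
  | .one => ![(1, 0), (1, 0), (1, 0)]
  | .two => ![(0, 1), (1, 0), (1, 0)]
  | .three => ![(-1, -1), (1, 0), (1, 0)]
  | .a => ![(0, 1), (-1, -1), (1, 0)]
  | .b => ![(-1, -1), (-1, -1), (1, 0)]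
  | .c => ![(1, 0), (-1, -1), (1, 0)]
  | .alpha => ![(1, 0), (0, 1), (1, 0)]
  | .beta => ![(-1, -1), (0, 1), (1, 0)]
  | .gamma => ![(0, 1), (0, 1), (1, 0)]

-- A finite check in `ℤ[ω]`: the determinants of collinear triples vanish, and those of the other
-- triples have norm a power of `3`, hence stay nonzero in every field where `3` is invertible.
set_option maxRecDepth 100000 in
theorem eisensteinDet_eq_zero_iff (i j l : HesseVertex) (hij : i ≠ j) (hil : i ≠ l) (hjl : j ≠ l) :
    (∃ e, i ∈ dualHesseEdge e ∧ j ∈ dualHesseEdge e ∧ l ∈ dualHesseEdge e) ∧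
      eisensteinDet (eisensteinPoint i) (eisensteinPoint j) (eisensteinPoint l) = (0, 0) ∨
    ¬ (∃ e, i ∈ dualHesseEdge e ∧ j ∈ dualHesseEdge e ∧ l ∈ dualHesseEdge e) ∧
      ∃ r : Fin 4, (eisensteinDet (eisensteinPoint i) (eisensteinPoint j) (eisensteinPoint l)).1 ^ 2 -
        (eisensteinDet (eisensteinPoint i) (eisensteinPoint j) (eisensteinPoint l)).1 *
        (eisensteinDet (eisensteinPoint i) (eisensteinPoint j) (eisensteinPoint l)).2 +
        (eisensteinDet (eisensteinPoint i) (eisensteinPoint j) (eisensteinPoint l)).2 ^ 2 =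
        3 ^ (r : ℕ) := by
  revert i j l
  decide +kernel

theorem isDualHesseConfiguration_hessePoint (h3 : (3 : k) ≠ 0) {w : k} (hw : w ^ 2 + w + 1 = 0) :
    IsDualHesseConfiguration (hessePoint w) := by
  let φ : ℤ × ℤ → k := fun x => x.1 + x.2 * w
  have hmul : ∀ x y, φ (eisensteinMul x y) = φ x * φ y := by
    intro x y
    simp only [φ, eisensteinMul]
    push_cast
    linear_combination (-(x.2 : k) * y.2) * hw
  have hsub : ∀ x y, φ (x - y) = φ x - φ y := by intro x y; simp [φ]; ring
  have hadd : ∀ x y, φ (x + y) = φ x + φ y := by intro x y; simp [φ]; ring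
  have hpt : ∀ i e, hessePoint w i e = φ (eisensteinPoint i e) := by
    intro i e
    have h2 : w ^ 2 = -1 - w := by linear_combination hw
    cases i <;> fin_cases e <;> simp [hessePoint, eisensteinPoint, φ, h2] <;> ring
  have hdet : ∀ i j l, det3 (hessePoint w i) (hessePoint w j) (hessePoint w l) =
      φ (eisensteinDet (eisensteinPoint i) (eisensteinPoint j) (eisensteinPoint l)) := by
    intro i j l
    simp only [eisensteinDet, hadd, hsub, hmul, ← hpt, det3]
  intro i j l hij hil hjl
  rw [det_eq_det3, hdet]
  rcases eisensteinDet_eq_zero_iff i j l hij hil hjl with ⟨h, h'⟩ | ⟨h, r, h'⟩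
  · simp only [h', h, iff_true]
    simp [φ]
  · simp only [h, iff_false]
    generalize eisensteinDet (eisensteinPoint i) (eisensteinPoint j) (eisensteinPoint l) = x at h'
    intro h0
    have h1 := congrArg (Int.cast (R := k)) h'
    push_cast at h1
    apply pow_ne_zero (r : ℕ) h3
    rw [← h1]
    simp only [φ] at h0
    -- The first factor is the conjugate of `x.1 + x.2 w`, so the product with it is the norm.
    linear_combination (x.1 - x.2 - w * x.2) * h0 + (x.2 : k) ^ 2 * hw

/-- Every dual Hesse configuration is projectively equivalent to the normal form. -/
theorem IsDualHesseConfiguration.exists_eq_smul {P : HesseVertex → Fin 3 → k}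
    (hP : IsDualHesseConfiguration P) :
    ∃ w : k, w ^ 2 + w + 1 = 0 ∧ ∃ (G : Matrix (Fin 3) (Fin 3) k) (t : HesseVertex → k),
      G.det ≠ 0 ∧ (∀ i, t i ≠ 0) ∧ ∀ i, P i = t i • G.mulVec (hessePoint w i) := by
  -- The noncollinear points `m`, `n`, `p` become the coordinate points; no other point lies on the
  -- sides of this triangle, so all its coordinates are nonzero (`nz`).
  let M : Matrix (Fin 3) (Fin 3) k := (Matrix.of ![P m, P n, P p]).transpose
  have hM : M.det ≠ 0 := by
    rw [Matrix.det_transpose, ne_eq, hP m n p (by decide) (by decide) (by decide)]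
    decide
  have hMu : IsUnit M.det := hM.isUnit
  obtain ⟨y, hy⟩ : ∃ y : HesseVertex → Fin 3 → k, ∀ i, P i = M.mulVec (y i) :=
    ⟨fun i => M⁻¹.mulVec (P i), fun i => by
      simp [Matrix.mulVec_mulVec, Matrix.mul_nonsing_inv M hMu]⟩
  have hdet : ∀ i j l, i ≠ j → i ≠ l → j ≠ l → (det3 (y i) (y j) (y l) = 0 ↔
      ∃ e, i ∈ dualHesseEdge e ∧ j ∈ dualHesseEdge e ∧ l ∈ dualHesseEdge e) := by
    intro i j l hij hil hjl
    rw [← hP i j l hij hil hjl, det_eq_det3, hy i, hy j, hy l, det3_mulVec, mul_eq_zero,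
      or_iff_right hM]
  have inj : ∀ x z : Fin 3 → k, M.mulVec x = M.mulVec z → x = z := by
    intro x z h
    have := congrArg M⁻¹.mulVec h
    simpa [Matrix.mulVec_mulVec, Matrix.nonsing_inv_mul M hMu] using this
  have ym : y m = ![1, 0, 0] := by
    apply inj; rw [← hy]; funext e; fin_cases e <;> simp [M, Matrix.mulVec, dotProduct, Fin.sum_univ_three]
  have yn : y n = ![0, 1, 0] := by
    apply inj; rw [← hy]; funext e; fin_cases e <;> simp [M, Matrix.mulVec, dotProduct, Fin.sum_univ_three]
  have yp : y p = ![0, 0, 1] := by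
    apply inj; rw [← hy]; funext e; fin_cases e <;> simp [M, Matrix.mulVec, dotProduct, Fin.sum_univ_three]
  have nz : ∀ i, i ≠ m → i ≠ n → i ≠ p → y i 0 ≠ 0 ∧ y i 1 ≠ 0 ∧ y i 2 ≠ 0 := by
    intro i h1 h2 h3
    have a1 := (hdet n p i (by decide) h2.symm h3.symm).not
    have a2 := (hdet m p i (by decide) h1.symm h3.symm).not
    have a3 := (hdet m n i (by decide) h1.symm h2.symm).not
    rw [ym, yn] at a3
    rw [ym, yp] at a2
    rw [yn, yp] at a1
    simp [det3] at a1 a2 a3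
    have key : ∀ i, i ≠ m → i ≠ n → i ≠ p →
        (∀ x, n ∈ dualHesseEdge x → p ∈ dualHesseEdge x → i ∉ dualHesseEdge x) ∧
        (∀ x, m ∈ dualHesseEdge x → p ∈ dualHesseEdge x → i ∉ dualHesseEdge x) ∧
        (∀ x, m ∈ dualHesseEdge x → n ∈ dualHesseEdge x → i ∉ dualHesseEdge x) := by decide
    obtain ⟨k1, k2, k3⟩ := key i h1 h2 h3
    exact ⟨a1.2 k1, a2.2 k2, a3.2 k3⟩
  have lp : ∀ i j, i ≠ j → i ≠ p → j ≠ p → (∃ e, p ∈ dualHesseEdge e ∧ i ∈ dualHesseEdge e ∧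
      j ∈ dualHesseEdge e) → y i 0 * y j 1 - y i 1 * y j 0 = 0 := by
    intro i j hij h1 h2 h
    have := (hdet p i j h1.symm h2.symm hij).2 h
    rw [yp] at this
    simp [det3] at this
    linear_combination this
  have ln : ∀ i j, i ≠ j → i ≠ n → j ≠ n → (∃ e, n ∈ dualHesseEdge e ∧ i ∈ dualHesseEdge e ∧
      j ∈ dualHesseEdge e) → y i 0 * y j 2 - y i 2 * y j 0 = 0 := by
    intro i j hij h1 h2 h
    have := (hdet n i j h1.symm h2.symm hij).2 h
    rw [yn] at this
    simp [det3] at this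
    linear_combination -this
  have lm : ∀ i j, i ≠ j → i ≠ m → j ≠ m → (∃ e, m ∈ dualHesseEdge e ∧ i ∈ dualHesseEdge e ∧
      j ∈ dualHesseEdge e) → y i 1 * y j 2 - y i 2 * y j 1 = 0 := by
    intro i j hij h1 h2 h
    have := (hdet m i j h1.symm h2.symm hij).2 h
    rw [ym] at this
    simp [det3] at this
    linear_combination this
  obtain ⟨d0, d1, d2⟩ := nz one (by decide) (by decide) (by decide)
  -- Affine coordinates in which the point `1` is `(1, 1)`. Lines through `p`, `n`, `m` become lines
  -- on which `X : Y`, `X`, `Y` is constant.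
  let X : HesseVertex → k := fun i => y i 0 / y one 0 * (y one 2 / y i 2)
  let Y : HesseVertex → k := fun i => y i 1 / y one 1 * (y one 2 / y i 2)
  have hX : ∀ i, i ≠ m → i ≠ n → i ≠ p → y i 0 = y i 2 / y one 2 * (y one 0 * X i) := by
    intro i h1 h2 h3
    obtain ⟨-, -, h⟩ := nz i h1 h2 h3
    simp only [X]; field_simp
  have hY : ∀ i, i ≠ m → i ≠ n → i ≠ p → y i 1 = y i 2 / y one 2 * (y one 1 * Y i) := by
    intro i h1 h2 h3
    obtain ⟨-, -, h⟩ := nz i h1 h2 h3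
    simp only [Y]; field_simp
  have X1 : X one = 1 := by simp only [X]; field_simp
  have Y1 : Y one = 1 := by simp only [Y]; field_simp
  have Lp : ∀ i j, i ≠ j → i ≠ p → j ≠ p → (∃ e, p ∈ dualHesseEdge e ∧ i ∈ dualHesseEdge e ∧
      j ∈ dualHesseEdge e) → i ≠ m → i ≠ n → j ≠ m → j ≠ n → X i * Y j = Y i * X j := by
    intro i j hij h1 h2 h h3 h4 h5 h6
    have := lp i j hij h1 h2 h
    have z1 := (nz i h3 h4 h1).2.2
    have z2 := (nz j h5 h6 h2).2.2
    rw [hX i h3 h4 h1, hX j h5 h6 h2, hY i h3 h4 h1, hY j h5 h6 h2] at this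
    apply mul_left_cancel₀ (mul_ne_zero (mul_ne_zero (div_ne_zero z1 d2) (div_ne_zero z2 d2))
      (mul_ne_zero d0 d1))
    linear_combination this
  have Ln : ∀ i j, i ≠ j → i ≠ n → j ≠ n → (∃ e, n ∈ dualHesseEdge e ∧ i ∈ dualHesseEdge e ∧
      j ∈ dualHesseEdge e) → i ≠ m → i ≠ p → j ≠ m → j ≠ p → X i = X j := by
    intro i j hij h1 h2 h h3 h4 h5 h6
    have := ln i j hij h1 h2 h
    have z1 := (nz i h3 h1 h4).2.2
    have z2 := (nz j h5 h2 h6).2.2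
    rw [hX i h3 h1 h4, hX j h5 h2 h6] at this
    apply mul_left_cancel₀ (mul_ne_zero (mul_ne_zero (div_ne_zero z1 d2) z2) d0)
    linear_combination this
  have Lm : ∀ i j, i ≠ j → i ≠ m → j ≠ m → (∃ e, m ∈ dualHesseEdge e ∧ i ∈ dualHesseEdge e ∧
      j ∈ dualHesseEdge e) → i ≠ n → i ≠ p → j ≠ n → j ≠ p → Y i = Y j := by
    intro i j hij h1 h2 h h3 h4 h5 h6
    have := lm i j hij h1 h2 h
    have z1 := (nz i h1 h3 h4).2.2
    have z2 := (nz j h2 h5 h6).2.2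
    rw [hY i h1 h3 h4, hY j h2 h5 h6] at this
    apply mul_left_cancel₀ (mul_ne_zero (mul_ne_zero (div_ne_zero z1 d2) z2) d1)
    linear_combination this
  have e1 := Lp one b (by decide) (by decide) (by decide) (by decide) (by decide) (by decide) (by decide) (by decide)
  have e2 := Lp one gamma (by decide) (by decide) (by decide) (by decide) (by decide) (by decide) (by decide) (by decide)
  have e3 := Lm one two (by decide) (by decide) (by decide) (by decide) (by decide) (by decide) (by decide) (by decide)
  have e4 := Lm one three (by decide) (by decide) (by decide) (by decide) (by decide) (by decide) (by decide) (by decide)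
  have e5 := Ln two a (by decide) (by decide) (by decide) (by decide) (by decide) (by decide) (by decide) (by decide)
  have e6 := Ln two gamma (by decide) (by decide) (by decide) (by decide) (by decide) (by decide) (by decide) (by decide)
  have e7 := Lm alpha gamma (by decide) (by decide) (by decide) (by decide) (by decide) (by decide) (by decide) (by decide)
  have e8 := Lm beta gamma (by decide) (by decide) (by decide) (by decide) (by decide) (by decide) (by decide) (by decide)
  have e9 := Ln one c (by decide) (by decide) (by decide) (by decide) (by decide) (by decide) (by decide) (by decide)
  have e10 := Ln one alpha (by decide) (by decide) (by decide) (by decide) (by decide) (by decide) (by decide) (by decide)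
  have e11 := Lp two c (by decide) (by decide) (by decide) (by decide) (by decide) (by decide) (by decide) (by decide)
  have e12 := Lm b c (by decide) (by decide) (by decide) (by decide) (by decide) (by decide) (by decide) (by decide)
  have e13 := Lm b a (by decide) (by decide) (by decide) (by decide) (by decide) (by decide) (by decide) (by decide)
  have e14 := Lp two beta (by decide) (by decide) (by decide) (by decide) (by decide) (by decide) (by decide) (by decide)
  have e15 := Ln three b (by decide) (by decide) (by decide) (by decide) (by decide) (by decide) (by decide) (by decide)
  have e16 := Ln b beta (by decide) (by decide) (by decide) (by decide) (by decide) (by decide) (by decide) (by decide)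
  -- The coordinate of the point `2` determines the configuration: the collinearities express all
  -- other coordinates as powers of `w`, and the last ones give `w³ = 1`.
  obtain ⟨w, hw⟩ : ∃ w, X two = w := ⟨_, rfl⟩
  rw [X1, Y1, one_mul, one_mul] at e1 e2
  rw [Y1] at e3 e4
  rw [X1] at e9 e10
  rw [hw] at e5 e6
  rw [← e6] at e2
  rw [e2] at e7 e8
  rw [hw, ← e3, e8] at e14
  rw [hw, ← e3, ← e9] at e11
  have x2 : w ^ 2 = X beta := by linear_combination e14
  rw [← x2] at e16
  rw [e16] at e1 e15
  rw [e1] at e12 e13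
  have w3 : w ^ 3 = 1 := by rw [← e12] at e11; linear_combination e11
  -- For `w = 1` the points `1` and `2` would coincide, so `1`, `2`, `a` would be collinear although
  -- no hyperedge contains them.
  have hne : w - 1 ≠ 0 := by
    intro h
    have h1 : w = 1 := by linear_combination h
    have := (hdet one two a (by decide) (by decide) (by decide)).not
    refine this.2 (by decide) ?_
    have a0 := hX two (by decide) (by decide) (by decide)
    have a1 := hY two (by decide) (by decide) (by decide)
    rw [hw, h1] at a0
    rw [← e3] at a1
    simp only [det3]
    rw [a0, a1]
    field_simp
    ring
  refine ⟨w, ?_, M * Matrix.diagonal (y one), fun i => match i with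
    | .m => (y one 0)⁻¹
    | .n => (y one 1)⁻¹
    | .p => (y one 2)⁻¹
    | i => y i 2 / y one 2, ?_, ?_, ?_⟩
  · apply mul_left_cancel₀ hne; linear_combination w3
  · rw [Matrix.det_mul, Matrix.det_diagonal, Fin.prod_univ_three]
    exact mul_ne_zero hM (mul_ne_zero (mul_ne_zero d0 d1) d2)
  · have nz' := fun i h1 h2 h3 => div_ne_zero (nz i h1 h2 h3).2.2 d2
    intro i
    cases i
    · exact inv_ne_zero d0
    · exact inv_ne_zero d1
    · exact inv_ne_zero d2
    all_goals exact nz' _ (by decide) (by decide) (by decide)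
  · have F : ∀ i, i ≠ m → i ≠ n → i ≠ p → ∀ {x' y'}, X i = x' → Y i = y' →
        y i = (y i 2 / y one 2) • (Matrix.diagonal (y one)).mulVec ![x', y', 1] := by
      rintro i h1 h2 h3 _ _ rfl rfl
      funext e
      fin_cases e
      · simpa [Matrix.mulVec_diagonal] using hX i h1 h2 h3
      · simpa [Matrix.mulVec_diagonal] using hY i h1 h2 h3
      · simp [Matrix.mulVec_diagonal, d2]
    intro i
    rw [hy i, ← Matrix.mulVec_mulVec, ← Matrix.mulVec_smul]
    congr 1
    cases i
    · rw [ym]; funext e; fin_cases e <;> simp [hessePoint, Matrix.mulVec_diagonal, d0]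
    · rw [yn]; funext e; fin_cases e <;> simp [hessePoint, Matrix.mulVec_diagonal, d1]
    · rw [yp]; funext e; fin_cases e <;> simp [hessePoint, Matrix.mulVec_diagonal, d2]
    · exact F _ (by decide) (by decide) (by decide) X1 Y1
    · exact F _ (by decide) (by decide) (by decide) hw e3.symm
    · exact F _ (by decide) (by decide) (by decide) e15 e4.symm
    · exact F _ (by decide) (by decide) (by decide) e5.symm e13.symm
    · exact F _ (by decide) (by decide) (by decide) e16 e1
    · exact F _ (by decide) (by decide) (by decide) e9.symm e12.symm
    · exact F _ (by decide) (by decide) (by decide) e10.symm e7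
    · exact F _ (by decide) (by decide) (by decide) x2.symm e8
    · exact F _ (by decide) (by decide) (by decide) e6.symm e2

end DualHesse

/-! ### The conic and the projection from its points. -/

section Conic

open HesseVertex

variable {k : Type u} [Field k]

theorem exists_quadratic_form {Q : MvPolynomial (Fin 3) k} (hQ : Q.IsHomogeneous 2) :
    ∃ c : Fin 6 → k, ∀ x : Fin 3 → k, MvPolynomial.eval x Q = c 0 * x 0 ^ 2 + c 1 * x 1 ^ 2 +
      c 2 * x 2 ^ 2 + c 3 * (x 1 * x 2) + c 4 * (x 2 * x 0) + c 5 * (x 0 * x 1) := by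
  rw [← Q.support_sum_monomial_coeff]
  have : ∀ s ⊆ Q.support, ∃ c : Fin 6 → k, ∀ x : Fin 3 → k,
      MvPolynomial.eval x (∑ v ∈ s, MvPolynomial.monomial v (MvPolynomial.coeff v Q)) =
      c 0 * x 0 ^ 2 + c 1 * x 1 ^ 2 +
      c 2 * x 2 ^ 2 + c 3 * (x 1 * x 2) + c 4 * (x 2 * x 0) + c 5 * (x 0 * x 1) := by
    intro s hs
    induction s using Finset.induction_on with
    | empty => exact ⟨0, by simp⟩
    | insert d s hd ih =>
      obtain ⟨c, hc⟩ := ih (fun x hx => hs (Finset.mem_insert_of_mem hx))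
      have h2 := hQ (MvPolynomial.mem_support_iff.1 (hs (Finset.mem_insert_self d s)))
      rw [Finsupp.weight_apply, Finsupp.sum_fintype _ _ (by simp), Fin.sum_univ_three] at h2
      simp at h2
      have hm : ∃ e : Fin 6 → k, ∀ x : Fin 3 → k,
          MvPolynomial.eval x (MvPolynomial.monomial d (MvPolynomial.coeff d Q)) =
          e 0 * x 0 ^ 2 + e 1 * x 1 ^ 2 +
          e 2 * x 2 ^ 2 + e 3 * (x 1 * x 2) + e 4 * (x 2 * x 0) + e 5 * (x 0 * x 1) := by
        have hx : ∀ x : Fin 3 → k,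
            MvPolynomial.eval x (MvPolynomial.monomial d (MvPolynomial.coeff d Q)) =
            MvPolynomial.coeff d Q * (x 0 ^ d 0 * x 1 ^ d 1 * x 2 ^ d 2) := by
          intro x
          rw [MvPolynomial.eval_monomial, Finsupp.prod_fintype _ _ (by simp), Fin.prod_univ_three]
        simp only [hx]
        generalize MvPolynomial.coeff d Q = r
        have l0 : d 0 ≤ 2 := by omega
        have l1 : d 1 ≤ 2 := by omega
        generalize d 0 = i at *
        generalize d 1 = j at *
        generalize d 2 = l at *
        obtain rfl : l = 2 - i - j := by omega
        interval_cases i <;> interval_cases j <;> first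
          | omega
          | (refine ⟨![r, 0, 0, 0, 0, 0], fun x => ?_⟩; simp [mul_comm]; done)
          | (refine ⟨![0, r, 0, 0, 0, 0], fun x => ?_⟩; simp [mul_comm]; done)
          | (refine ⟨![0, 0, r, 0, 0, 0], fun x => ?_⟩; simp [mul_comm]; done)
          | (refine ⟨![0, 0, 0, r, 0, 0], fun x => ?_⟩; simp [mul_comm]; done)
          | (refine ⟨![0, 0, 0, 0, r, 0], fun x => ?_⟩; simp [mul_comm]; done)
          | (refine ⟨![0, 0, 0, 0, 0, r], fun x => ?_⟩; simp [mul_comm]; done)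
      obtain ⟨e, he⟩ := hm
      refine ⟨e + c, fun x => ?_⟩
      rw [Finset.sum_insert hd, map_add, he, hc]
      simp only [Pi.add_apply]
      ring
  exact this _ subset_rfl

/-- The equation of the conic through five points of the normal form of the dual Hesse
configuration. -/
def hesseConic (w : k) : MvPolynomial (Fin 3) k :=
  .X 1 * .X 2 + .C (w ^ 2) * (.X 2 * .X 0) + .C w * (.X 0 * .X 1)

theorem eval_hesseConic (w : k) (x : Fin 3 → k) : MvPolynomial.eval x (hesseConic w) =
    x 1 * x 2 + w ^ 2 * (x 2 * x 0) + w * (x 0 * x 1) := by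
  simp [hesseConic]

theorem isHomogeneous_hesseConic (w : k) : (hesseConic w).IsHomogeneous 2 := by
  have h : ∀ i j : Fin 3, (MvPolynomial.X i * MvPolynomial.X j : MvPolynomial (Fin 3) k).IsHomogeneous 2 :=
    fun i j => (MvPolynomial.isHomogeneous_X k i).mul (MvPolynomial.isHomogeneous_X k j)
  have h' : ∀ (r : k) (i j : Fin 3), (MvPolynomial.C r * (MvPolynomial.X i * MvPolynomial.X j) :
      MvPolynomial (Fin 3) k).IsHomogeneous 2 := by
    intro r i j
    have := (MvPolynomial.isHomogeneous_C (Fin 3) r).mul (h i j)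
    rwa [zero_add] at this
  exact ((h 1 2).add (h' _ 2 0)).add (h' _ 0 1)

/-- The substitution of linear forms. -/
def substitute (G : Matrix (Fin 3) (Fin 3) k) (Q : MvPolynomial (Fin 3) k) : MvPolynomial (Fin 3) k :=
  MvPolynomial.aeval (fun i => ∑ j, MvPolynomial.C (G i j) * MvPolynomial.X j) Q

theorem eval_substitute (G : Matrix (Fin 3) (Fin 3) k) (Q : MvPolynomial (Fin 3) k) (x : Fin 3 → k) :
    MvPolynomial.eval x (substitute G Q) = MvPolynomial.eval (G.mulVec x) Q := by
  have h : (MvPolynomial.eval x).comp ((MvPolynomial.aeval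
      (fun i => ∑ j, MvPolynomial.C (G i j) * MvPolynomial.X j) :
      MvPolynomial (Fin 3) k →ₐ[k] MvPolynomial (Fin 3) k) : MvPolynomial (Fin 3) k →+* _) =
      MvPolynomial.eval (G.mulVec x) := by
    refine MvPolynomial.ringHom_ext (fun r => by simp) (fun i => ?_)
    simp [Matrix.mulVec, dotProduct]
  exact DFunLike.congr_fun h Q

theorem isHomogeneous_substitute (G : Matrix (Fin 3) (Fin 3) k) {Q : MvPolynomial (Fin 3) k}
    (hQ : Q.IsHomogeneous 2) : (substitute G Q).IsHomogeneous 2 := by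
  have := hQ.aeval (φ := Q) (fun i => ∑ j, MvPolynomial.C (G i j) * MvPolynomial.X j) (n := 1) ?_
  · rwa [one_mul] at this
  · intro i
    refine MvPolynomial.IsHomogeneous.sum _ _ _ fun j _ => ?_
    have := (MvPolynomial.isHomogeneous_C (Fin 3) (G i j)).mul (MvPolynomial.isHomogeneous_X k j)
    rwa [zero_add] at this

theorem eval_smul_of_isHomogeneous {Q : MvPolynomial (Fin 3) k} (hQ : Q.IsHomogeneous 2) (t : k)
    (x : Fin 3 → k) : MvPolynomial.eval (t • x) Q = t ^ 2 * MvPolynomial.eval x Q := by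
  obtain ⟨c, hc⟩ := exists_quadratic_form hQ
  rw [hc, hc]
  simp only [Pi.smul_apply, smul_eq_mul]
  ring

/-- Vanishing at the three coordinate points kills the squares; the other two points impose two
conditions on the mixed coefficients, which are independent because `w ≠ 1`. -/
theorem eq_smul_hesseConic {w : k} (hw : w ^ 2 + w + 1 = 0) (h3 : (3 : k) ≠ 0)
    {Q : MvPolynomial (Fin 3) k} (hQ : Q.IsHomogeneous 2)
    (h : ∀ i ∈ conicEdge, MvPolynomial.eval (hessePoint w i) Q = 0) :
    ∃ c : k, ∀ x, MvPolynomial.eval x Q = c * MvPolynomial.eval x (hesseConic w) := by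
  obtain ⟨c, hc⟩ := exists_quadratic_form hQ
  have hm := h m (by decide)
  have hn := h n (by decide)
  have hp := h p (by decide)
  have h1 := h one (by decide)
  have ha := h a (by decide)
  rw [hc] at hm hn hp h1 ha
  simp [hessePoint] at hm hn hp h1 ha
  rw [hm, hn, hp] at h1 ha
  have hw1 : w - 1 ≠ 0 := by
    intro h
    rw [sub_eq_zero.1 h] at hw
    apply h3
    linear_combination hw
  have e4 : c 4 = w ^ 2 * c 3 := by
    apply mul_left_cancel₀ hw1
    linear_combination ha - h1 - (c 5 + c 3) * (w - 1) * hw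
  refine ⟨c 3, fun x => ?_⟩
  have e5 : c 5 = w * c 3 := by linear_combination h1 - e4 - c 3 * hw
  rw [hc, eval_hesseConic, hm, hn, hp, e4, e5]
  ring

/-- The equation of the conic through five points of a dual Hesse configuration. -/
theorem isConicThrough_and_unique [Infinite k] {P : HesseVertex → Fin 3 → k} {w : k}
    (hw : w ^ 2 + w + 1 = 0)
    (h3 : (3 : k) ≠ 0) {G : Matrix (Fin 3) (Fin 3) k} {t : HesseVertex → k} (hG : G.det ≠ 0)
    (ht : ∀ i, t i ≠ 0) (hP : ∀ i, P i = t i • G.mulVec (hessePoint w i)) :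
    IsConicThrough P conicEdge (substitute G⁻¹ (hesseConic w)) ∧
      ∀ Q', IsConicThrough P conicEdge Q' → ∃ c : k, Q' = c • substitute G⁻¹ (hesseConic w) := by
  have hGG : ∀ x, G⁻¹.mulVec (G.mulVec x) = x := by
    intro x; rw [Matrix.mulVec_mulVec, Matrix.nonsing_inv_mul G hG.isUnit, Matrix.one_mulVec]
  have hGG' : ∀ x, G.mulVec (G⁻¹.mulVec x) = x := by
    intro x; rw [Matrix.mulVec_mulVec, Matrix.mul_nonsing_inv G hG.isUnit, Matrix.one_mulVec]
  refine ⟨⟨isHomogeneous_substitute _ (isHomogeneous_hesseConic w), ?_, ?_⟩, ?_⟩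
  · intro h
    have := eval_substitute G⁻¹ (hesseConic w) (G.mulVec ![0, 1, 1])
    rw [h, hGG, eval_hesseConic] at this
    simp at this
  · intro i hi
    rw [eval_substitute, hP, Matrix.mulVec_smul, hGG,
      eval_smul_of_isHomogeneous (isHomogeneous_hesseConic w), eval_hesseConic]
    simp only [conicEdge, Finset.mem_insert, Finset.mem_singleton] at hi
    rcases hi with rfl | rfl | rfl | rfl | rfl <;> simp [hessePoint]
    · right; linear_combination hw
    · right; linear_combination w ^ 2 * hw
  · rintro Q' ⟨h1, -, h2⟩
    obtain ⟨c, hc⟩ := eq_smul_hesseConic hw h3 (isHomogeneous_substitute G h1) (fun i hi => by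
      have := h2 i hi
      rw [hP, eval_smul_of_isHomogeneous h1] at this
      rw [eval_substitute]
      exact (mul_eq_zero.1 this).resolve_left (pow_ne_zero 2 (ht i)))
    refine ⟨c, MvPolynomial.funext fun x => ?_⟩
    have := hc (G⁻¹.mulVec x)
    rw [eval_substitute, hGG'] at this
    rw [this, MvPolynomial.smul_eval, eval_substitute]

/-- A linear map onto the plane with a given kernel. -/
theorem exists_bracket_eq_det3 {x : Fin 3 → k} (L : (Fin 3 → k) →ₗ[k] (Fin 2 → k))
    (hL : LinearMap.ker L = Submodule.span k {x}) :
    ∃ d : k, ∀ y z : Fin 3 → k, L y 0 * L z 1 - L y 1 * L z 0 = d * det3 x y z := by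
  let l : Fin 2 → Fin 3 → k := fun e j => L (Pi.single j 1) e
  have hl : ∀ y e, L y e = l e 0 * y 0 + l e 1 * y 1 + l e 2 * y 2 := by
    intro y e
    have : y = y 0 • Pi.single 0 1 + y 1 • Pi.single 1 1 + y 2 • Pi.single 2 1 := by
      funext j; fin_cases j <;> simp
    conv_lhs => rw [this]
    simp [l]; ring
  -- The cross product of the two rows of `L` lies in its kernel, hence is a multiple `d x`; pairing
  -- it with the cross product of `y` and `z` gives the bracket.
  have hk : (![l 0 1 * l 1 2 - l 0 2 * l 1 1, l 0 2 * l 1 0 - l 0 0 * l 1 2,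
      l 0 0 * l 1 1 - l 0 1 * l 1 0] : Fin 3 → k) ∈ LinearMap.ker L := by
    rw [LinearMap.mem_ker]
    funext e
    rw [hl]
    fin_cases e <;> simp <;> ring
  rw [hL, Submodule.mem_span_singleton] at hk
  obtain ⟨d, hd⟩ := hk
  refine ⟨d, fun y z => ?_⟩
  have h0 := congrFun hd 0
  have h1 := congrFun hd 1
  have h2 := congrFun hd 2
  simp at h0 h1 h2
  simp only [hl, det3]
  linear_combination (-(y 1 * z 2 - y 2 * z 1)) * h0 + (y 0 * z 2 - y 2 * z 0) * h1 -
    (y 0 * z 1 - y 1 * z 0) * h2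

/-- The points of the conic. -/
def conicPoint (w s : k) : Fin 3 → k := ![-(w ^ 2 * (1 + s)), w * s, -(s * (1 + s))]

/-- The projection from a point of the conic. -/
def conicProjection (w s : k) : (Fin 3 → k) →ₗ[k] (Fin 2 → k) :=
  (Matrix.of ![![w ^ 2 * s, -(w * (1 + s)), 1], ![s, -(1 + s), 1]]).mulVecLin

theorem conicProjection_apply_zero (w s : k) (y : Fin 3 → k) :
    conicProjection w s y 0 = w ^ 2 * s * y 0 - w * (1 + s) * y 1 + y 2 := by
  simp [conicProjection, Matrix.mulVec, dotProduct, Fin.sum_univ_three]; ring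

theorem conicProjection_apply_one (w s : k) (y : Fin 3 → k) :
    conicProjection w s y 1 = s * y 0 - (1 + s) * y 1 + y 2 := by
  simp [conicProjection, Matrix.mulVec, dotProduct, Fin.sum_univ_three]; ring

/-- The factors of proportionality between the projections of the points of the configuration and
the vectors `hesseVector`. -/
def conicFactor (w s : k) : HesseVertex → k
  | .m => s
  | .n => -(1 + s)
  | .p => 1
  | .one => (1 - w) * (1 - w * s)
  | .two => -(1 - w)
  | .three => w ^ 2 * (1 - w)
  | .a => w * (1 - w) * (s - w)
  | .b => 1 - w ^ 2
  | .c => 1 - w ^ 2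
  | .alpha => 1 - w
  | .beta => -(w * (1 - w))
  | .gamma => 1 - w

variable {w : k}

/-- This identifies the family found from the constancy of the cross-ratios with the projections
from the conic. -/
theorem conicProjection_hessePoint (hw : w ^ 2 + w + 1 = 0) (s : k) (i : HesseVertex) :
    conicProjection w s (hessePoint w i) = conicFactor w s i • hesseVector w s i := by
  funext e
  have hw2 : w ^ 2 = -1 - w := by linear_combination hw
  have hw3 : w ^ 3 = 1 := by linear_combination (w - 1) * hw
  have hw4 : w ^ 4 = w := by linear_combination (w ^ 2 - w) * hw
  fin_cases e
  · simp only [Fin.zero_eta, conicProjection_apply_zero]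
    cases i <;> simp [hessePoint, conicFactor, hesseVector] <;> ring_nf <;> (try simp only [hw3, hw4]) <;> (try simp only [hw2]) <;> ring
  · simp only [Fin.mk_one, conicProjection_apply_one]
    cases i <;> simp [hessePoint, conicFactor, hesseVector] <;> ring_nf <;> (try simp only [hw3, hw4]) <;> (try simp only [hw2]) <;> ring

theorem bracket_conicProjection (hw : w ^ 2 + w + 1 = 0) (s : k) (y z : Fin 3 → k) :
    conicProjection w s y 0 * conicProjection w s z 1 -
      conicProjection w s y 1 * conicProjection w s z 0 =
      -(w * (1 - w)) * det3 (conicPoint w s) y z := by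
  simp only [conicProjection_apply_zero, conicProjection_apply_one, det3, conicPoint]
  simp
  have hw3 : w ^ 3 = 1 := by linear_combination (w - 1) * hw
  linear_combination (((y 1 * z 2 - y 2 * z 1) * (-(1 - w)) * (1 + s)) + s * (y 0 * z 2 - y 2 * z 0)) * hw3

theorem det3_smul_left (c : k) (x y z : Fin 3 → k) : det3 (c • x) y z = c * det3 x y z := by
  simp only [det3, Pi.smul_apply, smul_eq_mul]; ring

theorem ker_conicProjection (hw : w ^ 2 + w + 1 = 0) (h3 : (3 : k) ≠ 0) {s : k} (hs : 1 + s ≠ 0) :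
    LinearMap.ker (conicProjection w s) = Submodule.span k {conicPoint w s} := by
  have hw3 : w ^ 3 = 1 := by linear_combination (w - 1) * hw
  have hw0 : w ≠ 0 := by rintro rfl; simp at hw
  have hw1 : w - 1 ≠ 0 := by
    intro h
    rw [sub_eq_zero.1 h] at hw
    exact h3 (by linear_combination hw)
  ext y
  rw [LinearMap.mem_ker, Submodule.mem_span_singleton]
  constructor
  · intro h
    have e0 := congrFun h 0
    have e1 := congrFun h 1
    rw [conicProjection_apply_zero] at e0
    rw [conicProjection_apply_one] at e1
    simp only [Pi.zero_apply] at e0 e1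
    have e : (1 + s) * y 1 = -(w ^ 2 * s * y 0) := by
      apply mul_left_cancel₀ hw1
      linear_combination e1 - e0 + (w - 1) * s * y 0 * hw
    have e2 : y 2 = w * s * y 0 := by linear_combination e1 + e - s * y 0 * hw
    refine ⟨y 0 / -(w ^ 2 * (1 + s)), ?_⟩
    have hn : -(w ^ 2 * (1 + s)) ≠ 0 := neg_ne_zero.2 (mul_ne_zero (pow_ne_zero 2 hw0) hs)
    funext j
    simp only [Pi.smul_apply, smul_eq_mul]
    rw [div_mul_eq_mul_div, div_eq_iff hn]
    fin_cases j
    · simp [conicPoint]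
    · simp [conicPoint]; linear_combination w ^ 2 * e - w * s * y 0 * hw3
    · simp [conicPoint]; linear_combination -(w ^ 2 * (1 + s)) * e2 - s * (1 + s) * y 0 * hw3
  · rintro ⟨c, rfl⟩
    funext e
    fin_cases e
    · simp [conicProjection_apply_zero, conicPoint]
      linear_combination - c * s * (1 + s) * (w ^ 2 - w + 1) * hw
    · simp [conicProjection_apply_one, conicPoint]
      linear_combination - c * s * (1 + s) * hw

/-- Each factor can vanish only for a parameter `s` at which two of the vectors `hesseVector w s`
are proportional. -/
theorem conicFactor_ne_zero (hw : w ^ 2 + w + 1 = 0) (h3 : (3 : k) ≠ 0) {s : k}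
    (hv : IsConfiguration (hesseVector w s)) (i : HesseVertex) : conicFactor w s i ≠ 0 := by
  have hw0 : w ≠ 0 := by rintro rfl; simp at hw
  have hw1 : 1 - w ≠ 0 := by
    intro h
    rw [← sub_eq_zero.1 h] at hw
    exact h3 (by linear_combination hw)
  have hw2 : 1 - w ^ 2 ≠ 0 := by
    have : (1 - w) * -w ^ 2 ≠ 0 := mul_ne_zero hw1 (by simpa using hw0)
    intro h
    apply this
    linear_combination h - (1 - w) * hw
  have b1 := (hv b p (by decide)).ne_zero
  have b2 := (hv b m (by decide)).ne_zero
  have b3 := (hv b a (by decide)).ne_zero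
  have b4 := (hv gamma a (by decide)).ne_zero
  simp [bracket, hesseVector] at b1 b2 b3 b4
  have c1 : 1 - w * s ≠ 0 := fun h => b1 (by linear_combination -h)
  have c2 : s - w ≠ 0 := fun h => b2 (by linear_combination w * h)
  cases i <;> simp only [conicFactor, ne_eq, neg_eq_zero, mul_eq_zero, not_or, one_ne_zero,
    not_false_eq_true, pow_eq_zero_iff, OfNat.ofNat_ne_zero] <;> tauto

/-- In normal form, the points of the conic off the joining lines are the `conicPoint w s` for which
`hesseVector w s` is a configuration. Two projections from the same point, and two choices of
representing vectors, differ by a linear map and by rescaling, which does not change the point of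
the moduli space. -/
theorem properTransform_eq (hw : w ^ 2 + w + 1 = 0) (h3 : (3 : k) ≠ 0)
    {P : HesseVertex → Fin 3 → k} {G : Matrix (Fin 3) (Fin 3) k} {t : HesseVertex → k}
    (hG : G.det ≠ 0) (ht : ∀ i, t i ≠ 0) (hP : ∀ i, P i = t i • G.mulVec (hessePoint w i)) :
    properTransform P (substitute G⁻¹ (hesseConic w)) =
      closure (M0.toMBar k _ '' {z | ∃ (s : k) (hv : IsConfiguration (hesseVector w s)),
        z = M0.point (hesseVector w s) hv}) := by
  have hGG : ∀ x, G⁻¹.mulVec (G.mulVec x) = x := by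
    intro x; rw [Matrix.mulVec_mulVec, Matrix.nonsing_inv_mul G hG.isUnit, Matrix.one_mulVec]
  have hGG' : ∀ x, G.mulVec (G⁻¹.mulVec x) = x := by
    intro x; rw [Matrix.mulVec_mulVec, Matrix.mul_nonsing_inv G hG.isUnit, Matrix.one_mulVec]
  have hw3 : w ^ 3 = 1 := by linear_combination (w - 1) * hw
  have hw0 : w ≠ 0 := by rintro rfl; simp at hw
  have hw1 : 1 - w ≠ 0 := by
    intro h
    rw [← sub_eq_zero.1 h] at hw
    exact h3 (by linear_combination hw)
  have hbr : ∀ s i j, bracket (fun i => conicProjection w s (hessePoint w i)) i j =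
      conicFactor w s i * conicFactor w s j * bracket (hesseVector w s) i j := by
    intro s i j
    simp only [bracket, conicProjection_hessePoint hw, Pi.smul_apply, smul_eq_mul]
    ring
  rw [properTransform]
  congr 2
  ext z
  constructor
  · rintro ⟨x, hx, hQ, v, hv, ⟨L, hL, hvL⟩, rfl⟩
    rw [eval_substitute, eval_hesseConic] at hQ
    obtain ⟨d, hd⟩ := exists_bracket_eq_det3 (x := G⁻¹.mulVec x) (L.comp G.mulVecLin) (by
      ext y
      rw [LinearMap.mem_ker, LinearMap.comp_apply, ← LinearMap.mem_ker, hL,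
        Submodule.mem_span_singleton, Submodule.mem_span_singleton]
      refine exists_congr fun c => ⟨fun h => ?_, fun h => ?_⟩
      · rw [← Matrix.mulVec_smul, h, Matrix.mulVecLin_apply, hGG]
      · rw [← h, Matrix.mulVecLin_apply, Matrix.mulVec_smul, hGG'])
    set x' := G⁻¹.mulVec x
    have hvb : ∀ i j, bracket v i j = t i * t j * (d * det3 x' (hessePoint w i) (hessePoint w j)) := by
      intro i j
      rw [← hd]
      simp only [bracket, hvL, hP, map_smul, Pi.smul_apply, smul_eq_mul, LinearMap.comp_apply,
        Matrix.mulVecLin_apply]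
      ring
    have hne : ∀ i j, i ≠ j → det3 x' (hessePoint w i) (hessePoint w j) ≠ 0 := by
      intro i j hij h
      have := (hv i j hij).ne_zero
      rw [hvb, h] at this
      simp at this
    have hx0 : x' 0 ≠ 0 := by
      have := hne n p (by decide)
      simpa [det3, hessePoint] using this
    have hx1 : x' 1 ≠ 0 := by
      have := hne m p (by decide)
      simpa [det3, hessePoint] using this
    have hx2 : x' 2 ≠ 0 := by
      have := hne m n (by decide)
      simpa [det3, hessePoint] using this
    -- The conic has the equation `x₁ (x₂ + w x₀) + w² x₂ x₀ = 0`, and no coordinate vanishes off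
    -- the joining lines of `m`, `n`, `p`.
    have hs1 : x' 2 + w * x' 0 ≠ 0 := by
      intro h
      have : w ^ 2 * (x' 2 * x' 0) = 0 := by linear_combination hQ - x' 1 * h
      simp [hw0, hx0, hx2] at this
    -- The quotient of the third and the first coordinate of `conicPoint w s` is `s / w²`.
    obtain ⟨s, hs⟩ : ∃ s, s = w ^ 2 * x' 2 / x' 0 := ⟨_, rfl⟩
    have hs' : s * x' 0 = w ^ 2 * x' 2 := by rw [hs, div_mul_cancel₀ _ hx0]
    have hs2 : (1 + s) * x' 0 = w ^ 2 * (x' 2 + w * x' 0) := by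
      linear_combination hs' - x' 0 * hw3
    have hs3 : 1 + s ≠ 0 := by
      intro h
      rw [h, zero_mul] at hs2
      exact mul_ne_zero (pow_ne_zero 2 hw0) hs1 hs2.symm
    have hxc : x' = (x' 0 / -(w ^ 2 * (1 + s))) • conicPoint w s := by
      have hn : -(w ^ 2 * (1 + s)) ≠ 0 := neg_ne_zero.2 (mul_ne_zero (pow_ne_zero 2 hw0) hs3)
      funext j
      simp only [Pi.smul_apply, smul_eq_mul]
      rw [div_mul_eq_mul_div, eq_div_iff hn]
      fin_cases j
      · simp [conicPoint]
      · simp [conicPoint]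
        apply mul_left_cancel₀ hx0
        linear_combination -(w ^ 2 * x' 1) * hs2 - w * x' 0 * hs' - w ^ 4 * hQ + (x' 0 * x' 2) * w ^ 3 * hw3
      · simp [conicPoint]
        linear_combination -(1 + s) * hs'
    have hvb' : ∀ i j, bracket v i j = (t i * conicFactor w s i) * (t j * conicFactor w s j) *
        (d * (x' 0 / -(w ^ 2 * (1 + s))) / -(w * (1 - w))) * bracket (hesseVector w s) i j := by
      intro i j
      have h := bracket_conicProjection hw s (hessePoint w i) (hessePoint w j)
      have h' := hbr s i j
      simp only [bracket] at h'
      rw [h] at h'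
      have hn : -(w * (1 - w)) ≠ 0 := neg_ne_zero.2 (mul_ne_zero hw0 hw1)
      have h'' : det3 (conicPoint w s) (hessePoint w i) (hessePoint w j) =
          conicFactor w s i * conicFactor w s j * bracket (hesseVector w s) i j / -(w * (1 - w)) := by
        rw [eq_div_iff hn, mul_comm, h']; rfl
      rw [hvb, hxc, det3_smul_left, h'', ← hxc]
      ring
    have hc : IsConfiguration (hesseVector w s) := by
      intro i j hij
      have := hv i j hij
      rw [hvb'] at this
      exact isUnit_of_mul_isUnit_right this
    refine ⟨s, hc, ?_⟩
    have := CoordRing.eval_eq_of_bracket (k := k) hc hv hvb'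
    change Spec.map (CommRingCat.ofHom (CoordRing.eval v hv).toRingHom) _ = Spec.map (CommRingCat.ofHom (CoordRing.eval _ hc).toRingHom) _
    rw [this]
  · rintro ⟨s, hv, rfl⟩
    have b4 := (hv gamma a (by decide)).ne_zero
    simp [bracket, hesseVector] at b4
    have hvb : ∀ i j, bracket (fun i => conicProjection w s (G⁻¹.mulVec (P i))) i j =
        (t i * conicFactor w s i) * (t j * conicFactor w s j) * 1 * bracket (hesseVector w s) i j := by
      intro i j
      have h := hbr s i j
      simp only [bracket] at h
      simp only [bracket, hP, Matrix.mulVec_smul, hGG, map_smul, Pi.smul_apply, smul_eq_mul]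
      linear_combination t i * t j * h
    have hv' : IsConfiguration (fun i => conicProjection w s (G⁻¹.mulVec (P i))) := by
      intro i j hij
      rw [hvb]
      have := conicFactor_ne_zero hw h3 hv
      exact ((((mul_ne_zero (ht i) (this i)).isUnit.mul (mul_ne_zero (ht j) (this j)).isUnit).mul
        isUnit_one).mul (hv i j hij))
    refine ⟨G.mulVec (conicPoint w s), ?_, ?_, _, hv', ⟨(conicProjection w s).comp G⁻¹.mulVecLin, ?_,
      fun i => rfl⟩, ?_⟩
    · intro h
      have := congrArg G⁻¹.mulVec h
      rw [hGG, Matrix.mulVec_zero] at this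
      have := congrFun this 0
      simp [conicPoint] at this
      tauto
    · rw [eval_substitute, hGG, eval_hesseConic]
      simp [conicPoint]
      linear_combination s ^ 2 * (1 + s) * w * hw3
    · ext y
      rw [LinearMap.mem_ker, LinearMap.comp_apply, ← LinearMap.mem_ker,
        ker_conicProjection hw h3 (by tauto),
        Submodule.mem_span_singleton, Submodule.mem_span_singleton]
      refine exists_congr fun c => ⟨fun h => ?_, fun h => ?_⟩
      · rw [← Matrix.mulVec_smul, h, Matrix.mulVecLin_apply, hGG']
      · rw [← h, Matrix.mulVecLin_apply, Matrix.mulVec_smul, hGG]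
    · have := CoordRing.eval_eq_of_bracket (k := k) hv hv' hvb
      change Spec.map (CommRingCat.ofHom (CoordRing.eval _ hv).toRingHom) _ = Spec.map (CommRingCat.ofHom (CoordRing.eval _ hv').toRingHom) _
      rw [this]

end Conic

/-! ### Exceptional loci in terms of specializations. -/

section ExceptionalLocus

theorem topologicalKrullDim_pos_of_specializes {T : Type*} [TopologicalSpace T] [T0Space T] {x y : T}
    (h : x ⤳ y) (hxy : y ≠ x) : 0 < topologicalKrullDim T := by
  refine Order.krullDim_pos_iff.2 ⟨⟨closure {y}, isIrreducible_singleton.closure, isClosed_closure⟩,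
    ⟨closure {x}, isIrreducible_singleton.closure, isClosed_closure⟩, ?_⟩
  refine lt_of_le_of_ne (specializes_iff_closure_subset.1 h) fun e => hxy ?_
  have e' : closure {y} = closure {x} := congrArg (fun t => t.carrier) e
  exact (Inseparable.eq (inseparable_iff_closure_eq.2 e'))

theorem exists_ne_of_topologicalKrullDim_pos {T : Type*} [TopologicalSpace T]
    (h : 0 < topologicalKrullDim T) (x : T) : ∃ y, y ≠ x := by
  obtain ⟨Z, W, hZW⟩ := Order.krullDim_pos_iff.1 h
  obtain ⟨z, hz⟩ := Z.isIrreducible.nonempty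
  obtain ⟨w, hw, hwz⟩ := Set.exists_of_ssubset (show (Z : Set T) ⊂ W from hZW)
  by_contra! hx
  exact hwz (by rw [hx w, ← hx z]; exact hz)

variable {X Y : Scheme.{u}} (f : X ⟶ Y)

/-- Take for `η` the generic point of a component of the fibre through `x`; positive dimension
provides a second point `x'` of it. Here `x` itself may be `η`. -/
theorem exists_specializes_of_mem_exceptionalLocus {x : X} (hx : x ∈ exceptionalLocus f) :
    ∃ η x' : X, η ⤳ x ∧ η ⤳ x' ∧ x' ≠ η ∧ f x' = f η := by
  obtain ⟨y, Z, hZ, hdim, z, hz, rfl⟩ := hx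
  have hirr : IsIrreducible Z := hZ.1
  have hcl : IsClosed Z := isClosed_of_mem_irreducibleComponents Z hZ
  obtain ⟨g, hg⟩ := QuasiSober.sober hirr hcl
  have hfib : ∀ a, f (f.fiberι y a) = y := fun a => by
    have : f.fiberι y a ∈ f ⁻¹' {y} := f.range_fiberι y ▸ Set.mem_range_self a
    exact this
  obtain ⟨z', hz'⟩ := exists_ne_of_topologicalKrullDim_pos hdim (⟨g, hg.mem⟩ : Z)
  refine ⟨f.fiberι y g, f.fiberι y z', (hg.specializes hz).map (f.fiberι y).continuous,
    (hg.specializes z'.2).map (f.fiberι y).continuous, ?_, by rw [hfib, hfib]⟩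
  intro e
  exact hz' (Subtype.ext ((f.fiberι y).isEmbedding.injective e))

/-- The fibre through `η` contains a proper specialization of it, so a component containing the
closure of `η` in the fibre has positive dimension. -/
theorem mem_exceptionalLocus_of_specializes {η x : X} (h : η ⤳ x) (hne : x ≠ η)
    (hf : f x = f η) : η ∈ exceptionalLocus f := by
  have h' : f.asFiber η ⤳ (f.fiberHomeo (f η)).symm ⟨x, hf⟩ := by
    refine ((f.fiberHomeo (f η)).symm.isInducing.specializes_iff).2 ?_
    exact Topology.IsInducing.subtypeVal.specializes_iff.1 h
  have hne' : (f.fiberHomeo (f η)).symm ⟨x, hf⟩ ≠ f.asFiber η := by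
    intro e
    have := (f.fiberHomeo (f η)).symm.injective e
    exact hne (congrArg Subtype.val this)
  obtain ⟨Z, hZ, hsub⟩ := exists_mem_irreducibleComponents_subset_of_isIrreducible
    (closure {f.asFiber η}) isIrreducible_singleton.closure
  refine ⟨f η, Z, hZ, ?_, f.asFiber η, hsub (subset_closure rfl), f.fiberι_asFiber η⟩
  have : (⟨f.asFiber η, hsub (subset_closure rfl)⟩ : Z) ⤳
      ⟨_, hsub (specializes_iff_mem_closure.1 h')⟩ := Topology.IsInducing.subtypeVal.specializes_iff.1 h'
  exact topologicalKrullDim_pos_of_specializes this fun e => hne' (congrArg Subtype.val e)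

end ExceptionalLocus

/-! ### Algebraic dependence on the cross-ratios of the hyperedges. -/

section Algebraic

open HesseVertex

variable {k : Type u} [Field k]

/-- If three of four points and their cross-ratio are defined over a subfield, then so is the
fourth point. -/
theorem mem_of_bracket {L : Type*} [Field L] (K : Subfield L) {v : Fin 4 → Fin 2 → L}
    (hv : ∀ i j, i ≠ j → bracket v i j ≠ 0) (h0 : v 0 1 = 1) (h1 : ∀ e, v 1 e ∈ K)
    (h2 : ∀ e, v 2 e ∈ K) (h3 : ∀ e, v 3 e ∈ K) {c : L} (hc : c ∈ K)
    (h : c * (bracket v 0 3 * bracket v 1 2) = bracket v 0 2 * bracket v 1 3) :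
    v 0 0 ∈ K := by
  have b12 : bracket v 1 2 ∈ K := sub_mem (mul_mem (h1 _) (h2 _)) (mul_mem (h1 _) (h2 _))
  have b13 : bracket v 1 3 ∈ K := sub_mem (mul_mem (h1 _) (h3 _)) (mul_mem (h1 _) (h3 _))
  have e : v 0 0 * (c * v 3 1 * bracket v 1 2 - v 2 1 * bracket v 1 3) =
      c * v 3 0 * bracket v 1 2 - v 2 0 * bracket v 1 3 := by
    have e3 : bracket v 0 3 = v 0 0 * v 3 1 - v 3 0 := by rw [bracket, h0, one_mul]
    have e2 : bracket v 0 2 = v 0 0 * v 2 1 - v 2 0 := by rw [bracket, h0, one_mul]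
    rw [e3, e2] at h
    linear_combination h
  have hd : c * v 3 1 * bracket v 1 2 - v 2 1 * bracket v 1 3 ≠ 0 := by
    intro hd
    rw [hd, mul_zero] at e
    have : bracket v 1 3 * bracket v 2 3 = 0 := by
      rw [bracket.eq_1 v 2 3]
      linear_combination v 3 1 * e + v 3 0 * hd
    exact mul_ne_zero (hv _ _ (by decide)) (hv _ _ (by decide)) this
  rw [← eq_div_iff hd] at e
  rw [e]
  exact div_mem (sub_mem (mul_mem (mul_mem hc (h3 _)) b12) (mul_mem (h2 _) b13))
    (sub_mem (mul_mem (mul_mem hc (h3 _)) b12) (mul_mem (h2 _) b13))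

variable {L : Type u} [Field L] [Algebra k L]

/-- A hyperedge with three known points and known cross-ratios determines its other points. Starting
from `1`, `a`, `p`, `γ` one reaches successively `n`, `m`, `b`, `2`, `3`, `α`, `c`, `β`, so the
coordinate of `γ` is the only possible modulus. -/
theorem mem_of_hesseCoordinate_gamma_mem (K : IntermediateField k L)
    (f : CoordRing k HesseVertex →ₐ[k] L)
    (hK : ∀ j, ∀ q : Fin 4 ↪ HesseVertex, (∀ i, q i ∈ hesseHypergraph j) →
      f (CoordRing.crossRatio q) ∈ K)
    (hx : f (hesseCoordinate k gamma) ∈ K) (r : CoordRing k HesseVertex) : f r ∈ K := by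
  have C := isConfiguration_affineVector f
  have F := eq_eval_affineVector f
  set v := affineVector (fun i => f (hesseCoordinate k i)) with hvdef
  have hcr : ∀ q : Fin 4 ↪ HesseVertex, f (CoordRing.crossRatio q) *
      (bracket v (q 0) (q 3) * bracket v (q 1) (q 2)) =
      bracket v (q 0) (q 2) * bracket v (q 1) (q 3) := by
    intro q
    conv_lhs => rw [F]
    exact CoordRing.eval_crossRatio v C q
  have step : ∀ (j : Fin 10) (i0 i1 i2 i3 : HesseVertex), i0 ≠ one → ∀ h : Function.Injective ![i0, i1, i2, i3],
      (∀ i, ![i0, i1, i2, i3] i ∈ hesseHypergraph j) → (∀ e, v i1 e ∈ K) → (∀ e, v i2 e ∈ K) →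
      (∀ e, v i3 e ∈ K) → ∀ e, v i0 e ∈ K := by
    intro j i0 i1 i2 i3 h0 h hj h1 h2 h3 e
    have e1 : v i0 1 = 1 := by
      rw [hvdef]
      cases i0 <;> simp [affineVector] at h0 ⊢
    fin_cases e
    · exact mem_of_bracket K.toSubfield (v := fun i => v (![i0, i1, i2, i3] i))
        (fun a b hab => (C _ _ (h.ne hab)).ne_zero) e1 h1 h2 h3 (hK j ⟨_, h⟩ hj) (hcr ⟨_, h⟩)
    · change v i0 1 ∈ K
      rw [e1]; exact one_mem K
  have c1 : ∀ e, v one e ∈ K := by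
    intro e; rw [hvdef]; fin_cases e <;> simp [affineVector, zero_mem, one_mem]
  have ca : ∀ e, v a e ∈ K := by
    intro e; rw [hvdef]; fin_cases e <;> simp [affineVector, zero_mem, one_mem]
  have cp : ∀ e, v p e ∈ K := by
    intro e; rw [hvdef]; fin_cases e <;> simp [affineVector, one_mem]
  have cg : ∀ e, v gamma e ∈ K := by
    intro e; rw [hvdef]; fin_cases e
    · simpa [affineVector] using hx
    · simp [affineVector, one_mem]
  have cn := step 0 n p a one (by decide) (by decide) (by decide) cp ca c1
  have cm := step 0 m p a one (by decide) (by decide) (by decide) cp ca c1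
  have cb := step 1 b gamma p one (by decide) (by decide) (by decide) cg cp c1
  have c2 := step 4 two gamma n a (by decide) (by decide) (by decide) cg cn ca
  have c3 := step 7 three two m one (by decide) (by decide) (by decide) c2 cm c1
  have cal := step 3 alpha three p a (by decide) (by decide) (by decide) c3 cp ca
  have cc := step 6 c alpha n one (by decide) (by decide) (by decide) cal cn c1
  have cbe := step 2 beta two p c (by decide) (by decide) (by decide) c2 cp cc
  have call : ∀ i e, v i e ∈ K := by
    intro i
    cases i <;> assumption
  have hbr : ∀ i j, bracket v i j ∈ K := fun i j =>
    sub_mem (mul_mem (call _ _) (call _ _)) (mul_mem (call _ _) (call _ _))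
  have hle : (⊤ : Subalgebra k (CoordRing k HesseVertex)) ≤ K.toSubalgebra.comap f := by
    rw [← CoordRing.adjoin_crossRatio]
    refine Algebra.adjoin_le ?_
    rintro _ ⟨q, rfl⟩
    change f _ ∈ K
    have h := hcr q
    have hne : bracket v (q 0) (q 3) * bracket v (q 1) (q 2) ≠ 0 :=
      mul_ne_zero (C _ _ (q.injective.ne (by decide))).ne_zero
        (C _ _ (q.injective.ne (by decide))).ne_zero
    rw [← eq_div_iff hne] at h
    rw [h]
    exact div_mem (mul_mem (hbr _ _) (hbr _ _)) (mul_mem (hbr _ _) (hbr _ _))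
  exact hle (Algebra.mem_top (x := r))

theorem hesseCr_mem (i : Fin 11) : ∃ j, ∃ q : Fin 4 ↪ HesseVertex,
    (∀ i, q i ∈ hesseHypergraph j) ∧ hesseCr k i = CoordRing.crossRatio q := by
  obtain ⟨j, hj⟩ : ∃ j, ∀ l, ![(hesseQuadruple i).1, (hesseQuadruple i).2.1,
      (hesseQuadruple i).2.2.1, (hesseQuadruple i).2.2.2] l ∈ hesseHypergraph j := by
    revert i; decide
  exact ⟨j, ⟨_, injective_hesseQuadruple i⟩, hj, by rw [hesseCr, cr, dif_pos]⟩

/-- A family of configurations whose cross-ratios on the hyperedges are algebraic over a field over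
which not all cross-ratios are algebraic is one of the families given by the conics. -/
theorem exists_eq_eval_of_not_isAlgebraic [IsAlgClosed k] (h3 : (3 : k) ≠ 0)
    (f : CoordRing k HesseVertex →ₐ[k] L) (K₀ : IntermediateField k L)
    (hK : ∀ j, ∀ q : Fin 4 ↪ HesseVertex, (∀ i, q i ∈ hesseHypergraph j) →
      IsAlgebraic K₀ (f (CoordRing.crossRatio q)))
    (hr : ∃ r, ¬ IsAlgebraic K₀ (f r)) (hg : f (hesseGenericity k) ≠ 0) :
    ∃ (w : k) (hw : w ^ 2 + w + 1 = 0) (s : L) (hs : Transcendental k s),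
      f = CoordRing.eval _ (isConfiguration_hesseVector h3 hw hs) := by
  -- Over the relative algebraic closure the constants `y` are available as elements, and an element
  -- is algebraic over it only if it is algebraic over `K₀`.
  let K : IntermediateField K₀ L := algebraicClosure K₀ L
  have hmem : ∀ x : L, x ∈ K ↔ IsAlgebraic K₀ x := fun x => mem_algebraicClosure_iff
  have hy : ∀ i : Fin 11, ∃ y : K, algebraMap K L y = f (hesseCr k i) := by
    intro i
    obtain ⟨j, q, hq, e⟩ := hesseCr_mem (k := k) i
    exact ⟨⟨f (hesseCr k i), (hmem _).2 (e ▸ hK j q hq)⟩, rfl⟩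
  choose y hy using hy
  have : IsScalarTower k K L := IsScalarTower.of_algebraMap_eq fun _ => rfl
  refine exists_eq_eval_hesseVector h3 (K := K) f hy ?_ hg
  intro halg
  obtain ⟨r, hr⟩ := hr
  have hx : f (hesseCoordinate k gamma) ∈ K.restrictScalars k := by
    refine (hmem _).2 ?_
    exact halg.restrictScalars K₀
  exact hr ((hmem _).1 (mem_of_hesseCoordinate_gamma_mem (K.restrictScalars k) f
    (fun j q hq => (hmem _).2 (hK j q hq)) hx r))

open scoped IntermediateField.algebraAdjoinAdjoin in
/-- If two prime ideals `P < Q` have the same intersection with a subring `A`, then the quotient by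
`P` is not algebraic over `A`. -/
theorem not_isAlgebraic_of_lt {R : Type*} [CommRing R] [Algebra k R] {P Q : Ideal R} (hPQ : P ≤ Q)
    (A : Subalgebra k R) (h : ∀ x ∈ A, x ∈ Q → x ∈ P) {r : R} (hr : r ∈ Q) (hr' : r ∉ P)
    {L : Type*} [Field L] [Algebra k L] (f : R →ₐ[k] L) (hf : RingHom.ker f = P) :
    ¬ IsAlgebraic (IntermediateField.adjoin k (f '' A)) (f r) := by
  intro H
  have hA : Algebra.adjoin k (f '' A) = A.map f := by
    rw [← Algebra.adjoin_eq (A.map f)]; rfl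
  have H1 : IsAlgebraic (Algebra.adjoin k (f '' A)) (f r) :=
    (IsFractionRing.isAlgebraic_iff (Algebra.adjoin k (f '' A))
      (IntermediateField.adjoin k (f '' A)) L).2 H
  have hfr : f r ≠ 0 := fun e => hr' (hf ▸ e)
  -- Clear denominators to get an algebraic relation with coefficients in the image of `A`; since `f
  -- r ≠ 0`, its constant term can be taken nonzero.
  obtain ⟨p, hp, hp0⟩ := H1.exists_nonzero_coeff_and_aeval_eq_zero (mem_nonZeroDivisors_of_ne_zero hfr)
  have hc : ∀ i, ∃ a ∈ A, f a = p.coeff i := fun i => by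
    have := hA.le (p.coeff i).2
    exact this
  obtain ⟨a, ha, hac⟩ := hc 0
  have ht : Polynomial.aeval (f r) p.divX ∈ f.range := by
    rw [Polynomial.aeval_eq_sum_range]
    refine sum_mem fun i _ => ?_
    obtain ⟨b, -, hb⟩ := hc (i + 1)
    rw [Polynomial.coeff_divX, Algebra.smul_def]
    refine mul_mem (?_ : (p.coeff (i + 1) : L) ∈ f.range) (pow_mem ?_ _)
    · exact ⟨b, hb⟩
    · exact ⟨r, rfl⟩
  obtain ⟨t, ht⟩ := ht
  rw [← Polynomial.divX_mul_X_add p, map_add, map_mul, Polynomial.aeval_X, Polynomial.aeval_C] at hp0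
  have h0 : f (t * r + a) = 0 := by
    rw [map_add, map_mul, hac]
    exact (congrArg (fun z => z * f r + _) ht).trans hp0
  -- The relation reads `t r + a ∈ P`. As `r ∈ Q`, the constant term `a` lies in `Q ∩ A`, hence in
  -- `P`, which contradicts its choice.
  have haQ : a ∈ Q := by
    have h1 : t * r + a ∈ Q := hPQ (hf ▸ h0)
    exact (Q.add_mem_iff_right (Q.mul_mem_left t hr)).1 h1
  have haP := h a ha haQ
  rw [← hf] at haP
  exact hp (Subtype.ext (hac.symm.trans haP))

end Algebraic

/-! ### Fibres of the hypergraph morphism. -/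

section Fibres

/-- The pull-back of global functions along a morphism from an affine scheme. -/
def pullbackFunctions {R : CommRingCat.{u}} {Y : Scheme.{u}} (f : Spec R ⟶ Y) : Γ(Y, ⊤) →+* R :=
  ((Scheme.ΓSpecIso R).hom.hom).comp f.appTop.hom

/-- Whether a pulled-back function lies in the prime `x` depends only on the image of `x`. Thus
points with equal image are compared without describing the points of a fibre product. -/
theorem pullbackFunctions_mem_iff {R : CommRingCat.{u}} {Y : Scheme.{u}} (f : Spec R ⟶ Y)
    (b : Γ(Y, ⊤)) (x : PrimeSpectrum R) :
    pullbackFunctions f b ∈ x.asIdeal ↔ f x ∉ Y.basicOpen b := by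
  have h1 : f ⁻¹ᵁ Y.basicOpen b = (Spec R).basicOpen (f.appTop b) := Scheme.preimage_basicOpen_top f b
  have h2 := basicOpen_eq_of_affine' (R := R) (f.appTop b)
  have h3 : x ∈ f ⁻¹ᵁ Y.basicOpen b ↔ f x ∈ Y.basicOpen b := Iff.rfl
  rw [← h3, h1, h2]
  exact (not_not).symm

theorem pullbackFunctions_appTop {R S : CommRingCat.{u}} {Y : Scheme.{u}} (f : Spec R ⟶ Y)
    (g : Y ⟶ Spec S) (φ : S ⟶ R) (h : f ≫ g = Spec.map φ) (s : S) :
    pullbackFunctions f (g.appTop ((Scheme.ΓSpecIso S).inv s)) = φ s := by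
  have h1 : g.appTop ≫ f.appTop = (Spec.map φ).appTop := by rw [← h, Scheme.Hom.comp_appTop]
  have h2 : (Scheme.ΓSpecIso S).inv ≫ (g.appTop ≫ f.appTop) ≫ (Scheme.ΓSpecIso R).hom = φ := by
    rw [h1, Scheme.ΓSpecIso_naturality, Iso.inv_hom_id_assoc]
  exact congrArg (fun t => t.hom s) h2

theorem mem_range_pullbackFunctions {R S : CommRingCat.{u}} {Y : Scheme.{u}} (f : Spec R ⟶ Y)
    (g : Y ⟶ Spec S) (φ : S ⟶ R) (h : f ≫ g = Spec.map φ) (s : S) :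
    φ s ∈ (pullbackFunctions f).range :=
  ⟨_, pullbackFunctions_appTop f g φ h s⟩

variable {k : Type u} [Field k] {N : Type}

/-- Take for `A` the pull-back of all global functions on the target. The cross-ratios on the
hyperedges come from the factors. -/
theorem exists_subalgebra_of_hypergraphMorphism_eq {J : Type} [Finite J] (Γ : J → Finset N)
    {x y : PrimeSpectrum (CoordRing k N)}
    (h : hypergraphMorphism k Γ (x : M0 k N) = hypergraphMorphism k Γ (y : M0 k N)) :
    ∃ A : Subalgebra k (CoordRing k N),
      (∀ j, ∀ q : Fin 4 ↪ N, (∀ i, q i ∈ Γ j) → CoordRing.crossRatio q ∈ A) ∧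
      ∀ a ∈ A, a ∈ x.asIdeal ↔ a ∈ y.asIdeal := by
  let f : Spec (CommRingCat.of (CoordRing k N)) ⟶ hypergraphModuli k Γ := hypergraphMorphism k Γ
  have hk : ∀ r : k, algebraMap k (CoordRing k N) r ∈ (pullbackFunctions f).range := by
    intro r
    refine mem_range_pullbackFunctions f (S := CommRingCat.of k) (WidePullback.base _)
      (CommRingCat.ofHom (algebraMap k (CoordRing k N))) ?_ r
    exact WidePullback.lift_base _ _ _ _
  refine ⟨{ (pullbackFunctions f).range with algebraMap_mem' := hk }, ?_, ?_⟩
  · intro j q hq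
    have := mem_range_pullbackFunctions f (S := CommRingCat.of (CoordRing k (Γ j))) (WidePullback.π _ j)
      (CommRingCat.ofHom (moduliRing.forget (k := k) (Γ j)).toRingHom) (WidePullback.lift_π _ _ _ _ j)
      (CoordRing.crossRatio (⟨fun i => ⟨q i, hq i⟩, fun a b hab => q.injective (congrArg Subtype.val hab)⟩))
    have e : (moduliRing.forget (k := k) (Γ j)).toRingHom
      (CoordRing.crossRatio (⟨fun i => ⟨q i, hq i⟩, fun a b hab => q.injective (congrArg Subtype.val hab)⟩) : CoordRing k (Γ j)) =
        (CoordRing.crossRatio q : CoordRing k N) := by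
      apply CoordRing.val_injective
      exact ConfigRing.forget_crossRatio _ _
    change (moduliRing.forget (k := k) (Γ j)).toRingHom _ ∈ _ at this
    rw [e] at this
    exact this
  · rintro _ ⟨b, rfl⟩
    have h' : f x = f y := h
    refine (pullbackFunctions_mem_iff f b x).trans (Iff.trans ?_ (pullbackFunctions_mem_iff f b y).symm)
    exact not_congr (Eq.to_iff (congrArg (· ∈ (hypergraphModuli k Γ).basicOpen b) h'))

variable (k) in
/-- The projections of the target of the hypergraph morphism. -/
def hypergraphModuli.π {J : Type} [Finite J] (Γ : J → Finset N) (j : J) :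
    hypergraphModuli k Γ ⟶ M0 k (Γ j) :=
  WidePullback.π _ j

variable (k) in
/-- The structure morphism of the target of the hypergraph morphism. -/
def hypergraphModuli.base {J : Type} [Finite J] (Γ : J → Finset N) :
    hypergraphModuli k Γ ⟶ Spec (CommRingCat.of k) :=
  WidePullback.base _

theorem hypergraphModuli.hom_ext {J : Type} [Finite J] {Γ : J → Finset N} {T : Scheme.{u}}
    {f g : T ⟶ hypergraphModuli k Γ}
    (h : ∀ j, f ≫ hypergraphModuli.π k Γ j = g ≫ hypergraphModuli.π k Γ j)
    (h' : f ≫ hypergraphModuli.base k Γ = g ≫ hypergraphModuli.base k Γ) : f = g :=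
  WidePullback.hom_ext _ _ _ h h'

theorem hypergraphMorphism_π {J : Type} [Finite J] (Γ : J → Finset N) (j : J) :
    hypergraphMorphism k Γ ≫ hypergraphModuli.π k Γ j = M0.forget k (Γ j) :=
  WidePullback.lift_π _ _ _ _ j

theorem hypergraphMorphism_base {J : Type} [Finite J] (Γ : J → Finset N) :
    hypergraphMorphism k Γ ≫ hypergraphModuli.base k Γ = M0.toBase k N :=
  WidePullback.lift_base _ _ _ _

/-- The hypergraph morphism is constant on the closed subsets on which the cross-ratios on the
hyperedges are constant. -/
theorem hypergraphMorphism_eq {J : Type} [Finite J] (Γ : J → Finset N)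
    {L : Type u} [Field L] [Algebra k L] (φ : CoordRing k N →ₐ[k] L)
    (h : ∀ j, ∀ q : Fin 4 ↪ N, (∀ i, q i ∈ Γ j) → φ (CoordRing.crossRatio q) ∈ (⊥ : Subalgebra k L))
    {x y : PrimeSpectrum (CoordRing k N)}
    (hx : RingHom.ker φ ≤ x.asIdeal) (hy : RingHom.ker φ ≤ y.asIdeal) :
    hypergraphMorphism k Γ (x : M0 k N) = hypergraphMorphism k Γ (y : M0 k N) := by
  -- Points of a fibre product are not determined by their projections, so constancy is shown on the
  -- level of morphisms: the restriction to `Spec S` factors through a `k`-rational point of the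
  -- target.
  let S : Subalgebra k L := φ.range
  let ψ : CoordRing k N →ₐ[k] S := φ.rangeRestrict
  have hψ : Function.Surjective ψ := φ.rangeRestrict_surjective
  have hker : RingHom.ker ψ = RingHom.ker φ := by
    ext r
    rw [RingHom.mem_ker, RingHom.mem_ker]
    exact Subtype.ext_iff
  let i : Spec (CommRingCat.of S) ⟶ M0 k N := Spec.map (CommRingCat.ofHom ψ.toRingHom)
  have hrange : ∀ z : PrimeSpectrum (CoordRing k N), RingHom.ker φ ≤ z.asIdeal →
      ∃ z' : PrimeSpectrum S, i z' = z := by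
    intro z hz
    have : z ∈ Set.range (PrimeSpectrum.comap ψ.toRingHom) := by
      rw [range_comap_of_surjective _ _ hψ]
      exact hker.le.trans hz
    exact this
  obtain ⟨x', rfl⟩ := hrange x hx
  obtain ⟨y', rfl⟩ := hrange y hy
  have hbot : ∀ j, ∃ χ : CoordRing k (Γ j) →ₐ[k] k, ∀ r,
      algebraMap k S (χ r) = ψ (moduliRing.forget (k := k) (Γ j) r) := by
    intro j
    let F : CoordRing k (Γ j) →ₐ[k] S := ψ.comp (moduliRing.forget (k := k) (Γ j))
    have hF : ∀ r, F r ∈ (⊥ : Subalgebra k S) := by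
      intro r
      have hle : (⊤ : Subalgebra k (CoordRing k (Γ j))) ≤ (⊥ : Subalgebra k S).comap F := by
        rw [← CoordRing.adjoin_crossRatio]
        refine Algebra.adjoin_le ?_
        rintro _ ⟨q, rfl⟩
        have e : (moduliRing.forget (k := k) (Γ j)) (CoordRing.crossRatio q : CoordRing k (Γ j)) =
            (CoordRing.crossRatio (q.trans (Function.Embedding.subtype _)) : CoordRing k N) := by
          apply CoordRing.val_injective
          exact ConfigRing.forget_crossRatio _ _
        change ψ (moduliRing.forget (k := k) (Γ j) (CoordRing.crossRatio q : CoordRing k (Γ j))) ∈ (⊥ : Subalgebra k S)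
        rw [e]
        obtain ⟨c, hc⟩ := Algebra.mem_bot.1 (h j (q.trans (Function.Embedding.subtype _)) (fun i => (q i).2))
        exact Algebra.mem_bot.2 ⟨c, Subtype.ext hc⟩
      exact hle (Algebra.mem_top (x := r))
    have : Function.Injective (algebraMap k S) := (algebraMap k S).injective
    refine ⟨(Algebra.botEquivOfInjective this).toAlgHom.comp (F.codRestrict ⊥ hF), fun r => ?_⟩
    have := (Algebra.botEquivOfInjective this).symm_apply_apply (F.codRestrict ⊥ hF r)
    exact congrArg Subtype.val this
  choose χ hχ using hbot
  let c : Spec (CommRingCat.of k) ⟶ hypergraphModuli k Γ :=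
    WidePullback.lift (𝟙 _) (fun j => Spec.map (CommRingCat.ofHom (χ j).toRingHom)) (fun j => by
      refine (Spec.map_comp (CommRingCat.ofHom (algebraMap k (CoordRing k (Γ j)))) (CommRingCat.ofHom (χ j).toRingHom)).symm.trans ?_
      rw [← CommRingCat.ofHom_comp, AlgHom.toRingHom_eq_coe, AlgHom.comp_algebraMap]
      exact Spec.map_id _)
  have hfac : i ≫ hypergraphMorphism k Γ = Spec.map (CommRingCat.ofHom (algebraMap k S)) ≫ c := by
    refine hypergraphModuli.hom_ext (fun j => ?_) ?_
    · rw [Category.assoc, Category.assoc, hypergraphMorphism_π]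
      have : c ≫ hypergraphModuli.π k Γ j = Spec.map (CommRingCat.ofHom (χ j).toRingHom) :=
        WidePullback.lift_π _ _ _ _ j
      rw [this]
      refine (Spec.map_comp _ _).symm.trans (Eq.trans ?_ (Spec.map_comp _ _))
      congr 1
      ext r
      exact congrArg Subtype.val (hχ j r).symm
    · rw [Category.assoc, Category.assoc, hypergraphMorphism_base]
      have : c ≫ hypergraphModuli.base k Γ = 𝟙 _ := WidePullback.lift_base _ _ _ _
      rw [this, Category.comp_id]
      refine (Spec.map_comp _ _).symm.trans ?_
      congr 1
      ext r
      exact congrArg Subtype.val (ψ.commutes r)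
  have e : ∀ z : Spec (CommRingCat.of S), hypergraphMorphism k Γ (i z) = c (Spec.map (CommRingCat.ofHom (algebraMap k S)) z) := by
    intro z
    exact congrArg (fun t : Spec (CommRingCat.of S) ⟶ hypergraphModuli k Γ => t z) hfac
  have hs : Subsingleton (Spec (CommRingCat.of k)) := inferInstanceAs (Subsingleton (PrimeSpectrum k))
  refine (e x').trans (Eq.trans ?_ (e y').symm)
  exact congrArg c (Subsingleton.elim _ _)

end Fibres

/-! ### Specialization of the family to values of the parameter. -/

section HesseFamily

open HesseVertex

variable {k : Type u} [Field k] {w : k}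

/-- The product of the brackets of the members of the family `hesseVector`. -/
def hesseDiscriminant (w : k) : Polynomial k :=
  ∏ q : HesseVertex × HesseVertex, if q.1 = q.2 then 1 else
    bracket (hesseVector (Polynomial.C w) Polynomial.X) q.1 q.2

theorem hesseDiscriminant_ne_zero (h3 : (3 : k) ≠ 0) (hw : w ^ 2 + w + 1 = 0) : hesseDiscriminant w ≠ 0 := by
  refine Finset.prod_ne_zero_iff.2 fun q _ => ?_
  split_ifs with h
  · exact one_ne_zero
  · exact bracket_hesseVector_ne_zero h3 hw h

theorem bracket_dvd_hesseDiscriminant {i j : HesseVertex} (h : i ≠ j) :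
    bracket (hesseVector (Polynomial.C w) Polynomial.X) i j ∣ hesseDiscriminant w := by
  have := Finset.dvd_prod_of_mem (fun q : HesseVertex × HesseVertex => if q.1 = q.2 then 1 else
    bracket (hesseVector (Polynomial.C w) Polynomial.X) q.1 q.2) (Finset.mem_univ (i, j))
  simpa [h, hesseDiscriminant] using this

theorem isConfiguration_of_isUnit {A : Type u} [CommRing A] [Algebra k A] {s : A}
    (hs : IsUnit (Polynomial.aeval s (hesseDiscriminant w))) :
    IsConfiguration (hesseVector (algebraMap k A w) s) := by
  intro i j hij
  have h := map_hesseVector ((Polynomial.aeval s : Polynomial k →ₐ[k] A) : Polynomial k →+* A)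
    (Polynomial.C w) Polynomial.X
  simp only [RingHom.coe_coe, Polynomial.aeval_C, Polynomial.aeval_X] at h
  rw [← h]
  have h' := bracket_map ((Polynomial.aeval s : Polynomial k →ₐ[k] A) : Polynomial k →+* A)
    (hesseVector (Polynomial.C w) Polynomial.X) i j
  simp only [RingHom.coe_coe] at h'
  rw [h']
  exact isUnit_of_dvd_unit (map_dvd _ (bracket_dvd_hesseDiscriminant hij)) hs

theorem isUnit_hesseDiscriminant {s : k} (hv : IsConfiguration (hesseVector w s)) :
    IsUnit (Polynomial.aeval s (hesseDiscriminant w)) := by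
  rw [hesseDiscriminant, map_prod, IsUnit.prod_univ_iff]
  intro q
  split_ifs with h
  · simp
  · have h1 := map_hesseVector ((Polynomial.aeval s : Polynomial k →ₐ[k] k) : Polynomial k →+* k)
      (Polynomial.C w) Polynomial.X
    simp only [RingHom.coe_coe, Polynomial.aeval_C, Polynomial.aeval_X] at h1
    have h' := bracket_map ((Polynomial.aeval s : Polynomial k →ₐ[k] k) : Polynomial k →+* k)
      (hesseVector (Polynomial.C w) Polynomial.X) q.1 q.2
    simp only [RingHom.coe_coe] at h'
    rw [← h', h1]
    exact hv _ _ h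

/-- The value of a function at the members of the family, up to a power of the discriminant. -/
theorem exists_polynomial (r : CoordRing k HesseVertex) : ∃ (P : Polynomial k) (n : ℕ),
    ∀ (A : Type u) [CommRing A] [Algebra k A] (s : A)
      (hs : IsUnit (Polynomial.aeval s (hesseDiscriminant w))),
      CoordRing.eval (k := k) _ (isConfiguration_of_isUnit hs) r *
        Polynomial.aeval s (hesseDiscriminant w) ^ n = Polynomial.aeval s P := by
  -- Evaluate once over the universal ring `k[X][1/D]`, where the family is a configuration, and
  -- specialize from there.
  let D := hesseDiscriminant w
  let A₀ := Localization.Away D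
  have hu : IsUnit (Polynomial.aeval (algebraMap (Polynomial k) A₀ Polynomial.X) D) := by
    rw [Polynomial.aeval_algebraMap_apply, Polynomial.aeval_X_left_apply]
    exact IsLocalization.Away.algebraMap_isUnit D
  obtain ⟨n, P, hP⟩ := IsLocalization.Away.surj D (CoordRing.eval (k := k) _ (isConfiguration_of_isUnit hu) r)
  refine ⟨P, n, fun A _ _ s hs => ?_⟩
  have hD : ∀ y : Submonoid.powers D, IsUnit ((Polynomial.aeval s : Polynomial k →ₐ[k] A) y) := by
    rintro ⟨_, n, rfl⟩
    rw [map_pow]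
    exact hs.pow n
  let g : A₀ →ₐ[k] A := IsLocalization.liftAlgHom (M := Submonoid.powers D)
    (f := (Polynomial.aeval s : Polynomial k →ₐ[k] A)) hD
  have hg : ∀ Q, g (algebraMap (Polynomial k) A₀ Q) = Polynomial.aeval s Q := fun Q =>
    IsLocalization.lift_eq (M := Submonoid.powers D) hD Q
  have h := CoordRing.map_eval g _ (isConfiguration_of_isUnit hu)
  have hv : (fun i e => g (hesseVector (algebraMap k A₀ w)
      (algebraMap (Polynomial k) A₀ Polynomial.X) i e)) = hesseVector (algebraMap k A w) s := by
    have := map_hesseVector (g : A₀ →+* A)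
      (algebraMap k A₀ w) (algebraMap (Polynomial k) A₀ Polynomial.X)
    simp only [RingHom.coe_coe, AlgHom.commutes, hg, Polynomial.aeval_X] at this
    exact this
  replace h := h.trans (CoordRing.eval_congr hv _ (isConfiguration_of_isUnit hs))
  have h2 := congrArg g hP
  rw [map_mul, map_pow, hg, hg] at h2
  rw [← h2, ← h]
  rfl

theorem isUnit_aeval_hesseDiscriminant_X (h3 : (3 : k) ≠ 0) (hw : w ^ 2 + w + 1 = 0) :
    IsUnit (Polynomial.aeval (algebraMap (Polynomial k) (FractionRing (Polynomial k)) Polynomial.X)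
      (hesseDiscriminant w)) := by
  rw [Polynomial.aeval_algebraMap_apply, Polynomial.aeval_X_left_apply, isUnit_iff_ne_zero]
  simpa using hesseDiscriminant_ne_zero h3 hw

/-- Up to a power of the discriminant, a function on the family is a polynomial in the parameter; it
vanishes generically only if this polynomial is zero. Together with
`exists_eval_hesseVector_ne_zero` this shows that `hesseIdeal` is the ideal of the rational points
of the family. -/
theorem eval_hesseVector_eq_zero (h3 : (3 : k) ≠ 0) (hw : w ^ 2 + w + 1 = 0) {r : CoordRing k HesseVertex} (hr : r ∈ hesseIdeal h3 hw) {s : k}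
    (hv : IsConfiguration (hesseVector w s)) : CoordRing.eval (k := k) _ hv r = 0 := by
  obtain ⟨P, n, hP⟩ := exists_polynomial (w := w) r
  have h1 := hP _ _ (isUnit_aeval_hesseDiscriminant_X h3 hw)
  have hr' : CoordRing.eval (k := k) _ (isConfiguration_of_isUnit (isUnit_aeval_hesseDiscriminant_X h3 hw)) r = 0 := hr
  rw [hr', zero_mul, Polynomial.aeval_algebraMap_apply, Polynomial.aeval_X_left_apply] at h1
  have hP0 : P = 0 := by simpa using h1.symm
  have hu := isUnit_hesseDiscriminant hv
  have h2 := hP k s hu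
  rw [hP0, map_zero] at h2
  exact (mul_eq_zero.1 h2).resolve_right (pow_ne_zero n hu.ne_zero)

theorem exists_eval_hesseVector_ne_zero (h3 : (3 : k) ≠ 0) (hw : w ^ 2 + w + 1 = 0) [Infinite k] {r : CoordRing k HesseVertex}
    (hr : r ∉ hesseIdeal h3 hw) :
    ∃ (s : k) (hv : IsConfiguration (hesseVector w s)), CoordRing.eval (k := k) _ hv r ≠ 0 := by
  obtain ⟨P, n, hP⟩ := exists_polynomial (w := w) r
  have h1 := hP _ _ (isUnit_aeval_hesseDiscriminant_X h3 hw)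
  have hr' : CoordRing.eval (k := k) _ (isConfiguration_of_isUnit (isUnit_aeval_hesseDiscriminant_X h3 hw)) r ≠ 0 := hr
  have hP0 : P ≠ 0 := by
    rintro rfl
    rw [map_zero] at h1
    exact mul_ne_zero hr' (pow_ne_zero n (isUnit_aeval_hesseDiscriminant_X h3 hw).ne_zero) h1
  obtain ⟨s, hs⟩ : ∃ s, (P * hesseDiscriminant w).eval s ≠ 0 := by
    by_contra! h
    exact mul_ne_zero hP0 (hesseDiscriminant_ne_zero h3 hw) (Polynomial.funext (by simpa using h))
  rw [Polynomial.eval_mul] at hs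
  have hu : IsUnit (Polynomial.aeval s (hesseDiscriminant w)) := by
    rw [Polynomial.coe_aeval_eq_eval]; exact (right_ne_zero_of_mul hs).isUnit
  refine ⟨s, isConfiguration_of_isUnit hu, fun h => ?_⟩
  have h2 := hP k s hu
  erw [h, zero_mul, Polynomial.coe_aeval_eq_eval] at h2
  exact left_ne_zero_of_mul hs h2.symm

/-- The generic point of the curve in the moduli space, which consists of the projections of a dual
Hesse configuration from the points of a conic. -/
def hessePrime (h3 : (3 : k) ≠ 0) (hw : w ^ 2 + w + 1 = 0) : PrimeSpectrum (CoordRing k HesseVertex) := ⟨hesseIdeal h3 hw, hesseIdeal_isPrime h3 hw⟩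

theorem asIdeal_point {s : k} (hv : IsConfiguration (hesseVector w s)) :
    (M0.point _ hv : PrimeSpectrum (CoordRing k HesseVertex)).asIdeal =
      RingHom.ker (CoordRing.eval (k := k) _ hv) := by
  ext r
  change CoordRing.eval (k := k) _ hv r ∈ IsLocalRing.maximalIdeal k ↔ _
  rw [IsLocalRing.maximalIdeal_eq_bot]
  rfl

theorem closure_points (h3 : (3 : k) ≠ 0) (hw : w ^ 2 + w + 1 = 0) [Infinite k] :
    closure {z : PrimeSpectrum (CoordRing k HesseVertex) | ∃ (s : k) (hv : IsConfiguration (hesseVector w s)),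
        z = M0.point (hesseVector w s) hv} = closure {hessePrime h3 hw} := by
  rw [← PrimeSpectrum.zeroLocus_vanishingIdeal_eq_closure, PrimeSpectrum.closure_singleton]
  congr 1
  ext r
  rw [SetLike.mem_coe, PrimeSpectrum.mem_vanishingIdeal]
  constructor
  · intro h
    by_contra hr
    obtain ⟨s, hv, hne⟩ := exists_eval_hesseVector_ne_zero h3 hw hr
    have := h _ ⟨s, hv, rfl⟩
    rw [asIdeal_point] at this
    exact hne this
  · rintro h _ ⟨s, hv, rfl⟩
    rw [asIdeal_point]
    exact eval_hesseVector_eq_zero h3 hw h hv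

theorem det3_mul_det3 (x y a b c d : Fin 3 → k) : det3 x a b * det3 y c d - det3 y a b * det3 x c d =
    det3 a b d * det3 x y c - det3 a b c * det3 x y d := by
  simp only [det3]; ring

/-- On the five vertices of the conic the vectors `hesseVector w s` do not depend on `s`, in
accordance with Steiner's theorem on projections from the points of a conic. For the other
hyperedges the points are collinear, and projection from any centre preserves the cross-ratio of
points on a line. -/
theorem eval_crossRatio_eq_of_mem (h3 : (3 : k) ≠ 0) (hw : w ^ 2 + w + 1 = 0) {s s' : k}
    (hv : IsConfiguration (hesseVector w s)) (hv' : IsConfiguration (hesseVector w s'))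
    (j : Fin 10) (q : Fin 4 ↪ HesseVertex) (hq : ∀ i, q i ∈ hesseHypergraph j) :
    CoordRing.eval (k := k) _ hv (CoordRing.crossRatio q) =
      CoordRing.eval (k := k) _ hv' (CoordRing.crossRatio q) := by
  have h1 := CoordRing.eval_crossRatio (k := k) _ hv q
  have h2 := CoordRing.eval_crossRatio (k := k) _ hv' q
  have hne := fun a b hab => ((hv (q a) (q b) (q.injective.ne hab))).ne_zero
  have hne' := fun a b hab => ((hv' (q a) (q b) (q.injective.ne hab))).ne_zero
  suffices H : bracket (hesseVector w s) (q 0) (q 2) * bracket (hesseVector w s) (q 1) (q 3) *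
      (bracket (hesseVector w s') (q 0) (q 3) * bracket (hesseVector w s') (q 1) (q 2)) =
      bracket (hesseVector w s') (q 0) (q 2) * bracket (hesseVector w s') (q 1) (q 3) *
      (bracket (hesseVector w s) (q 0) (q 3) * bracket (hesseVector w s) (q 1) (q 2)) by
    rw [← h1, ← h2] at H
    have n1 := mul_ne_zero (hne 0 3 (by decide)) (hne 1 2 (by decide))
    have n2 := mul_ne_zero (hne' 0 3 (by decide)) (hne' 1 2 (by decide))
    apply mul_right_cancel₀ (mul_ne_zero n1 n2)
    linear_combination H
  refine Fin.cases (fun hq => ?_) (fun j hq => ?_) j hq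
  · have : ∀ a b, bracket (hesseVector w s) (q a) (q b) = bracket (hesseVector w s') (q a) (q b) := by
      have : ∀ i ∈ conicEdge, hesseVector w s i = hesseVector w s' i := by
        intro i hi
        simp only [conicEdge, Finset.mem_insert, Finset.mem_singleton] at hi
        rcases hi with rfl | rfl | rfl | rfl | rfl <;> rfl
      intro a b
      rw [bracket, bracket, this _ (hq a), this _ (hq b)]
    rw [this, this, this, this]
  · change ∀ i, q i ∈ dualHesseEdge j at hq
    have hw0 : w ≠ 0 := by rintro rfl; simp at hw
    have hw1 : 1 - w ≠ 0 := by
      intro h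
      rw [← sub_eq_zero.1 h] at hw
      exact h3 (by linear_combination hw)
    have hk : -(w * (1 - w)) ≠ 0 := neg_ne_zero.2 (mul_ne_zero hw0 hw1)
    have hD := isDualHesseConfiguration_hessePoint h3 hw
    have hdet : ∀ a b c, a ≠ b → a ≠ c → b ≠ c →
        det3 (hessePoint w (q a)) (hessePoint w (q b)) (hessePoint w (q c)) = 0 := by
      intro a b c hab hac hbc
      rw [← det_eq_det3]
      exact (hD _ _ _ (q.injective.ne hab) (q.injective.ne hac) (q.injective.ne hbc)).2
        ⟨j, hq a, hq b, hq c⟩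
    have hbr : ∀ s a b, conicFactor w s (q a) * conicFactor w s (q b) *
        bracket (hesseVector w s) (q a) (q b) = -(w * (1 - w)) *
          det3 (conicPoint w s) (hessePoint w (q a)) (hessePoint w (q b)) := by
      intro s a b
      rw [← bracket_conicProjection hw, conicProjection_hessePoint hw, conicProjection_hessePoint hw]
      simp only [bracket, Pi.smul_apply, smul_eq_mul]
      ring
    have hF := fun a => conicFactor_ne_zero hw h3 hv (q a)
    have hF' := fun a => conicFactor_ne_zero hw h3 hv' (q a)
    -- For collinear points the ratio of two brackets with a common point does not depend on the
    -- centre, up to the factors of proportionality. The product of two such identities gives the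
    -- cross-ratio.
    have pair : ∀ a b c, a ≠ b → a ≠ c → b ≠ c →
        conicFactor w s (q b) * bracket (hesseVector w s) (q a) (q b) *
          (conicFactor w s' (q c) * bracket (hesseVector w s') (q a) (q c)) =
        conicFactor w s' (q b) * bracket (hesseVector w s') (q a) (q b) *
          (conicFactor w s (q c) * bracket (hesseVector w s) (q a) (q c)) := by
      intro a b c hab hac hbc
      have e := det3_mul_det3 (conicPoint w s) (conicPoint w s') (hessePoint w (q a))
        (hessePoint w (q b)) (hessePoint w (q a)) (hessePoint w (q c))
      have e0 : det3 (hessePoint w (q a)) (hessePoint w (q b)) (hessePoint w (q a)) = 0 := by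
        simp only [det3]; ring
      rw [hdet a b c hab hac hbc, e0] at e
      apply mul_left_cancel₀ (mul_ne_zero (hF a) (hF' a))
      have b1 := hbr s a b
      have b2 := hbr s' a c
      have b3 := hbr s' a b
      have b4 := hbr s a c
      have : (conicFactor w s (q a) * conicFactor w s (q b) * bracket (hesseVector w s) (q a) (q b)) *
          (conicFactor w s' (q a) * conicFactor w s' (q c) * bracket (hesseVector w s') (q a) (q c)) =
          (conicFactor w s' (q a) * conicFactor w s' (q b) * bracket (hesseVector w s') (q a) (q b)) *
          (conicFactor w s (q a) * conicFactor w s (q c) * bracket (hesseVector w s) (q a) (q c)) := by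
        rw [b1, b2, b3, b4]
        linear_combination (w * (1 - w)) ^ 2 * e
      linear_combination this
    have p1 := pair 0 2 3 (by decide) (by decide) (by decide)
    have p2 := pair 1 3 2 (by decide) (by decide) (by decide)
    apply mul_left_cancel₀ (mul_ne_zero (mul_ne_zero (hF 2) (hF' 3)) (mul_ne_zero (hF 3) (hF' 2)))
    linear_combination congrArg₂ (· * ·) p1 p2

end HesseFamily

/-! ### The exceptional locus where the cross-ratios are general. -/

section HesseExceptional

open HesseVertex

variable {k : Type u} [Field k] {w : k}

theorem exists_isConfiguration_hesseVector (h3 : (3 : k) ≠ 0) (hw : w ^ 2 + w + 1 = 0) [Infinite k] :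
    ∃ s : k, IsConfiguration (hesseVector w s) := by
  have : (1 : CoordRing k HesseVertex) ∉ hesseIdeal h3 hw :=
    (Ideal.ne_top_iff_one _).1 (hesseIdeal_isPrime h3 hw).ne_top
  obtain ⟨s, hv, -⟩ := exists_eval_hesseVector_ne_zero h3 hw this
  exact ⟨s, hv⟩

/-- The difference between the cross-ratio and its value at one member of the family vanishes at all
members, hence at the generic point. -/
theorem eval_crossRatio_mem_bot (h3 : (3 : k) ≠ 0) (hw : w ^ 2 + w + 1 = 0) [Infinite k] (j : Fin 10) (q : Fin 4 ↪ HesseVertex)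
    (hq : ∀ i, q i ∈ hesseHypergraph j) :
    CoordRing.eval (k := k) _ (isConfiguration_hesseVector h3 hw
      (transcendental_X_fractionRing (k := k))) (CoordRing.crossRatio q) ∈
      (⊥ : Subalgebra k (FractionRing (Polynomial k))) := by
  obtain ⟨s₀, hv₀⟩ := exists_isConfiguration_hesseVector h3 hw
  have : CoordRing.crossRatio q - algebraMap k _ (CoordRing.eval (k := k) _ hv₀ (CoordRing.crossRatio q)) ∈
      hesseIdeal h3 hw := by
    by_contra h
    obtain ⟨s, hv, hne⟩ := exists_eval_hesseVector_ne_zero h3 hw h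
    apply hne
    rw [map_sub, AlgHom.commutes, eval_crossRatio_eq_of_mem h3 hw hv hv₀ j q hq]
    exact sub_self _
  rw [hesseIdeal, RingHom.mem_ker, map_sub, AlgHom.commutes, sub_eq_zero] at this
  exact Algebra.mem_bot.2 ⟨_, this.symm⟩

theorem hessePrime_specializes_point (h3 : (3 : k) ≠ 0) (hw : w ^ 2 + w + 1 = 0) {s : k}
    (hv : IsConfiguration (hesseVector w s)) :
    hessePrime h3 hw ⤳ (M0.point _ hv : PrimeSpectrum (CoordRing k HesseVertex)) := by
  refine (PrimeSpectrum.le_iff_specializes (hessePrime h3 hw) _).1 fun r hr => ?_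
  rw [asIdeal_point]
  exact eval_hesseVector_eq_zero h3 hw hr hv

/-- The coordinate of `b` is `w s`, which is not constant along the family. -/
theorem point_ne_hessePrime (h3 : (3 : k) ≠ 0) (hw : w ^ 2 + w + 1 = 0) {s : k}
    (hv : IsConfiguration (hesseVector w s)) :
    (M0.point _ hv : PrimeSpectrum (CoordRing k HesseVertex)) ≠ hessePrime h3 hw := by
  intro e
  have e' : (M0.point _ hv : PrimeSpectrum (CoordRing k HesseVertex)).asIdeal = hesseIdeal h3 hw :=
    congrArg PrimeSpectrum.asIdeal e
  rw [asIdeal_point] at e'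
  have hmem : cr k b p a one - algebraMap k _ (CoordRing.eval (k := k) _ hv (cr k b p a one)) ∈
      hesseIdeal h3 hw := by
    rw [← e', RingHom.mem_ker, map_sub, AlgHom.commutes]
    exact sub_self _
  have hi : Function.Injective ![b, p, a, one] := by decide
  rw [hesseIdeal, RingHom.mem_ker, map_sub, AlgHom.commutes, sub_eq_zero] at hmem
  generalize CoordRing.eval (k := k) _ hv (cr k b p a one) = c at hmem
  have h := CoordRing.eval_crossRatio (k := k) _ (isConfiguration_hesseVector h3 hw
    (transcendental_X_fractionRing (k := k))) ⟨_, hi⟩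
  rw [cr, dif_pos hi] at hmem
  rw [hmem] at h
  simp [bracket, hesseVector] at h
  have hT : algebraMap (Polynomial k) (FractionRing (Polynomial k)) (Polynomial.C c) =
      algebraMap (Polynomial k) (FractionRing (Polynomial k)) (Polynomial.C w * Polynomial.X) := by
    rw [map_mul]
    exact h
  have hP := IsFractionRing.injective (Polynomial k) (FractionRing (Polynomial k)) hT
  have hc := congrArg (fun P => Polynomial.coeff P 1) hP
  simp at hc
  rw [← hc] at hw
  simp at hw

theorem hessePrime_mem_exceptionalLocus (h3 : (3 : k) ≠ 0) (hw : w ^ 2 + w + 1 = 0) [Infinite k] :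
    (hessePrime h3 hw : M0 k HesseVertex) ∈
      exceptionalLocus (hypergraphMorphism k hesseHypergraph) := by
  obtain ⟨s₀, hv₀⟩ := exists_isConfiguration_hesseVector h3 hw
  have h := hessePrime_specializes_point h3 hw hv₀
  refine mem_exceptionalLocus_of_specializes _ h (point_ne_hessePrime h3 hw hv₀) ?_
  exact hypergraphMorphism_eq hesseHypergraph _ (eval_crossRatio_mem_bot h3 hw)
    ((PrimeSpectrum.le_iff_specializes (hessePrime h3 hw) _).2 h) le_rfl

/-- The classification of contracted curves: the generic point `η` of a component of a fibre has a
proper specialization with the same image, so its residue field is not algebraic over the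
pulled-back functions, and `exists_eq_eval_of_not_isAlgebraic` identifies `η`. Genericity at `x`
passes to its generization `η`. -/
theorem exists_hessePrime_specializes (h3 : (3 : k) ≠ 0) [IsAlgClosed k] {x : PrimeSpectrum (CoordRing k HesseVertex)}
    (hx : (x : M0 k HesseVertex) ∈ exceptionalLocus (hypergraphMorphism k hesseHypergraph))
    (hg : hesseGenericity k ∉ x.asIdeal) :
    ∃ (w : k) (hw : w ^ 2 + w + 1 = 0), hessePrime h3 hw ⤳ x := by
  obtain ⟨η, x', hηx, hηx', hne, hf⟩ := exists_specializes_of_mem_exceptionalLocus _ hx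
  let η' : PrimeSpectrum (CoordRing k HesseVertex) := η
  let x'' : PrimeSpectrum (CoordRing k HesseVertex) := x'
  have hle : η'.asIdeal ≤ x.asIdeal := (PrimeSpectrum.le_iff_specializes η' x).2 hηx
  have hle' : η'.asIdeal ≤ x''.asIdeal := (PrimeSpectrum.le_iff_specializes η' x'').2 hηx'
  obtain ⟨A, hA, hA'⟩ := exists_subalgebra_of_hypergraphMorphism_eq hesseHypergraph (x := x'') (y := η') hf
  obtain ⟨r, hr, hr'⟩ : ∃ r ∈ x''.asIdeal, r ∉ η'.asIdeal := by
    by_contra! h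
    exact hne (PrimeSpectrum.ext (le_antisymm h hle'))
  let L := FractionRing (CoordRing k HesseVertex ⧸ η'.asIdeal)
  let f : CoordRing k HesseVertex →ₐ[k] L :=
    (IsScalarTower.toAlgHom k (CoordRing k HesseVertex ⧸ η'.asIdeal) L).comp
      (Ideal.Quotient.mkₐ k η'.asIdeal)
  have hker : RingHom.ker f = η'.asIdeal := by
    ext a
    rw [RingHom.mem_ker]
    change algebraMap (CoordRing k HesseVertex ⧸ η'.asIdeal) L (Ideal.Quotient.mk _ a) = 0 ↔ _
    rw [map_eq_zero_iff _ (IsFractionRing.injective _ L), Ideal.Quotient.eq_zero_iff_mem]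
  obtain ⟨w, hw, s, hs, hfs⟩ := exists_eq_eval_of_not_isAlgebraic h3 f
    (IntermediateField.adjoin k (f '' A)) (fun j q hq => by
      exact isAlgebraic_algebraMap (⟨f (CoordRing.crossRatio q), IntermediateField.subset_adjoin _ _
        ⟨_, hA j q hq, rfl⟩⟩ : IntermediateField.adjoin k (f '' A)))
    ⟨r, not_isAlgebraic_of_lt hle' A (fun a ha => (hA' a ha).1) hr hr' f hker⟩ (by
      intro h
      exact hg (hle (hker ▸ h)))
  refine ⟨w, hw, ?_⟩
  have : η' = hessePrime h3 hw := by
    apply PrimeSpectrum.ext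
    rw [← hker, hfs]
    exact ker_eval_hesseVector h3 hw hs
  rw [← this]
  exact hηx

/-- The cross-ratios on the hyperedges for the family of configurations. -/
def hesseValue (w : k) : Fin 11 → k :=
  ![w, w ^ 2, -w, -w ^ 2, -w, -w ^ 2, -w, -w ^ 2, -w, -w ^ 2, -w]

theorem eval_hesseCr (hw : w ^ 2 + w + 1 = 0) {s : k} (hv : IsConfiguration (hesseVector w s)) (i : Fin 11) :
    CoordRing.eval (k := k) _ hv (hesseCr k i) = hesseValue w i := by
  have h := CoordRing.eval_crossRatio (k := k) _ hv ⟨_, injective_hesseQuadruple i⟩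
  rw [hesseCr, cr, dif_pos (injective_hesseQuadruple i)]
  have hne := (hv _ _ ((injective_hesseQuadruple i).ne (show (0 : Fin 4) ≠ 3 by decide))).mul
    (hv _ _ ((injective_hesseQuadruple i).ne (show (1 : Fin 4) ≠ 2 by decide)))
  refine hne.mul_right_cancel (h.trans ?_)
  clear h hne
  have hw3 : w ^ 3 = 1 := by linear_combination (w - 1) * hw
  have hw4 : w ^ 4 = w := by linear_combination (w ^ 2 - w) * hw
  have hw5 : w ^ 5 = w ^ 2 := by linear_combination (w ^ 3 - w ^ 2) * hw
  have hw6 : w ^ 6 = 1 := by linear_combination (w ^ 3 + 1) * hw3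
  have hw8 : w ^ 8 = w ^ 2 := by linear_combination (w ^ 5 + w ^ 2) * hw3
  have hw2 : w ^ 2 = -1 - w := by linear_combination hw
  fin_cases i <;> simp [hesseQuadruple, bracket, hesseVector, hesseValue] <;> ring_nf <;>
    (try simp only [hw3, hw4, hw5, hw6, hw8]) <;> (try simp only [hw2]) <;> ring

/-- Modulo `w² + w + 1` the factors are `1 + 2w`, `1 + 2w`, `1 - w`, `2 + w`, `1 + 2w`, and each of
them divides `3` in `ℤ[w]`. -/
theorem hesseObstruction_hesseValue_ne_zero (h3 : (3 : k) ≠ 0) (hw : w ^ 2 + w + 1 = 0) :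
    hesseObstruction w (w ^ 2) (-w) (-w ^ 2) (-w) (-w ^ 2) (-w) (-w ^ 2) (-w) ≠ 0 := by
  have a1 : 1 + 2 * w ≠ 0 := fun h => h3 (by linear_combination 4 * hw - (1 + 2 * w) * h)
  have a2 : 2 + w ≠ 0 := fun h => h3 (by linear_combination hw + (1 - w) * h)
  have a3 : 1 - w ≠ 0 := fun h => h3 (by linear_combination hw + (2 + w) * h)
  rw [hesseObstruction]
  refine mul_ne_zero (mul_ne_zero (mul_ne_zero (mul_ne_zero (fun h => a1 ?_) (fun h => a1 ?_))
    (fun h => a3 ?_)) (fun h => a2 ?_)) (fun h => a1 ?_)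
  · linear_combination h - (-1 - w + 2 * w ^ 2 - w ^ 3 - w ^ 4 + w ^ 5 - w ^ 6 - w ^ 7 + w ^ 8 +
      w ^ 11) * hw
  · linear_combination h - (-2 + w ^ 2 + w ^ 3 - w ^ 4) * hw
  · linear_combination h - (-1 + 2 * w - w ^ 2 + w ^ 3 - w ^ 4) * hw
  · linear_combination h - (-2 + 2 * w ^ 2 - w ^ 3 + w ^ 4 - w ^ 5) * hw
  · linear_combination h - (w ^ 2 - 2 * w ^ 3 + w ^ 5) * hw

theorem eval_hesseGenericity (hw : w ^ 2 + w + 1 = 0) [IsAlgClosed k] {s : k}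
    (hv : IsConfiguration (hesseVector w s)) :
    CoordRing.eval (k := k) _ hv (hesseGenericity k) =
      hesseObstruction w (w ^ 2) (-w) (-w ^ 2) (-w) (-w ^ 2) (-w) (-w ^ 2) (-w) := by
  have := map_hesseObstruction (CoordRing.eval (k := k) _ hv : CoordRing k HesseVertex →+* k) (hesseCr k 0) (hesseCr k 1) (hesseCr k 2)
      (hesseCr k 3) (hesseCr k 4) (hesseCr k 5) (hesseCr k 6) (hesseCr k 7) (hesseCr k 8)
  simp only [RingHom.coe_coe, eval_hesseCr hw] at this
  exact this

end HesseExceptional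

/-! ### Morphisms to a projective spectrum given by global functions. -/

/-- The morphism to a projective spectrum given by global functions, on the locus where a given
function is invertible. -/
theorem toBasicOpen_eq {A : Type u} [CommRing A] {σ : Type*} [SetLike σ A] [AddSubgroupClass σ A]
    (𝒜 : ℕ → σ) [GradedRing 𝒜] {X : Scheme.{u}} (F : A →+* Γ(X, ⊤)) {t : A} {d : ℕ} (h0d : 0 < d)
    (hd : t ∈ 𝒜 d) (χ : HomogeneousLocalization.Away 𝒜 t →+* Γ(X, ⊤))
    (hχ : ∀ y, algebraMap Γ(X, ⊤) (Localization.Away (F t)) (χ y) =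
      IsLocalization.map (M := .powers t) (T := .powers (F t)) (Localization.Away (F t)) F (by
        rw [← Submonoid.map_le_iff_le_comap, Submonoid.map_powers]) y.val) :
    Proj.toBasicOpenOfGlobalSections 𝒜 F rfl h0d hd ≫ (Proj.basicOpen 𝒜 t).ι =
      (X.basicOpen (F t)).ι ≫ X.toSpecΓ ≫ Spec.map (CommRingCat.ofHom χ) ≫ Proj.awayι 𝒜 t hd h0d := by
  rw [← Proj.basicOpenIsoSpec_inv_ι]
  simp only [← Category.assoc]
  congr 1
  rw [Proj.toBasicOpenOfGlobalSections]
  simp only [Category.assoc]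
  rw [Iso.inv_comp_eq, Scheme.isoOfEq_hom_ι_assoc]
  have h1 := morphismRestrict_ι X.toSpecΓ (PrimeSpectrum.basicOpen (F t))
  rw [← Category.assoc ((X.toSpecΓ ⁻¹ᵁ PrimeSpectrum.basicOpen (F t)).ι)]
  rw [← h1, Category.assoc]
  congr 1
  have h2 := congrArg (· ≫ Spec.map (CommRingCat.ofHom χ) ≫ (Proj.basicOpenIsoSpec 𝒜 t hd h0d).inv) (basicOpenIsoSpecAway_hom_SpecMap (R := Γ(X, ⊤)) (F t))
  refine Eq.trans ?_ h2
  rw [Category.assoc, ← Category.assoc (Spec.map _) (Spec.map _), ← Spec.map_comp, ← CommRingCat.ofHom_comp]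
  congr 4
  ext y
  exact (hχ y).symm

theorem fromOfGlobalSections_eq {A : Type u} [CommRing A] {σ : Type*} [SetLike σ A]
    [AddSubgroupClass σ A] (𝒜 : ℕ → σ) [GradedRing 𝒜] {X : Scheme.{u}} (F : A →+* Γ(X, ⊤))
    (hF : (HomogeneousIdeal.irrelevant 𝒜).toIdeal.map F = ⊤) {t : A} {d : ℕ} (h0d : 0 < d)
    (hd : t ∈ 𝒜 d) (ht : IsUnit (F t)) (χ : HomogeneousLocalization.Away 𝒜 t →+* Γ(X, ⊤))
    (hχ : ∀ y, algebraMap Γ(X, ⊤) (Localization.Away (F t)) (χ y) =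
      IsLocalization.map (M := .powers t) (T := .powers (F t)) (Localization.Away (F t)) F (by
        rw [← Submonoid.map_le_iff_le_comap, Submonoid.map_powers]) y.val) :
    Proj.fromOfGlobalSections 𝒜 F hF =
      X.toSpecΓ ≫ Spec.map (CommRingCat.ofHom χ) ≫ Proj.awayι 𝒜 t hd h0d := by
  have hU : Proj.fromOfGlobalSections 𝒜 F hF ⁻¹ᵁ Proj.basicOpen 𝒜 t = ⊤ := by
    rw [Proj.fromOfGlobalSections_preimage_basicOpen 𝒜 F hF h0d hd, Scheme.basicOpen_of_isUnit _ ht]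
  have : IsIso (Proj.fromOfGlobalSections 𝒜 F hF ⁻¹ᵁ Proj.basicOpen 𝒜 t).ι := by
    rw [hU]; exact (Scheme.topIso _).isIso_hom
  rw [← cancel_epi (Proj.fromOfGlobalSections 𝒜 F hF ⁻¹ᵁ Proj.basicOpen 𝒜 t).ι,
    ← morphismRestrict_ι, Proj.fromOfGlobalSections_morphismRestrict 𝒜 F hF h0d hd, Category.assoc,
    toBasicOpen_eq 𝒜 F h0d hd χ hχ, Scheme.isoOfEq_hom_ι_assoc]

/-! ### The affine chart of the projective line. -/

section ProjectiveLine

attribute [local instance] MvPolynomial.gradedAlgebra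

variable (k : Type u) [Field k]

/-- The grading of the homogeneous coordinate ring of the projective line. -/
abbrev P1.grading : ℕ → Submodule k (MvPolynomial (Fin 2) k) :=
  MvPolynomial.homogeneousSubmodule (Fin 2) k

/-- The coordinate ring of the affine line in the projective line. -/
abbrev P1.AffineRing : Type u :=
  HomogeneousLocalization.Away (P1.grading k) (MvPolynomial.X 1)

theorem P1.X_mem (i : Fin 2) : (MvPolynomial.X i : MvPolynomial (Fin 2) k) ∈ P1.grading k 1 :=
  MvPolynomial.isHomogeneous_X k i

/-- The inclusion of the affine line in the projective line. -/
def P1.affineι : Spec (CommRingCat.of (P1.AffineRing k)) ⟶ P1 k :=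
  Proj.awayι (P1.grading k) (MvPolynomial.X 1) (P1.X_mem k 1) one_pos

instance : IsOpenImmersion (P1.affineι k) := by
  unfold P1.affineι; infer_instance

/-- The coordinate of the affine line in the projective line. -/
def P1.affineCoordinate : P1.AffineRing k :=
  HomogeneousLocalization.Away.mk (P1.grading k) (P1.X_mem k 1) 1 (MvPolynomial.X 0) (P1.X_mem k 0)

variable {k}
variable {R : Type u} [CommRing R] [Algebra k R]

/-- The evaluation of functions on the affine line in the projective line. -/
def P1.affineEval (c : R) : P1.AffineRing k →+* R :=
  (IsLocalization.Away.lift (S := Localization.Away (MvPolynomial.X 1 : MvPolynomial (Fin 2) k))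
    (g := (MvPolynomial.aeval ![c, 1] : MvPolynomial (Fin 2) k →ₐ[k] R).toRingHom)
    (MvPolynomial.X 1) (by simp)).comp
    (algebraMap (P1.AffineRing k) (Localization.Away (MvPolynomial.X 1 : MvPolynomial (Fin 2) k)))

theorem P1.affineEval_affineCoordinate (c : R) :
    P1.affineEval (k := k) c (P1.affineCoordinate k) = c := by
  rw [P1.affineEval, RingHom.comp_apply, P1.affineCoordinate, HomogeneousLocalization.algebraMap_apply,
    HomogeneousLocalization.Away.val_mk, Localization.mk_eq_mk', IsLocalization.Away.lift,
    IsLocalization.lift_mk'_spec]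
  simp

theorem P1.coordinates_X_one (c : R) : P1.coordinates (k := k) c (MvPolynomial.X 1) = 1 := by
  simp [P1.coordinates]

/-- The second coordinate is `1`, so the morphism lands in the affine chart and becomes the spectrum
of an evaluation homomorphism; all later computations with `P1` go through this chart. -/
theorem P1.ofElement_eq (c : R) : P1.ofElement (k := k) c =
    Spec.map (CommRingCat.ofHom (P1.affineEval (k := k) c)) ≫ P1.affineι k := by
  let F := P1.coordinates (k := k) c
  have hF : IsUnit (F (MvPolynomial.X 1)) := by
    rw [P1.coordinates_X_one]; exact isUnit_one
  refine (fromOfGlobalSections_eq (P1.grading k) F (P1.map_irrelevant c) one_pos (P1.X_mem k 1) hF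
    ((Scheme.ΓSpecIso (CommRingCat.of R)).inv.hom.comp (P1.affineEval (k := k) c)) ?_).trans ?_
  swap
  · rw [CommRingCat.ofHom_comp, Spec.map_comp, Category.assoc]
    change (Spec (CommRingCat.of R)).toSpecΓ ≫
      Spec.map (Scheme.ΓSpecIso (CommRingCat.of R)).inv ≫ _ = _
    rw [← Category.assoc, toSpecΓ_SpecMap_ΓSpecIso_inv, Category.id_comp]
    rfl
  · intro y
    refine RingHom.congr_fun (f := ((algebraMap _ (Localization.Away (F (MvPolynomial.X 1)))).comp
      ((Scheme.ΓSpecIso (CommRingCat.of R)).inv.hom.comp (IsLocalization.Away.lift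
      (S := Localization.Away (MvPolynomial.X 1 : MvPolynomial (Fin 2) k))
    (g := (MvPolynomial.aeval ![c, 1] : MvPolynomial (Fin 2) k →ₐ[k] R).toRingHom)
    (MvPolynomial.X 1) (by simp))))) ?_ y.val
    refine IsLocalization.ringHom_ext
      (M := Submonoid.powers (MvPolynomial.X 1 : MvPolynomial (Fin 2) k)) ?_
    refine RingHom.ext fun x => ?_
    simp only [RingHom.comp_apply, IsLocalization.Away.lift, IsLocalization.lift_eq, IsLocalization.map_eq]
    rfl

end ProjectiveLine

/-! ### The locus where finitely many functions have no poles. -/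

section AffineLocus

attribute [local instance] MvPolynomial.gradedAlgebra

variable {k : Type u} [Field k] {ι : Type} [Finite ι] {X : Scheme.{u}}
  (b : X ⟶ Spec (CommRingCat.of k)) (φ : ι → (X ⟶ P1 k))

/-- The open subset where finitely many morphisms to the projective line are finite. -/
def affineLocus : X.Opens :=
  ⟨⋂ i, φ i ⁻¹' Set.range (P1.affineι k), isOpen_iInter_of_finite fun i =>
    (P1.affineι k).isOpenEmbedding.isOpen_range.preimage (φ i).continuous⟩

theorem mem_affineLocus {x : X} : x ∈ affineLocus φ ↔ ∀ i, φ i x ∈ Set.range (P1.affineι k) :=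
  Set.mem_iInter

theorem range_subset_of_affineLocus (i : ι) :
    Set.range ((affineLocus φ).ι ≫ φ i) ⊆ Set.range (P1.affineι k) := by
  rintro _ ⟨x, rfl⟩
  exact (mem_affineLocus φ).1 x.2 i

/-- The restriction of a morphism to the projective line to the locus where it is finite. -/
def affineLocusLift (i : ι) : (affineLocus φ).toScheme ⟶ Spec (CommRingCat.of (P1.AffineRing k)) :=
  IsOpenImmersion.lift (P1.affineι k) ((affineLocus φ).ι ≫ φ i) (range_subset_of_affineLocus φ i)

theorem affineLocusLift_fac (i : ι) : affineLocusLift φ i ≫ P1.affineι k = (affineLocus φ).ι ≫ φ i :=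
  IsOpenImmersion.lift_fac _ _ _

/-- The pull-back of polynomials in the coordinates of finitely many morphisms to the projective
line. -/
def affineLocusFunctions : MvPolynomial ι k →+* Γ((affineLocus φ).toScheme, ⊤) :=
  MvPolynomial.eval₂Hom
    (((affineLocus φ).ι ≫ b).appTop.hom.comp (Scheme.ΓSpecIso (CommRingCat.of k)).inv.hom)
    (fun i => (affineLocusLift φ i).appTop
      ((Scheme.ΓSpecIso (CommRingCat.of (P1.AffineRing k))).inv (P1.affineCoordinate k)))

/-- The morphism to an affine space given by finitely many morphisms to the projective line, on the
locus where they are finite. -/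
def affineLocusMap : (affineLocus φ).toScheme ⟶ Spec (CommRingCat.of (MvPolynomial ι k)) :=
  (affineLocus φ).toScheme.toSpecΓ ≫ Spec.map (CommRingCat.ofHom (affineLocusFunctions b φ))

theorem comp_toSpecΓ_map {R : CommRingCat.{u}} {Y : Scheme.{u}} (f : Spec R ⟶ Y) {A : Type u}
    [CommRing A] (θ : A →+* Γ(Y, ⊤)) : f ≫ Y.toSpecΓ ≫ Spec.map (CommRingCat.ofHom θ) =
      Spec.map (CommRingCat.ofHom ((pullbackFunctions f).comp θ)) := by
  rw [← Category.assoc, Scheme.toSpecΓ_naturality, Category.assoc, ← Spec.map_comp,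
    pullbackFunctions]
  have : CommRingCat.ofHom θ ≫ f.appTop = (CommRingCat.ofHom
      ((((Scheme.ΓSpecIso R).hom.hom).comp f.appTop.hom).comp θ)) ≫ (Scheme.ΓSpecIso R).inv := by
    ext x
    exact (congrArg (fun t => t.hom (f.appTop (θ x))) (Scheme.ΓSpecIso R).hom_inv_id).symm
  rw [this, Spec.map_comp]
  rw [← Category.assoc, toSpecΓ_SpecMap_ΓSpecIso_inv, Category.id_comp]

/-- A morphism from `Spec R` whose coordinates are elements `cᵢ` of `R` has no poles, and its
composition with the map to affine space is substitution of the `cᵢ`. -/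
theorem exists_lift_affineLocus {R : Type u} [CommRing R] [Algebra k R]
    (f : Spec (CommRingCat.of R) ⟶ X) (hb : f ≫ b = Spec.map (CommRingCat.ofHom (algebraMap k R)))
    {c : ι → R} (hc : ∀ i, f ≫ φ i = P1.ofElement (k := k) (c i)) :
    ∃ f' : Spec (CommRingCat.of R) ⟶ (affineLocus φ).toScheme, f' ≫ (affineLocus φ).ι = f ∧
      f' ≫ affineLocusMap b φ =
        Spec.map (CommRingCat.ofHom (MvPolynomial.aeval (R := k) c).toRingHom) := by
  have hrange : Set.range f ⊆ Set.range (affineLocus φ).ι := by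
    rintro _ ⟨x, rfl⟩
    rw [Scheme.Opens.range_ι]
    refine (mem_affineLocus φ).2 fun i => ?_
    have h : f ≫ φ i = Spec.map (CommRingCat.ofHom (P1.affineEval (k := k) (c i))) ≫ P1.affineι k := by
      rw [hc, P1.ofElement_eq]
    exact ⟨_, (congrArg (fun t : Spec (CommRingCat.of R) ⟶ P1 k => t x) h).symm⟩
  let f' := IsOpenImmersion.lift (affineLocus φ).ι f hrange
  have hf' : f' ≫ (affineLocus φ).ι = f := IsOpenImmersion.lift_fac _ _ _
  refine ⟨f', hf', ?_⟩
  refine (comp_toSpecΓ_map f' (affineLocusFunctions b φ)).trans ?_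
  congr 2
  refine MvPolynomial.ringHom_ext (fun r => ?_) (fun i => ?_)
  · rw [RingHom.comp_apply, affineLocusFunctions, MvPolynomial.coe_eval₂Hom, MvPolynomial.eval₂_C,
      RingHom.comp_apply]
    refine (pullbackFunctions_appTop (S := CommRingCat.of k) f' ((affineLocus φ).ι ≫ b)
      (CommRingCat.ofHom (algebraMap k R)) ?_ r).trans ?_
    · rw [← Category.assoc, hf', hb]
    · simp
  · rw [RingHom.comp_apply, affineLocusFunctions, MvPolynomial.coe_eval₂Hom, MvPolynomial.eval₂_X]
    refine (pullbackFunctions_appTop (S := CommRingCat.of (P1.AffineRing k)) f' (affineLocusLift φ i)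
      (CommRingCat.ofHom (P1.affineEval (k := k) (c i))) ?_ (P1.affineCoordinate k)).trans ?_
    · rw [← cancel_mono (P1.affineι k), Category.assoc, affineLocusLift_fac, ← Category.assoc, hf',
        hc, P1.ofElement_eq]
    · simp [P1.affineEval_affineCoordinate]

end AffineLocus

/-! ### The moduli space as an open subscheme of its compactification. -/

section MBar

variable {k : Type u} [Field k] {N : Type} [Finite N]

attribute [local instance] MvPolynomial.gradedAlgebra

variable (k) in
/-- The projections of the product of projective lines. -/
def crossRatioSpace.π (q : Fin 4 ↪ N) : crossRatioSpace k N ⟶ P1 k :=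
  WidePullback.π _ q

variable (k N) in
/-- The structure morphism of the product of projective lines. -/
def crossRatioSpace.base : crossRatioSpace k N ⟶ Spec (CommRingCat.of k) :=
  WidePullback.base _

theorem crossRatioMorphism_π (q : Fin 4 ↪ N) :
    (crossRatioMorphism k N : Spec (CommRingCat.of (CoordRing k N)) ⟶ _) ≫ crossRatioSpace.π k q =
      P1.ofElement (k := k) (CoordRing.crossRatio q : CoordRing k N) :=
  WidePullback.lift_π _ _ _ _ q

theorem crossRatioMorphism_base :
    (crossRatioMorphism k N : Spec (CommRingCat.of (CoordRing k N)) ⟶ _) ≫ crossRatioSpace.base k N =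
      Spec.map (CommRingCat.ofHom (algebraMap k (CoordRing k N))) :=
  WidePullback.lift_base _ _ _ _

/-- The cross-ratios generate the coordinate ring, so they embed the moduli space as a closed
subscheme of an affine space; this map factors through the open locus where all cross-ratios are
finite. -/
instance isImmersion_crossRatioMorphism : IsImmersion (crossRatioMorphism k N) := by
  let f : Spec (CommRingCat.of (CoordRing k N)) ⟶ crossRatioSpace k N := crossRatioMorphism k N
  obtain ⟨f', hf', he⟩ := exists_lift_affineLocus (crossRatioSpace.base k N)
    (fun q : Fin 4 ↪ N => crossRatioSpace.π k q) f
    crossRatioMorphism_base crossRatioMorphism_π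
  have hsurj : Function.Surjective (MvPolynomial.aeval (R := k)
      (CoordRing.crossRatio (k := k) (N := N))) := by
    rw [← AlgHom.range_eq_top, ← Algebra.adjoin_range_eq_range_aeval, CoordRing.adjoin_crossRatio]
  have h1 : IsClosedImmersion (Spec.map (CommRingCat.ofHom
      (MvPolynomial.aeval (R := k) (CoordRing.crossRatio (k := k) (N := N))).toRingHom)) :=
    IsClosedImmersion.spec_of_surjective _ hsurj
  rw [← he] at h1
  have h2 : IsImmersion f' := IsImmersion.of_comp f' (affineLocusMap (crossRatioSpace.base k N) _)
  have h3 : IsImmersion (f' ≫ (affineLocus _).ι) := inferInstance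
  rw [hf'] at h3
  exact h3

instance isNoetherianRing_coordRing : IsNoetherianRing (CoordRing k N) := by
  have hsurj : Function.Surjective (MvPolynomial.aeval (R := k)
      (CoordRing.crossRatio (k := k) (N := N))) := by
    rw [← AlgHom.range_eq_top, ← Algebra.adjoin_range_eq_range_aeval, CoordRing.adjoin_crossRatio]
  exact isNoetherianRing_of_surjective _ _ (MvPolynomial.aeval (R := k)
      (CoordRing.crossRatio (k := k) (N := N))).toRingHom hsurj

/-- A quasi-compact immersion is open in its scheme-theoretic image; quasi-compactness follows
because the source is noetherian. -/
instance isOpenImmersion_toMBar : IsOpenImmersion (M0.toMBar k N) := by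
  have : TopologicalSpace.NoetherianSpace (M0 k N) :=
    inferInstanceAs (TopologicalSpace.NoetherianSpace (PrimeSpectrum (CoordRing k N)))
  have : QuasiCompact (crossRatioMorphism k N) := inferInstance
  exact inferInstanceAs (IsOpenImmersion (crossRatioMorphism k N).toImage)

variable (k) in
/-- The extension of a cross-ratio to the compactification. -/
def MBar.crossRatio (q : Fin 4 ↪ N) : MBar k N ⟶ P1 k :=
  (crossRatioMorphism k N).imageι ≫ crossRatioSpace.π k q

theorem toMBar_crossRatio (q : Fin 4 ↪ N) :
    (M0.toMBar k N : Spec (CommRingCat.of (CoordRing k N)) ⟶ _) ≫ MBar.crossRatio k q =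
      P1.ofElement (k := k) (CoordRing.crossRatio q : CoordRing k N) := by
  rw [← crossRatioMorphism_π]
  have := (crossRatioMorphism k N).toImage_imageι
  exact (Category.assoc _ _ _).symm.trans (congrArg (· ≫ crossRatioSpace.π k q) this)

theorem toMBar_toBase :
    (M0.toMBar k N : Spec (CommRingCat.of (CoordRing k N)) ⟶ _) ≫ MBar.toBase k N =
      Spec.map (CommRingCat.ofHom (algebraMap k (CoordRing k N))) := by
  rw [← crossRatioMorphism_base]
  have := (crossRatioMorphism k N).toImage_imageι
  exact (Category.assoc _ _ _).symm.trans (congrArg (· ≫ crossRatioSpace.base k N) this)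

end MBar

/-! ### Constant values of functions. -/

section ConstantPoint

attribute [local instance] MvPolynomial.gradedAlgebra

variable {k : Type u} [Field k] {R : Type u} [CommRing R] [Algebra k R]

theorem P1.affineEval_map {R' : Type u} [CommRing R'] [Algebra k R'] (g : R →ₐ[k] R') (c : R)
    (y : P1.AffineRing k) : g (P1.affineEval (k := k) c y) = P1.affineEval (k := k) (g c) y := by
  have hu : IsUnit ((MvPolynomial.aeval ![g c, 1] : MvPolynomial (Fin 2) k →ₐ[k] R').toRingHom
      (MvPolynomial.X 1)) := by simp
  have hu' : IsUnit ((MvPolynomial.aeval ![c, 1] : MvPolynomial (Fin 2) k →ₐ[k] R).toRingHom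
      (MvPolynomial.X 1)) := by simp
  refine RingHom.congr_fun (f := (g : R →+* R').comp (IsLocalization.Away.lift
      (S := Localization.Away (MvPolynomial.X 1 : MvPolynomial (Fin 2) k)) (MvPolynomial.X 1) hu'))
      (g := IsLocalization.Away.lift
      (S := Localization.Away (MvPolynomial.X 1 : MvPolynomial (Fin 2) k)) (MvPolynomial.X 1) hu) ?_ y.val
  refine IsLocalization.ringHom_ext
    (M := Submonoid.powers (MvPolynomial.X 1 : MvPolynomial (Fin 2) k)) ?_
  refine MvPolynomial.ringHom_ext (fun r => ?_) (fun i => ?_)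
  · simp [IsLocalization.Away.lift, IsLocalization.lift_eq]
  · fin_cases i <;> simp [IsLocalization.Away.lift, IsLocalization.lift_eq]

/-- A function with a constant value at a point defines a constant point of the projective line. -/
theorem P1.ofElement_apply_eq {a : R} {c : k} {x : PrimeSpectrum R}
    (h : a - algebraMap k R c ∈ x.asIdeal) :
    P1.ofElement (k := k) a (x : Spec (CommRingCat.of R)) =
      P1.ofElement (k := k) c (IsLocalRing.closedPoint k : Spec (CommRingCat.of k)) := by
  rw [P1.ofElement_eq, P1.ofElement_eq]
  refine congrArg (P1.affineι k) (?_ :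
    PrimeSpectrum.comap (P1.affineEval (k := k) a) x =
    PrimeSpectrum.comap (P1.affineEval (k := k) c) (IsLocalRing.closedPoint k))
  ext y
  have h1 := P1.affineEval_map (Ideal.Quotient.mkₐ k x.asIdeal) a y
  have h2 := P1.affineEval_map (Algebra.ofId k (R ⧸ x.asIdeal)) c y
  have h3 : (Ideal.Quotient.mkₐ k x.asIdeal) a = Algebra.ofId k (R ⧸ x.asIdeal) c := by
    have := Ideal.Quotient.eq.2 h
    exact this
  have h4 : P1.affineEval (k := k) a y ∈ x.asIdeal ↔ Ideal.Quotient.mkₐ k x.asIdeal (P1.affineEval (k := k) a y) = 0 :=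
    Ideal.Quotient.eq_zero_iff_mem.symm
  change P1.affineEval (k := k) a y ∈ x.asIdeal ↔ P1.affineEval (k := k) c y ∈ IsLocalRing.maximalIdeal k
  rw [IsLocalRing.maximalIdeal_eq_bot, h4, h1, h3, ← h2]
  exact map_eq_zero_iff _ (algebraMap k (R ⧸ x.asIdeal)).injective

/-- A section of a separated morphism is a closed immersion. -/
theorem P1.isClosed_ofElement (c : k) :
    IsClosed {P1.ofElement (k := k) c (IsLocalRing.closedPoint k : Spec (CommRingCat.of k))} := by
  have h1 : P1.ofElement (k := k) c ≫ P1.toBase k = 𝟙 _ := by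
    rw [P1.ofElement_toBase]; exact Spec.map_id _
  have h2 : IsSeparated (P1.toBase k) := by
    have : IsAffineHom (Spec.map (CommRingCat.ofHom (algebraMap k (MvPolynomial.homogeneousSubmodule (Fin 2) k 0)))) :=
      inferInstance
    unfold P1.toBase
    infer_instance
  have h3 : IsClosedImmersion (P1.ofElement (k := k) c ≫ P1.toBase k) := by
    rw [h1]; infer_instance
  have h4 : IsClosedImmersion (P1.ofElement (k := k) c) :=
    IsClosedImmersion.of_comp (P1.ofElement (k := k) c) (P1.toBase k)
  have h5 := (P1.ofElement (k := k) c).isClosedEmbedding.isClosed_range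
  have : Subsingleton (Spec (CommRingCat.of k)) := inferInstanceAs (Subsingleton (PrimeSpectrum k))
  convert h5
  ext y
  constructor
  · rintro rfl; exact ⟨_, rfl⟩
  · rintro ⟨z, rfl⟩
    exact congrArg _ (Subsingleton.elim _ _)

end ConstantPoint

/-! ### The connected component of the closed exceptional locus. -/

section Component

attribute [local instance] MvPolynomial.gradedAlgebra

variable {k : Type u} [Field k]

theorem mem_hesseIdeal_iff [Infinite k] (h3 : (3 : k) ≠ 0) {w : k} (hw : w ^ 2 + w + 1 = 0)
    {r : CoordRing k HesseVertex} : r ∈ hesseIdeal h3 hw ↔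
      ∀ (s : k) (hv : IsConfiguration (hesseVector w s)), CoordRing.eval (k := k) _ hv r = 0 := by
  refine ⟨fun h s hv => eval_hesseVector_eq_zero h3 hw h hv, fun h => ?_⟩
  by_contra hr
  obtain ⟨s, hv, hne⟩ := exists_eval_hesseVector_ne_zero h3 hw hr
  exact hne (h s hv)

theorem hesseCr_sub_mem [Infinite k] (h3 : (3 : k) ≠ 0) {w : k} (hw : w ^ 2 + w + 1 = 0) (i : Fin 11) :
    hesseCr k i - algebraMap k _ (hesseValue w i) ∈ hesseIdeal h3 hw := by
  rw [mem_hesseIdeal_iff]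
  intro s hv
  rw [map_sub, eval_hesseCr hw, AlgHom.commutes]
  exact sub_self _

variable (k) in
/-- The point of the compactification given by a point of the moduli space. -/
def toMBar (x : PrimeSpectrum (CoordRing k HesseVertex)) : MBar k HesseVertex :=
  M0.toMBar k HesseVertex x

variable (k) in
/-- The extensions to the compactification of the cross-ratios `hesseCr`. -/
def hesseMap (i : Fin 11) : MBar k HesseVertex ⟶ P1 k :=
  MBar.crossRatio k ⟨_, injective_hesseQuadruple i⟩

theorem toMBar_hesseMap (i : Fin 11) :
    (M0.toMBar k HesseVertex : Spec (CommRingCat.of (CoordRing k HesseVertex)) ⟶ _) ≫ hesseMap k i =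
      P1.ofElement (k := k) (hesseCr k i) := by
  rw [hesseMap, toMBar_crossRatio, hesseCr, cr, dif_pos (injective_hesseQuadruple i)]

theorem hesseMap_toMBar_hessePrime [Infinite k] (h3 : (3 : k) ≠ 0) {w : k} (hw : w ^ 2 + w + 1 = 0) (i : Fin 11) :
    hesseMap k i (toMBar k (hessePrime h3 hw)) =
      P1.ofElement (k := k) (hesseValue w i) (IsLocalRing.closedPoint k : Spec (CommRingCat.of k)) := by
  rw [← P1.ofElement_apply_eq (x := hessePrime h3 hw) (hesseCr_sub_mem h3 hw i), ← toMBar_hesseMap]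
  rfl

/-- The closure of the curve `hessePrime` in the compactification. -/
def hesseCurve (h3 : (3 : k) ≠ 0) {w : k} (hw : w ^ 2 + w + 1 = 0) : Set (MBar k HesseVertex) :=
  closure {toMBar k (hessePrime h3 hw)}

/-- At the generic point of the curve each of the eleven cross-ratios takes a rational value, which
is a closed point of the projective line; by continuity it takes the same value on the closure, also
at the boundary of the moduli space. -/
theorem hesseCurve_subset_affineLocus [Infinite k] (h3 : (3 : k) ≠ 0) {w : k} (hw : w ^ 2 + w + 1 = 0) :
    hesseCurve h3 hw ⊆ affineLocus (hesseMap k) := by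
  intro z hz
  refine (mem_affineLocus _).2 fun i => ?_
  have h1 : hesseMap k i (toMBar k (hessePrime h3 hw)) ⤳ hesseMap k i z :=
    (specializes_iff_mem_closure.2 hz).map (hesseMap k i).continuous
  rw [hesseMap_toMBar_hessePrime] at h1
  have h2 := (P1.isClosed_ofElement (hesseValue w i)).closure_eq ▸ h1.mem_closure
  rw [Set.mem_singleton_iff.1 h2, P1.ofElement_eq]
  exact ⟨_, rfl⟩

variable (k) in
/-- The affine coordinates of the points with finite cross-ratios. -/
abbrev hesseAffineMap := affineLocusMap (MBar.toBase k HesseVertex) (hesseMap k)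

theorem exists_toMBar_lift : ∃ j' : PrimeSpectrum (CoordRing k HesseVertex) → (affineLocus (hesseMap k)).toScheme,
    (∀ x, (affineLocus (hesseMap k)).ι (j' x) = toMBar k x) ∧
    ∀ x P, P ∈ (hesseAffineMap k (j' x) : PrimeSpectrum (MvPolynomial (Fin 11) k)).asIdeal ↔
      MvPolynomial.aeval (hesseCr k) P ∈ x.asIdeal := by
  let f : Spec (CommRingCat.of (CoordRing k HesseVertex)) ⟶ MBar k HesseVertex := M0.toMBar k HesseVertex
  obtain ⟨f', h1, h2⟩ := exists_lift_affineLocus (MBar.toBase k HesseVertex) (hesseMap k) f toMBar_toBase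
    (c := hesseCr k) toMBar_hesseMap
  refine ⟨f', fun x => ?_, fun x P => ?_⟩
  · exact congrArg (fun t : Spec (CommRingCat.of (CoordRing k HesseVertex)) ⟶ MBar k HesseVertex => t x) h1
  · have := congrArg (fun t : Spec (CommRingCat.of (CoordRing k HesseVertex)) ⟶ Spec (CommRingCat.of (MvPolynomial (Fin 11) k)) => P ∈ (t x : PrimeSpectrum (MvPolynomial (Fin 11) k)).asIdeal) h2
    exact this.to_iff

/-- Polynomial relations between the cross-ratios which hold at the generic point hold on the whole
closed curve. This controls its boundary points, where the coordinate ring is not available. -/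
theorem mem_asIdeal_of_mem_hesseCurve (h3 : (3 : k) ≠ 0) {w : k} (hw : w ^ 2 + w + 1 = 0)
    {z : (affineLocus (hesseMap k)).toScheme} (hz : (affineLocus (hesseMap k)).ι z ∈ hesseCurve h3 hw)
    {P : MvPolynomial (Fin 11) k} (hP : MvPolynomial.aeval (hesseCr k) P ∈ hesseIdeal h3 hw) :
    P ∈ (hesseAffineMap k z : PrimeSpectrum (MvPolynomial (Fin 11) k)).asIdeal := by
  obtain ⟨j', h1, h2⟩ := exists_toMBar_lift (k := k)
  have h3' : j' (hessePrime h3 hw) ⤳ z := by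
    rw [← (affineLocus (hesseMap k)).ι.isEmbedding.isInducing.specializes_iff, h1]
    exact specializes_iff_mem_closure.2 hz
  have h4 := h3'.map (hesseAffineMap k).continuous
  have h5 := (PrimeSpectrum.le_iff_specializes (hesseAffineMap k (j' (hessePrime h3 hw))) (hesseAffineMap k z)).2 h4
  exact h5 ((h2 (hessePrime h3 hw) P).2 hP)

variable (k) in
/-- The polynomial which corresponds to the function `hesseGenericity`. -/
def hessePolynomial : MvPolynomial (Fin 11) k :=
  hesseObstruction (.X 0) (.X 1) (.X 2) (.X 3) (.X 4) (.X 5) (.X 6) (.X 7) (.X 8)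

theorem aeval_hessePolynomial [IsAlgClosed k] :
    MvPolynomial.aeval (hesseCr k) (hessePolynomial k) = hesseGenericity k := by
  have := map_hesseObstruction (MvPolynomial.aeval (hesseCr k) : MvPolynomial (Fin 11) k →ₐ[k] _).toRingHom
    (.X 0) (.X 1) (.X 2) (.X 3) (.X 4) (.X 5) (.X 6) (.X 7) (.X 8)
  simp only [AlgHom.toRingHom_eq_coe, RingHom.coe_coe, MvPolynomial.aeval_X] at this
  exact this

variable (k) in
/-- An open neighbourhood of the curves `hesseCurve`. -/
def hesseNeighbourhood : Set (MBar k HesseVertex) :=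
  (affineLocus (hesseMap k)).ι '' (hesseAffineMap k ⁻¹'
    ((PrimeSpectrum.basicOpen (hessePolynomial k) : TopologicalSpace.Opens (PrimeSpectrum _)) : Set (PrimeSpectrum _)))

theorem isOpen_hesseNeighbourhood : IsOpen (hesseNeighbourhood k) :=
  (affineLocus (hesseMap k)).ι.isOpenEmbedding.isOpenMap _
    ((PrimeSpectrum.basicOpen (hessePolynomial k)).isOpen.preimage (hesseAffineMap k).continuous)

theorem C_notMem {σ : Type*} {c : k} (hc : c ≠ 0) (x : PrimeSpectrum (MvPolynomial σ k)) :
    MvPolynomial.C c ∉ x.asIdeal := fun h =>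
  x.isPrime.ne_top (Ideal.eq_top_of_isUnit_mem _ h (hc.isUnit.map MvPolynomial.C))

/-- The obstruction is a nonzero constant on the curve. -/
theorem hesseCurve_subset_hesseNeighbourhood [IsAlgClosed k] (h3 : (3 : k) ≠ 0) {w : k}
    (hw : w ^ 2 + w + 1 = 0) : hesseCurve h3 hw ⊆ hesseNeighbourhood k := by
  have : Infinite k := IsAlgClosed.instInfinite
  intro z hz
  obtain ⟨z', rfl⟩ : z ∈ Set.range (affineLocus (hesseMap k)).ι := by
    rw [Scheme.Opens.range_ι]; exact hesseCurve_subset_affineLocus h3 hw hz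
  refine ⟨z', ?_, rfl⟩
  intro hG
  let c := hesseObstruction w (w ^ 2) (-w) (-w ^ 2) (-w) (-w ^ 2) (-w) (-w ^ 2) (-w)
  have hmem : hessePolynomial k - MvPolynomial.C c ∈
      (hesseAffineMap k z' : PrimeSpectrum (MvPolynomial (Fin 11) k)).asIdeal := by
    refine mem_asIdeal_of_mem_hesseCurve h3 hw hz ?_
    rw [mem_hesseIdeal_iff]
    intro s hv
    rw [map_sub, aeval_hessePolynomial, MvPolynomial.aeval_C, map_sub, AlgHom.commutes, eval_hesseGenericity hw]
    exact sub_self _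
  have := Ideal.sub_mem _ hG hmem
  rw [sub_sub_cancel] at this
  exact C_notMem (hesseObstruction_hesseValue_ne_zero h3 hw) _ this

/-- The coordinate of `n` is constant with value `w` on one curve and `w'` on the other, including
their boundary points. -/
theorem disjoint_hesseCurve [Infinite k] (h3 : (3 : k) ≠ 0) {w w' : k} (hw : w ^ 2 + w + 1 = 0)
    (hw' : w' ^ 2 + w' + 1 = 0) (hne : w ≠ w') : Disjoint (hesseCurve h3 hw) (hesseCurve h3 hw') := by
  refine Set.disjoint_left.2 fun z hz hz' => ?_
  obtain ⟨z', rfl⟩ : z ∈ Set.range (affineLocus (hesseMap k)).ι := by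
    rw [Scheme.Opens.range_ι]; exact hesseCurve_subset_affineLocus h3 hw hz
  have key : ∀ {w : k} (hw : w ^ 2 + w + 1 = 0), (affineLocus (hesseMap k)).ι z' ∈ hesseCurve h3 hw →
      MvPolynomial.X 0 - MvPolynomial.C w ∈
      (hesseAffineMap k z' : PrimeSpectrum (MvPolynomial (Fin 11) k)).asIdeal := by
    intro w hw hz
    refine mem_asIdeal_of_mem_hesseCurve h3 hw hz ?_
    rw [map_sub, MvPolynomial.aeval_X, MvPolynomial.aeval_C]
    exact hesseCr_sub_mem h3 hw 0
  have := Ideal.sub_mem _ (key hw' hz') (key hw hz)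
  rw [sub_sub_sub_cancel_left, ← MvPolynomial.C_sub] at this
  exact C_notMem (sub_ne_zero.2 hne) _ this

theorem toMBar_mem_hesseNeighbourhood [IsAlgClosed k] {x : PrimeSpectrum (CoordRing k HesseVertex)}
    (h : toMBar k x ∈ hesseNeighbourhood k) : hesseGenericity k ∉ x.asIdeal := by
  obtain ⟨z, hz, hzx⟩ := h
  obtain ⟨j', h1, h2⟩ := exists_toMBar_lift (k := k)
  obtain rfl : z = j' x := (affineLocus (hesseMap k)).ι.isEmbedding.injective (hzx.trans (h1 x).symm)
  rw [← aeval_hessePolynomial, ← h2]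
  exact hz

variable (k) in
/-- The image of the exceptional locus of the hypergraph morphism in the compactification. -/
abbrev hesseExceptional : Set (MBar k HesseVertex) :=
  M0.toMBar k HesseVertex '' exceptionalLocus (hypergraphMorphism k hesseHypergraph)

theorem isConnectedComponentOf_hesseCurve [IsAlgClosed k] (h3 : (3 : k) ≠ 0) {w : k}
    (hw : w ^ 2 + w + 1 = 0) :
    IsConnectedComponentOf (hesseCurve h3 hw) (closure (hesseExceptional k)) := by
  have : Infinite k := IsAlgClosed.instInfinite
  have hw3 : w ^ 3 = 1 := by linear_combination (w - 1) * hw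
  have hw' : (w ^ 2) ^ 2 + w ^ 2 + 1 = 0 := by linear_combination (w ^ 2 - w + 1) * hw
  have hne : w ≠ w ^ 2 := by
    intro h
    have h1 : w = 1 := by linear_combination hw3 + (1 + w) * h
    rw [h1] at hw
    exact h3 (by linear_combination hw)
  -- In the open neighbourhood the exceptional points lie on one of the two closed curves, and this
  -- passes to the closure of the exceptional locus.
  have hsub : closure (hesseExceptional k) ∩ hesseNeighbourhood k ⊆
      hesseCurve h3 hw ∪ hesseCurve h3 hw' := by
    have hcl : IsClosed (hesseCurve h3 hw ∪ hesseCurve h3 hw') := isClosed_closure.union isClosed_closure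
    rintro z ⟨hz, hzV⟩
    have h1 : z ∈ closure (hesseExceptional k ∩ hesseNeighbourhood k) :=
      IsOpen.closure_inter isOpen_hesseNeighbourhood ⟨hz, hzV⟩
    refine hcl.closure_subset_iff.2 ?_ h1
    rintro _ ⟨⟨x, hx, rfl⟩, hxV⟩
    obtain ⟨v, hv, hvx⟩ := exists_hessePrime_specializes h3 (x := x) hx (toMBar_mem_hesseNeighbourhood hxV)
    have hmem : toMBar k x ∈ hesseCurve h3 hv :=
      specializes_iff_mem_closure.1 (hvx.map (M0.toMBar k HesseVertex).continuous)
    have hvw : (v - w) * (v - w ^ 2) = 0 := by linear_combination hv - v * hw + hw3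
    rcases mul_eq_zero.1 hvw with h | h
    · obtain rfl := sub_eq_zero.1 h
      exact Or.inl hmem
    · obtain rfl := sub_eq_zero.1 h
      exact Or.inr hmem
  have hηE : toMBar k (hessePrime h3 hw) ∈ closure (hesseExceptional k) :=
    subset_closure ⟨_, hessePrime_mem_exceptionalLocus h3 hw, rfl⟩
  have hCE : hesseCurve h3 hw ⊆ closure (hesseExceptional k) :=
    isClosed_closure.closure_subset_iff.2 (Set.singleton_subset_iff.2 hηE)
  have hirr : IsIrreducible (hesseCurve h3 hw) := isIrreducible_singleton.closure
  refine ⟨toMBar k (hessePrime h3 hw), hηE, ?_⟩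
  apply Set.Subset.antisymm
  · exact hirr.isConnected.isPreconnected.subset_connectedComponentIn (subset_closure rfl) hCE
  · intro z hz
    by_contra hzC
    have hpre := isPreconnected_connectedComponentIn (F := closure (hesseExceptional k))
      (x := toMBar k (hessePrime h3 hw))
    have hdisj := disjoint_hesseCurve h3 hw hw' hne
    -- Within the closed exceptional locus the curve is cut out by an open set, the neighbourhood
    -- without the other curve. A connected set which meets both this open set and the complement of
    -- the curve would meet their intersection.
    have hopen : IsOpen (hesseNeighbourhood k \ hesseCurve h3 hw') :=
      isOpen_hesseNeighbourhood.sdiff isClosed_closure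
    have hCV : hesseCurve h3 hw ⊆ hesseNeighbourhood k \ hesseCurve h3 hw' := fun y hy =>
      ⟨hesseCurve_subset_hesseNeighbourhood h3 hw hy, fun hy' => Set.disjoint_left.1 hdisj hy hy'⟩
    obtain ⟨y, hy, hyV, hyC⟩ := hpre _ _ hopen (isClosed_closure (s := {toMBar k (hessePrime h3 hw)})).isOpen_compl
      (fun y _ => by
        by_cases h : y ∈ hesseCurve h3 hw
        · exact Or.inl (hCV h)
        · exact Or.inr h)
      ⟨_, mem_connectedComponentIn hηE, hCV (subset_closure rfl)⟩ ⟨z, hz, hzC⟩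
    rcases hsub ⟨connectedComponentIn_subset _ _ hy, hyV.1⟩ with h | h
    · exact hyC h
    · exact hyV.2 h

end Component

/-! ### Dimension and transcendence degree. -/

section Dimension

variable {k : Type u} [Field k]

theorem isAlgebraic_of_adjoin_bot {R : Type*} [CommRing R] [Algebra k R] {L : Type*} [Field L]
    [Algebra k L] (f : R →ₐ[k] L) {x : L} (h : IsAlgebraic k x) :
    IsAlgebraic (IntermediateField.adjoin k (f '' ((⊥ : Subalgebra k R) : Set R))) x :=
  h.tower_top _

/-- A strict chain of three prime ideals produces two algebraically independent functions. -/
theorem two_le_trdeg_of_lt {R : Type*} [CommRing R] [Algebra k R] {P₀ P₁ P₂ : Ideal R}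
    [P₁.IsPrime] [P₂.IsPrime] (h₀₁ : P₀ < P₁) (h₁₂ : P₁ < P₂) {L : Type u} [Field L] [Algebra k L]
    (f : R →ₐ[k] L) (hf : RingHom.ker f = P₀) : 2 ≤ Algebra.trdeg k L := by
  -- A function `y` in the largest prime but not in the middle one is transcendental modulo the
  -- middle one; a function `x` in the middle prime but not in the smallest is then transcendental
  -- over `k(y)`, by `not_isAlgebraic_of_lt` for the subring `k[y]`.
  obtain ⟨y, hy, hy'⟩ := SetLike.exists_of_lt h₁₂
  obtain ⟨x, hx, hx'⟩ := SetLike.exists_of_lt h₀₁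
  have hbot : ∀ r ∈ (⊥ : Subalgebra k R), r ∈ P₂ → r ∈ P₁ := by
    intro r hr hr2
    obtain ⟨c, rfl⟩ := Algebra.mem_bot.1 hr
    by_cases hc : c = 0
    · rw [hc, map_zero]; exact zero_mem _
    · exact absurd (Ideal.eq_top_of_isUnit_mem _ hr2 ((Ne.isUnit hc).map _)) (Ideal.IsPrime.ne_top ‹_›)
  let g : R →ₐ[k] FractionRing (R ⧸ P₁) :=
    (IsScalarTower.toAlgHom k (R ⧸ P₁) (FractionRing (R ⧸ P₁))).comp (Ideal.Quotient.mkₐ k P₁)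
  have hg : RingHom.ker g = P₁ := by
    ext a
    rw [RingHom.mem_ker]
    change algebraMap (R ⧸ P₁) (FractionRing (R ⧸ P₁)) (Ideal.Quotient.mk _ a) = 0 ↔ _
    rw [map_eq_zero_iff _ (IsFractionRing.injective _ _), Ideal.Quotient.eq_zero_iff_mem]
  have hgy : ¬ IsAlgebraic k (g y) := fun H =>
    not_isAlgebraic_of_lt h₁₂.le ⊥ hbot hy hy' g hg (isAlgebraic_of_adjoin_bot g H)
  have hpoly : ∀ F : Polynomial k, Polynomial.aeval y F ∈ P₁ → F = 0 := by
    intro F hF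
    by_contra hne
    refine hgy ⟨F, hne, ?_⟩
    rw [Polynomial.aeval_algHom_apply]
    rwa [← hg] at hF
  have hfy : Transcendental k (f y) := by
    rintro ⟨F, hne, hF⟩
    rw [Polynomial.aeval_algHom_apply] at hF
    have : Polynomial.aeval y F ∈ RingHom.ker f := hF
    rw [hf] at this
    exact hne (hpoly F (h₀₁.le this))
  have hadj : ∀ r ∈ Algebra.adjoin k {y}, r ∈ P₁ → r ∈ P₀ := by
    intro r hr hr1
    obtain ⟨F, rfl⟩ := Algebra.adjoin_mem_exists_aeval _ _ hr
    rw [hpoly F hr1, map_zero]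
    exact zero_mem _
  have hfx := not_isAlgebraic_of_lt h₀₁.le _ hadj hx hx' f hf
  set K := IntermediateField.adjoin k (f '' (Algebra.adjoin k {y} : Subalgebra k R)) with hK
  have h1 : Algebra.Transcendental k K :=
    ⟨⟨f y, IntermediateField.subset_adjoin _ _ ⟨y, Algebra.subset_adjoin rfl, rfl⟩⟩, fun H =>
      hfy (H.algHom K.val)⟩
  have h2 : Algebra.Transcendental K L := ⟨f x, hfx⟩
  have e1 : (1 : Cardinal.{u}) ≤ Algebra.trdeg k K := Cardinal.one_le_iff_pos.2 (trdeg_pos _ _)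
  have e2 : (1 : Cardinal.{u}) ≤ Algebra.trdeg K L := Cardinal.one_le_iff_pos.2 (trdeg_pos _ _)
  rw [← trdeg_add_eq k K (A := L), ← one_add_one_eq_two]
  exact add_le_add e1 e2

theorem exists_specializes_of_two_le {T : Type*} [TopologicalSpace T] [QuasiSober T]
    (h : 2 ≤ topologicalKrullDim T) :
    ∃ x y z : T, x ⤳ y ∧ y ⤳ z ∧ ¬ y ⤳ x ∧ ¬ z ⤳ y := by
  obtain ⟨l, hl⟩ := Order.le_krullDim_iff.1 (show ((2 : ℕ) : WithBot ℕ∞) ≤ Order.krullDim _ from h)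
  have key : ∀ {Z W : TopologicalSpace.IrreducibleCloseds T}, Z < W →
      W.isIrreducible.genericPoint ⤳ Z.isIrreducible.genericPoint ∧
        ¬ Z.isIrreducible.genericPoint ⤳ W.isIrreducible.genericPoint := by
    intro Z W hZW
    have e : ∀ Z : TopologicalSpace.IrreducibleCloseds T, closure {Z.isIrreducible.genericPoint} = (Z : Set T) := fun Z => by
      rw [Z.isIrreducible.closure_genericPoint]
      exact Z.isClosed
    rw [specializes_iff_closure_subset, specializes_iff_closure_subset, e, e]
    exact ⟨hZW.le, fun h => hZW.not_ge h⟩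
  have h0 := key (l.strictMono (a := ⟨0, by omega⟩) (b := ⟨1, by omega⟩) (Fin.mk_lt_mk.2 zero_lt_one))
  have h1 := key (l.strictMono (a := ⟨1, by omega⟩) (b := ⟨2, by omega⟩) (Fin.mk_lt_mk.2 one_lt_two))
  exact ⟨_, _, _, h1.1, h0.1, h1.2, h0.2⟩

/-- The dimension of the closure of a point is bounded by the transcendence degree of the fields
over which it is defined. -/
theorem two_le_trdeg_of_two_le_topologicalKrullDim {X : Scheme.{u}}
    (b : X ⟶ Spec (CommRingCat.of k)) {L : Type u} [Field L] [Algebra k L]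
    (ξ : Spec (CommRingCat.of L) ⟶ X)
    (hξ : ξ ≫ b = Spec.map (CommRingCat.ofHom (algebraMap k L)))
    (h : 2 ≤ topologicalKrullDim (closure {ξ (IsLocalRing.closedPoint L : Spec (CommRingCat.of L))})) :
    2 ≤ Algebra.trdeg k L := by
  set a := ξ (IsLocalRing.closedPoint L : Spec (CommRingCat.of L)) with ha
  have : QuasiSober (closure {a}) :=
    (isClosed_closure (s := {a})).isClosedEmbedding_subtypeVal.quasiSober
  obtain ⟨x, y, z, hxy, hyz, hyx, hzy⟩ := exists_specializes_of_two_le h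
  have hax : a ⤳ x := specializes_iff_mem_closure.2 x.2
  rw [← Topology.IsInducing.subtypeVal.specializes_iff] at hxy hyz hyx hzy
  -- An affine chart around the most special point of the chain contains the whole chain and the
  -- image of `ξ`, because open sets are stable under generization.
  obtain ⟨i, z', hz'⟩ := X.affineCover.exists_eq z.1
  let R := X.affineOpenCover.X i
  let ι : Spec R ⟶ X := X.affineCover.f i
  have hι : IsOpenImmersion ι := inferInstanceAs (IsOpenImmersion (X.affineCover.f i))
  have hmem : ∀ t, t ⤳ z.1 → ∃ t', ι t' = t := fun t ht =>
    ht.mem_open ι.isOpenEmbedding.isOpen_range ⟨z', hz'⟩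
  obtain ⟨y', hy'⟩ := hmem y hyz
  have hrange : Set.range ξ ⊆ Set.range ι := by
    have : Subsingleton (Spec (CommRingCat.of L)) := inferInstanceAs (Subsingleton (PrimeSpectrum L))
    rintro _ ⟨t, rfl⟩
    rw [Subsingleton.elim t (IsLocalRing.closedPoint L : Spec (CommRingCat.of L))]
    exact hmem a (hax.trans (hxy.trans hyz))
  let ξ' := IsOpenImmersion.lift ι ξ hrange
  have hξ' : ξ' ≫ ι = ξ := IsOpenImmersion.lift_fac _ _ _
  let ψ : R ⟶ CommRingCat.of L := Spec.preimage ξ'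
  let θ : CommRingCat.of k ⟶ R := Spec.preimage (ι ≫ b)
  have hψ : Spec.map ψ = ξ' := Spec.map_preimage _
  have hcomp : θ ≫ ψ = CommRingCat.ofHom (algebraMap k L) := by
    apply Spec.map_injective
    rw [Spec.map_comp, hψ, Spec.map_preimage, ← Category.assoc, hξ', hξ]
  let : Algebra k R := θ.hom.toAlgebra
  let f : R →ₐ[k] L := ⟨ψ.hom, fun r => congrArg (fun t => t.hom r) hcomp⟩
  have hιa : ι (ξ' (IsLocalRing.closedPoint L : Spec (CommRingCat.of L))) = a := by
    rw [ha, ← hξ']; rfl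
  let a' : PrimeSpectrum R := ξ' (IsLocalRing.closedPoint L : Spec (CommRingCat.of L))
  have hker : RingHom.ker f = a'.asIdeal := by
    have : a' = Spec.map ψ (IsLocalRing.closedPoint L : Spec (CommRingCat.of L)) := by rw [hψ]
    rw [this]
    ext r
    change ψ.hom r = 0 ↔ ψ.hom r ∈ IsLocalRing.maximalIdeal L
    rw [IsLocalRing.maximalIdeal_eq_bot]
    rfl
  have hlt : ∀ s t : PrimeSpectrum R, ι s ⤳ ι t → ¬ ι t ⤳ ι s → s.asIdeal < t.asIdeal := by
    have hsp : ∀ s t : PrimeSpectrum R, s.asIdeal ≤ t.asIdeal ↔ ι s ⤳ ι t := fun s t =>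
      (PrimeSpectrum.le_iff_specializes s t).trans ι.isOpenEmbedding.isInducing.specializes_iff.symm
    exact fun s t h h' => lt_of_le_not_ge ((hsp s t).2 h) fun H => h' ((hsp t s).1 H)
  have hιz : ι z' = z.1 := hz'
  have e1 : a'.asIdeal < (y' : PrimeSpectrum R).asIdeal := by
    refine hlt a' y' ?_ ?_
    · exact (congrArg₂ Specializes hιa hy').mpr (hax.trans hxy)
    · exact fun H => hyx (((congrArg₂ Specializes hy' hιa).mp H).trans hax)
  have e2 : (y' : PrimeSpectrum R).asIdeal < (z' : PrimeSpectrum R).asIdeal := by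
    refine hlt y' z' ?_ ?_
    · exact (congrArg₂ Specializes hy' hιz).mpr hyz
    · exact fun H => hzy ((congrArg₂ Specializes hιz hy').mp H)
  have hy : (y' : PrimeSpectrum R).asIdeal.IsPrime := (y' : PrimeSpectrum R).2
  have hz : (z' : PrimeSpectrum R).asIdeal.IsPrime := (z' : PrimeSpectrum R).2
  exact @two_le_trdeg_of_lt _ _ _ _ _ _ _ _ hy hz e1 e2 _ _ _ f hker

theorem trdeg_fractionRing_polynomial : Algebra.trdeg k (FractionRing (Polynomial k)) = 1 := by
  have : Algebra.IsAlgebraic (Polynomial k) (FractionRing (Polynomial k)) :=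
    (IsFractionRing.comap_isAlgebraic_iff (K := FractionRing (Polynomial k))).2 inferInstance
  rw [← trdeg_add_eq k (Polynomial k), Polynomial.trdeg_of_isDomain,
    trdeg_eq_zero, add_zero]

end Dimension

/-! ### The dimension of the curve. -/

section HesseCurve

variable {k : Type u} [Field k]

variable (k) in
/-- The inclusion of the moduli space in its compactification, with its source expressed as an affine
scheme. -/
def inclusion : Spec (CommRingCat.of (CoordRing k HesseVertex)) ⟶ MBar k HesseVertex :=
  M0.toMBar k HesseVertex

instance : IsOpenImmersion (inclusion k) := inferInstanceAs (IsOpenImmersion (M0.toMBar k HesseVertex))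

theorem inclusion_toBase : inclusion k ≫ MBar.toBase k HesseVertex =
    Spec.map (CommRingCat.ofHom (algebraMap k (CoordRing k HesseVertex))) :=
  toMBar_toBase

theorem ker_comp_point {L : Type u} [Field L] [Algebra k L] (f : CoordRing k HesseVertex →ₐ[k] L)
    {x : PrimeSpectrum (CoordRing k HesseVertex)} (hx : RingHom.ker f = x.asIdeal) :
    (Spec.map (CommRingCat.ofHom f.toRingHom) ≫ inclusion k)
        (IsLocalRing.closedPoint L : Spec (CommRingCat.of L)) = toMBar k x := by
  have : (Spec.map (CommRingCat.ofHom f.toRingHom)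
      (IsLocalRing.closedPoint L : Spec (CommRingCat.of L)) : PrimeSpectrum (CoordRing k HesseVertex)) = x := by
    refine PrimeSpectrum.ext (Ideal.ext fun r => ?_)
    rw [← hx, RingHom.mem_ker]
    change f r ∈ IsLocalRing.maximalIdeal L ↔ _
    rw [IsLocalRing.maximalIdeal_eq_bot]
    rfl
  rw [← this]
  rfl

theorem comp_toBase {L : Type u} [Field L] [Algebra k L] (f : CoordRing k HesseVertex →ₐ[k] L) :
    (Spec.map (CommRingCat.ofHom f.toRingHom) ≫ inclusion k) ≫
        MBar.toBase k HesseVertex = Spec.map (CommRingCat.ofHom (algebraMap k L)) := by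
  rw [Category.assoc, inclusion_toBase, ← Spec.map_comp, ← CommRingCat.ofHom_comp]
  congr 2
  exact f.comp_algebraMap

theorem two_le_trdeg_of_toMBar {L : Type u} [Field L] [Algebra k L]
    (f : CoordRing k HesseVertex →ₐ[k] L) {x : PrimeSpectrum (CoordRing k HesseVertex)}
    (hx : RingHom.ker f = x.asIdeal) (h : 2 ≤ topologicalKrullDim (closure {toMBar k x})) :
    2 ≤ Algebra.trdeg k L := by
  rw [← ker_comp_point f hx] at h
  exact two_le_trdeg_of_two_le_topologicalKrullDim (MBar.toBase k HesseVertex) _ (comp_toBase f) h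

/-- The generic point is defined over `k(X)`, of transcendence degree one, which bounds the
dimension from above; a member of the family is a proper specialization, which bounds it from below.
-/
theorem topologicalKrullDim_hesseCurve [Infinite k] (h3 : (3 : k) ≠ 0) {w : k}
    (hw : w ^ 2 + w + 1 = 0) : topologicalKrullDim (hesseCurve h3 hw) = 1 := by
  apply le_antisymm
  · by_contra hlt
    have h2 : 2 ≤ topologicalKrullDim (hesseCurve h3 hw) := by
      have := ENat.WithBot.add_one_le_iff (n := 1) |>.2 (not_le.1 hlt)
      norm_num at this
      exact this
    have := two_le_trdeg_of_toMBar (x := hessePrime h3 hw) (CoordRing.eval (k := k) _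
      (isConfiguration_hesseVector h3 hw (transcendental_X_fractionRing (k := k)))) rfl h2
    rw [trdeg_fractionRing_polynomial] at this
    exact absurd this (by norm_num)
  · obtain ⟨s, hv⟩ := exists_isConfiguration_hesseVector h3 hw
    have hx := hessePrime_specializes_point h3 hw hv
    have hne := point_ne_hessePrime h3 hw hv
    have hj : Function.Injective (toMBar k) := (M0.toMBar k HesseVertex).isOpenEmbedding.injective
    have hx' : toMBar k (hessePrime h3 hw) ⤳ toMBar k (M0.point _ hv) := hx.map (M0.toMBar k HesseVertex).continuous
    have : (⟨toMBar k (hessePrime h3 hw), subset_closure rfl⟩ : hesseCurve h3 hw) ⤳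
        ⟨toMBar k (M0.point _ hv), specializes_iff_mem_closure.1 hx'⟩ :=
      Topology.IsInducing.subtypeVal.specializes_iff.1 hx'
    have h0 := topologicalKrullDim_pos_of_specializes this fun e => hne (hj (congrArg Subtype.val e))
    have := ENat.WithBot.add_one_le_iff (n := 0) |>.2 h0
    norm_num at this
    exact this

end HesseCurve

/-! ### Functions without poles on a fibre over a curve. -/

section CurveFunctions

variable {k : Type u} [Field k]

/-- By lying over and going up, chains of primes lift to the integral extension. This bounds the
number of variables in Noether normalization. -/
theorem ringKrullDim_le_of_isIntegral_of_injective {R S : Type*} [CommRing R] [CommRing S] [Algebra R S]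
    [Algebra.IsIntegral R S] (h : Function.Injective (algebraMap R S)) {n : ℕ}
    (hS : ringKrullDim S ≤ n) : ringKrullDim R ≤ n := by
  have key : ∀ l : LTSeries (PrimeSpectrum R), ∃ l' : LTSeries (PrimeSpectrum S), l'.length = l.length ∧
      PrimeSpectrum.comap (algebraMap R S) l'.last = l.last := by
    intro l
    induction l using RelSeries.inductionOn' with
    | singleton x =>
      obtain ⟨Q, -, hQ, hc⟩ := Ideal.exists_ideal_over_prime_of_isIntegral x.asIdeal (⊥ : Ideal S) (by
        intro r hr
        have : algebraMap R S r = 0 := hr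
        rw [map_eq_zero_iff _ h] at this
        rw [this]; exact zero_mem _)
      exact ⟨RelSeries.singleton _ ⟨Q, hQ⟩, rfl, PrimeSpectrum.ext hc⟩
    | snoc p x hx ih =>
      obtain ⟨l', hl', hlast⟩ := ih
      obtain ⟨Q, hQ', hQ, hc⟩ := Ideal.exists_ideal_over_prime_of_isIntegral x.asIdeal l'.last.asIdeal (by
        have : l'.last.asIdeal.comap (algebraMap R S) = p.last.asIdeal :=
          congrArg PrimeSpectrum.asIdeal hlast
        rw [this]
        exact le_of_lt hx)
      have hlt : l'.last < ⟨Q, hQ⟩ := by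
        refine lt_of_le_of_ne hQ' fun e => ?_
        have : p.last = x := by
          rw [← hlast, e]; exact PrimeSpectrum.ext hc
        exact (ne_of_lt hx) this
      exact ⟨l'.snoc ⟨Q, hQ⟩ hlt, by simp [hl'], by simpa using PrimeSpectrum.ext hc⟩
  refine iSup_le fun l => ?_
  obtain ⟨l', hl', -⟩ := key l
  rw [← hl']
  exact (le_iSup (fun l : LTSeries (PrimeSpectrum S) => (l.length : WithBot ℕ∞)) l').trans hS

/-- Noether normalization of a curve. -/
theorem exists_isIntegral_adjoin (A : Type u) [CommRing A] [IsDomain A] [Algebra k A]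
    [Algebra.FiniteType k A] (h : ringKrullDim A ≤ 1) :
    ∃ t : A, ∀ a : A, IsIntegral (Algebra.adjoin k {t}) a := by
  obtain ⟨s, g, hinj, hint⟩ := exists_integral_inj_algHom_of_fg k A
  have hs : s ≤ 1 := by
    algebraize [g.toRingHom]
    have h1 := ringKrullDim_le_of_isIntegral_of_injective (R := MvPolynomial (Fin s) k) (S := A) hinj
      (n := 1) h
    rw [MvPolynomial.ringKrullDim_of_isNoetherianRing, ringKrullDim_eq_zero_of_field, zero_add] at h1
    simpa using h1
  -- There is at most one variable; if there is none, any element serves as `t`.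
  obtain ⟨t, ht⟩ : ∃ t : A, ∀ i, g (MvPolynomial.X i) = t := by
    rcases Nat.le_one_iff_eq_zero_or_eq_one.1 hs with rfl | rfl
    · exact ⟨0, fun i => i.elim0⟩
    · exact ⟨g (MvPolynomial.X 0), fun i => by rw [Subsingleton.elim i 0]⟩
  have hrange : ∀ P, g P ∈ Algebra.adjoin k {t} := by
    intro P
    induction P using MvPolynomial.induction_on with
    | C r => rw [← MvPolynomial.algebraMap_eq, AlgHom.commutes]; exact Subalgebra.algebraMap_mem _ _
    | add p q hp hq => rw [map_add]; exact add_mem hp hq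
    | mul_X p i hp => rw [map_mul, ht]; exact mul_mem hp (Algebra.subset_adjoin rfl)
  refine ⟨t, fun a => ?_⟩
  let φ : MvPolynomial (Fin s) k →+* Algebra.adjoin k {t} := (g.codRestrict _ hrange).toRingHom
  obtain ⟨P, hP, hPa⟩ := hint a
  refine ⟨P.map φ, hP.map _, ?_⟩
  rw [Polynomial.eval₂_map]
  exact hPa

theorem isIntegral_adjoin_map {A : Type*} [CommRing A] [Algebra k A] {L : Type*} [Field L] [Algebra k L]
    (θ : A →ₐ[k] L) {t a : A} (h : IsIntegral (Algebra.adjoin k {t}) a) :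
    IsIntegral (IntermediateField.adjoin k {θ t}) (θ a) := by
  have hle : ∀ x : Algebra.adjoin k {t}, θ x ∈ IntermediateField.adjoin k {θ t} := by
    have : Algebra.adjoin k {t} ≤ (IntermediateField.adjoin k {θ t}).toSubalgebra.comap θ := by
      refine Algebra.adjoin_le ?_
      rintro _ rfl
      exact IntermediateField.subset_adjoin _ _ rfl
    exact fun x => this x.2
  exact h.map_of_comp_eq ((θ : A →+* L).comp (algebraMap (Algebra.adjoin k {t}) A) |>.codRestrict
    (IntermediateField.adjoin k {θ t}).toSubfield hle) (θ : A →+* L) rfl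

variable {S B : Scheme.{u}}

theorem finiteType_of_isAffine {V : Scheme.{u}} [IsAffine V] (b : V ⟶ Spec (CommRingCat.of k))
    [LocallyOfFiniteType b] :
    (b.appTop.hom.comp (Scheme.ΓSpecIso (CommRingCat.of k)).inv.hom).FiniteType := by
  have h1 : b.appTop.hom.FiniteType := HasRingHomProperty.appTop (P := @LocallyOfFiniteType) b inferInstance
  refine h1.comp (RingHom.FiniteType.of_surjective _ ?_)
  exact (ConcreteCategory.bijective_of_isIso (Scheme.ΓSpecIso (CommRingCat.of k)).inv).2

theorem ringKrullDim_le_topologicalKrullDim {V : Scheme.{u}} [IsAffine V] :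
    ringKrullDim Γ(V, ⊤) ≤ topologicalKrullDim V := by
  rw [← PrimeSpectrum.topologicalKrullDim_eq_ringKrullDim]
  change topologicalKrullDim (Spec Γ(V, ⊤)) ≤ _
  exact (IsHomeomorph.topologicalKrullDim_eq _ V.isoSpec.hom.homeomorph.isHomeomorph).ge

attribute [local instance] MvPolynomial.gradedAlgebra

/-- A function on a proper scheme over an affine scheme is integral over the functions on the
base. -/
theorem isIntegralElem_of_forall_mem_range {V : Scheme.{u}} [IsAffine V] (p : S ⟶ V)
    [UniversallyClosed p] (φ : S ⟶ P1 k) (hφ : ∀ z, φ z ∈ Set.range (P1.affineι k))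
    {L : Type u} [Field L] [Algebra k L] (ξ : Spec (CommRingCat.of L) ⟶ S) {c : L}
    (hc : ξ ≫ φ = P1.ofElement (k := k) c) :
    (pullbackFunctions (ξ ≫ p)).IsIntegralElem c := by
  let v : S ⟶ Spec (CommRingCat.of (P1.AffineRing k)) :=
    IsOpenImmersion.lift (P1.affineι k) φ (Set.range_subset_iff.2 hφ)
  have hv : v ≫ P1.affineι k = φ := IsOpenImmersion.lift_fac _ _ _
  -- A function without poles is a global function on `S`, and global functions on a universally
  -- closed scheme over an affine base are integral over the base.
  have h1 := isIntegral_appTop_of_universallyClosed p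
    (v.appTop ((Scheme.ΓSpecIso (CommRingCat.of (P1.AffineRing k))).inv (P1.affineCoordinate k)))
  have h2 : pullbackFunctions ξ
      (v.appTop ((Scheme.ΓSpecIso (CommRingCat.of (P1.AffineRing k))).inv (P1.affineCoordinate k))) = c := by
    refine (pullbackFunctions_appTop (S := CommRingCat.of (P1.AffineRing k)) ξ v
      (CommRingCat.ofHom (P1.affineEval (k := k) c)) ?_ (P1.affineCoordinate k)).trans ?_
    · rw [← cancel_mono (P1.affineι k), Category.assoc, hv, hc, P1.ofElement_eq]
    · simp [P1.affineEval_affineCoordinate]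
  obtain ⟨P, hP, hP0⟩ := h1
  refine ⟨P, hP, ?_⟩
  have h3 : pullbackFunctions (ξ ≫ p) = (pullbackFunctions ξ).comp p.appTop.hom := by
    rw [pullbackFunctions, Scheme.Hom.comp_appTop]; rfl
  rw [h3, ← h2, ← Polynomial.hom_eval₂, hP0, map_zero]

/-- Consider a proper morphism to a curve and finitely many rational functions which have no poles
on one of its fibres. They are algebraic over a field generated by one element. -/
theorem exists_isAlgebraic_of_fibre {ι : Type*} [Finite ι] (p : S ⟶ B) [UniversallyClosed p]
    (b : B ⟶ Spec (CommRingCat.of k)) [IsIntegral B] [LocallyOfFiniteType b]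
    (hdim : topologicalKrullDim B ≤ 1) {y : B} (φ : ι → (S ⟶ P1 k))
    (hφ : ∀ i z, p z = y → φ i z ∈ Set.range (P1.affineι k))
    {L : Type u} [Field L] [Algebra k L] (ξ : Spec (CommRingCat.of L) ⟶ S)
    (hξ : ξ ≫ p ≫ b = Spec.map (CommRingCat.ofHom (algebraMap k L)))
    (hy : p (ξ (IsLocalRing.closedPoint L : Spec (CommRingCat.of L))) ⤳ y)
    {c : ι → L} (hc : ∀ i, ξ ≫ φ i = P1.ofElement (k := k) (c i)) :
    ∃ τ : L, ∀ i, IsAlgebraic (IntermediateField.adjoin k {τ}) (c i) := by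
  have : Subsingleton (Spec (CommRingCat.of L)) := inferInstanceAs (Subsingleton (PrimeSpectrum L))
  -- The complement of the image of the poles. It is open because `p` is closed, and it contains `y`
  -- because there are no poles on the fibre over `y`.
  let W : Set B := (p '' (⋂ i, φ i ⁻¹' Set.range (P1.affineι k))ᶜ)ᶜ
  have hW : IsOpen W := by
    rw [isOpen_compl_iff]
    refine p.isClosedMap _ (isOpen_iInter_of_finite fun i => ?_).isClosed_compl
    exact (P1.affineι k).isOpenEmbedding.isOpen_range.preimage (φ i).continuous
  have hyW : y ∈ W := by
    rintro ⟨z, hz, hzy⟩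
    exact hz (Set.mem_iInter.2 fun i => hφ i z hzy)
  obtain ⟨_, ⟨(V : B.Opens), hV, rfl⟩, hyV, hVW⟩ := B.isBasis_affineOpens.exists_subset_of_mem_open hyW hW
  have : IsAffine V := hV
  have : Nonempty V := ⟨⟨y, hyV⟩⟩
  have hrange : Set.range ξ ⊆ Set.range (p ⁻¹ᵁ V).ι := by
    rintro _ ⟨t, rfl⟩
    rw [Scheme.Opens.range_ι, Subsingleton.elim t (IsLocalRing.closedPoint L : Spec (CommRingCat.of L))]
    exact hy.mem_open V.isOpen hyV
  let ξ' := IsOpenImmersion.lift (p ⁻¹ᵁ V).ι ξ hrange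
  have hξ' : ξ' ≫ (p ⁻¹ᵁ V).ι = ξ := IsOpenImmersion.lift_fac _ _ _
  have hcomp : (ξ' ≫ p ∣_ V) ≫ V.ι ≫ b = Spec.map (CommRingCat.ofHom (algebraMap k L)) := by
    rw [Category.assoc, ← Category.assoc (p ∣_ V), morphismRestrict_ι, Category.assoc,
      ← Category.assoc, hξ', hξ]
  let κ : k →+* Γ(V.toScheme, ⊤) :=
    (V.ι ≫ b).appTop.hom.comp (Scheme.ΓSpecIso (CommRingCat.of k)).inv.hom
  have hκ : κ.FiniteType := finiteType_of_isAffine (V.ι ≫ b)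
  let : Algebra k Γ(V.toScheme, ⊤) := κ.toAlgebra
  have : Algebra.FiniteType k Γ(V.toScheme, ⊤) := hκ
  let θ : Γ(V.toScheme, ⊤) →ₐ[k] L := ⟨pullbackFunctions (ξ' ≫ p ∣_ V), fun r =>
    pullbackFunctions_appTop (S := CommRingCat.of k) (ξ' ≫ p ∣_ V) (V.ι ≫ b)
      (CommRingCat.ofHom (algebraMap k L)) hcomp r⟩
  obtain ⟨t, ht⟩ := exists_isIntegral_adjoin (k := k) Γ(V.toScheme, ⊤)
    (ringKrullDim_le_topologicalKrullDim.trans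
      ((topologicalKrullDim_subspace_le B V).trans hdim))
  refine ⟨θ t, fun i => ?_⟩
  obtain ⟨P, hP, hP0⟩ := isIntegralElem_of_forall_mem_range (p ∣_ V) ((p ⁻¹ᵁ V).ι ≫ φ i) (fun z => by
    by_contra hz
    refine hVW (show p z.1 ∈ V from z.2) ⟨z.1, fun hz' => hz ?_, rfl⟩
    exact Set.mem_iInter.1 hz' i) ξ' (c := c i) (by rw [← Category.assoc, hξ', hc])
  have hθ : ∀ a, θ a ∈ integralClosure (IntermediateField.adjoin k {θ t}) L := fun a =>
    isIntegral_adjoin_map θ (ht a)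
  let θ' : Γ(V.toScheme, ⊤) →+* integralClosure (IntermediateField.adjoin k {θ t}) L :=
    (θ : Γ(V.toScheme, ⊤) →+* L).codRestrict _ hθ
  have hint : IsIntegral (integralClosure (IntermediateField.adjoin k {θ t}) L) (c i) :=
    ⟨P.map θ', hP.map _, by rw [Polynomial.eval₂_map]; exact hP0⟩
  exact (isIntegral_trans (c i) hint : IsIntegral (IntermediateField.adjoin k {θ t}) (c i)).isAlgebraic

end CurveFunctions

/-! ### Rigidity of the curve. -/

section Rigidity

variable {k : Type u} [Field k]

open scoped IntermediateField.algebraAdjoinAdjoin in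
theorem trdeg_adjoin_singleton_le {L : Type u} [Field L] [Algebra k L] (τ : L) :
    Algebra.trdeg k (IntermediateField.adjoin k {τ}) ≤ 1 := by
  have h1 : Algebra.trdeg k (Algebra.adjoin k {τ}) ≤ 1 := by
    rw [← Polynomial.trdeg_of_isDomain (R := k)]
    refine trdeg_le_of_surjective
      (Polynomial.aeval (R := k) (⟨τ, Algebra.subset_adjoin rfl⟩ : Algebra.adjoin k {τ})) fun x => ?_
    obtain ⟨F, hF⟩ := Algebra.adjoin_mem_exists_aeval _ _ x.2
    refine ⟨F, Subtype.ext (Eq.trans ?_ hF)⟩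
    exact (Polynomial.aeval_algHom_apply (Algebra.adjoin k {τ}).val _ F).symm
  have : Algebra.IsAlgebraic (Algebra.adjoin k {τ}) (IntermediateField.adjoin k {τ}) :=
    (IsFractionRing.comap_isAlgebraic_iff (K := IntermediateField.adjoin k {τ})).2 inferInstance
  rw [← trdeg_add_eq k (Algebra.adjoin k {τ}), trdeg_eq_zero (R := Algebra.adjoin k {τ}), add_zero]
  exact h1

theorem topologicalKrullDim_mono {T : Type*} [TopologicalSpace T] {s t : Set T} (h : s ⊆ t) :
    topologicalKrullDim s ≤ topologicalKrullDim t :=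
  (Topology.IsEmbedding.inclusion h).isInducing.topologicalKrullDim_le

/-- If all values were algebraic over `k(τ)`, the point would be defined over the algebraic closure
of `k(τ)` in `L`, of transcendence degree at most one, and its closure would have dimension at most
one. -/
theorem exists_not_isAlgebraic_of_two_le {L : Type u} [Field L] [Algebra k L]
    (f : CoordRing k HesseVertex →ₐ[k] L) {x : PrimeSpectrum (CoordRing k HesseVertex)}
    (hx : RingHom.ker f = x.asIdeal) (h : 2 ≤ topologicalKrullDim (closure {toMBar k x})) (τ : L) :
    ∃ r, ¬ IsAlgebraic (IntermediateField.adjoin k {τ}) (f r) := by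
  by_contra! H
  let K := IntermediateField.adjoin k {τ}
  let f' : CoordRing k HesseVertex →ₐ[k] algebraicClosure K L :=
    f.codRestrict ((algebraicClosure K L).toSubalgebra.restrictScalars k)
      (fun r => mem_algebraicClosure_iff.2 (H r))
  have hf' : RingHom.ker f' = x.asIdeal := by
    rw [← hx]
    ext r
    rw [RingHom.mem_ker, RingHom.mem_ker]
    exact ⟨fun e => congrArg Subtype.val e, fun e => Subtype.ext e⟩
  have h2 := two_le_trdeg_of_toMBar f' hf' h
  have : FaithfulSMul K (algebraicClosure K L) :=
    (faithfulSMul_iff_algebraMap_injective _ _).2 (algebraMap K (algebraicClosure K L)).injective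
  rw [← trdeg_add_eq k K, trdeg_eq_zero (R := K), add_zero] at h2
  exact absurd (h2.trans (trdeg_adjoin_singleton_le τ)) (by norm_num)

attribute [local instance] MvPolynomial.gradedAlgebra

theorem P1.map_ofElement {R R' : Type u} [CommRing R] [Algebra k R] [CommRing R'] [Algebra k R']
    (g : R →ₐ[k] R') (c : R) : Spec.map (CommRingCat.ofHom g.toRingHom) ≫ P1.ofElement (k := k) c =
      P1.ofElement (k := k) (g c) := by
  rw [P1.ofElement_eq, P1.ofElement_eq, ← Category.assoc, ← Spec.map_comp, ← CommRingCat.ofHom_comp]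
  congr 3
  ext x
  exact P1.affineEval_map g c x

theorem inclusion_crossRatio (q : Fin 4 ↪ HesseVertex) : inclusion k ≫ MBar.crossRatio k q =
    P1.ofElement (k := k) (CoordRing.crossRatio q : CoordRing k HesseVertex) :=
  toMBar_crossRatio q

theorem crossRatio_mem_range_of_mem_hesseCurve [Infinite k] (h3 : (3 : k) ≠ 0) {w : k}
    (hw : w ^ 2 + w + 1 = 0) {j : Fin 10} {q : Fin 4 ↪ HesseVertex}
    (hq : ∀ i, q i ∈ hesseHypergraph j) {z : MBar k HesseVertex} (hz : z ∈ hesseCurve h3 hw) :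
    MBar.crossRatio k q z ∈ Set.range (P1.affineι k) := by
  obtain ⟨c, hc⟩ := Algebra.mem_bot.1 (eval_crossRatio_mem_bot h3 hw j q hq)
  have hmem : CoordRing.crossRatio q - algebraMap k _ c ∈ hesseIdeal h3 hw := by
    rw [hesseIdeal, RingHom.mem_ker, map_sub, AlgHom.commutes, ← hc]
    exact sub_self _
  have h0 : MBar.crossRatio k q (toMBar k (hessePrime h3 hw)) =
      P1.ofElement (k := k) c (IsLocalRing.closedPoint k : Spec (CommRingCat.of k)) := by
    rw [← P1.ofElement_apply_eq (x := hessePrime h3 hw) hmem, ← toMBar_crossRatio]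
    rfl
  have h1 := (specializes_iff_mem_closure.2 hz).map (MBar.crossRatio k q).continuous
  rw [h0] at h1
  have h2 := (P1.isClosed_ofElement c).closure_eq ▸ h1.mem_closure
  rw [Set.mem_singleton_iff.1 h2, P1.ofElement_eq]
  exact ⟨_, rfl⟩

/-- `L` is the residue field of `η`; as `h η` lies in the open moduli space, the composition with
`h` is given by a homomorphism from the coordinate ring. -/
theorem exists_algHom_of_mem_range {S : Scheme.{u}} (s : S ⟶ Spec (CommRingCat.of k))
    {h : S ⟶ MBar k HesseVertex} (hs : h ≫ MBar.toBase k HesseVertex = s) {η : S}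
    (hη : h η ∈ Set.range (toMBar k)) :
    ∃ (L : Type u) (_ : Field L) (_ : Algebra k L) (ξ : Spec (CommRingCat.of L) ⟶ S)
      (f : CoordRing k HesseVertex →ₐ[k] L),
      ξ (IsLocalRing.closedPoint L : Spec (CommRingCat.of L)) = η ∧
      ξ ≫ s = Spec.map (CommRingCat.ofHom (algebraMap k L)) ∧
      Spec.map (CommRingCat.ofHom f.toRingHom) ≫ inclusion k = ξ ≫ h := by
  let L := S.residueField η
  let ξ : Spec (CommRingCat.of L) ⟶ S := S.fromSpecResidueField η
  have hξ : ∀ t, ξ t = η := S.fromSpecResidueField_apply η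
  let κ : CommRingCat.of k ⟶ CommRingCat.of L := Spec.preimage (ξ ≫ s)
  let : Algebra k L := κ.hom.toAlgebra
  have hκ : ξ ≫ s = Spec.map (CommRingCat.ofHom (algebraMap k L)) := (Spec.map_preimage (ξ ≫ s)).symm
  have hrange : Set.range (ξ ≫ h) ⊆ Set.range (inclusion k) := by
    rintro _ ⟨t, rfl⟩
    rw [Scheme.Hom.comp_apply, hξ]
    exact hη
  let g : CommRingCat.of (CoordRing k HesseVertex) ⟶ CommRingCat.of L :=
    Spec.preimage (IsOpenImmersion.lift (inclusion k) (ξ ≫ h) hrange)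
  have hg : Spec.map g ≫ inclusion k = ξ ≫ h := by
    rw [Spec.map_preimage, IsOpenImmersion.lift_fac]
  have hcomm : CommRingCat.ofHom (algebraMap k (CoordRing k HesseVertex)) ≫ g =
      CommRingCat.ofHom (algebraMap k L) := by
    apply Spec.map_injective
    rw [Spec.map_comp, ← inclusion_toBase, ← Category.assoc, hg, Category.assoc, hs, hκ]
  let f : CoordRing k HesseVertex →ₐ[k] L := ⟨g.hom, fun r => congrArg (fun t => t.hom r) hcomm⟩
  exact ⟨L, inferInstance, inferInstance, ξ, f, hξ _, hκ, hg⟩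

/-- Some point of the distinguished fibre maps to the generic point of the curve, so the generic
point of `S` maps to a generization of it, which lies in the moduli space and in the neighbourhood
where the obstruction does not vanish. The cross-ratios on the hyperedges are constant on the curve,
hence have no poles on the fibre and are algebraic over some `k(τ)`. -/
theorem not_moves_hesseCurve [IsAlgClosed k] (h3 : (3 : k) ≠ 0) {w : k} (hw : w ^ 2 + w + 1 = 0) :
    ¬ Moves (MBar.toBase k HesseVertex) (hesseCurve h3 hw) := by
  have : Infinite k := IsAlgClosed.instInfinite
  rintro ⟨S, B, s, b, p, h, hS, -, hB, hBdim, -, hp, hproper, -, hs, hdim, y, -, hy⟩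
  have := hS.isIntegral
  have := hB.isIntegral
  have := hB.locallyOfFiniteType
  obtain ⟨z, hz, hzη⟩ : toMBar k (hessePrime h3 hw) ∈ h '' (p ⁻¹' {y}) := by
    rw [hy]; exact subset_closure rfl
  have hηz : ∀ z, genericPoint S ⤳ z := genericPoint_specializes
  have hspec : h (genericPoint S) ⤳ toMBar k (hessePrime h3 hw) := hzη ▸ (hηz z).map h.continuous
  have hmem : h (genericPoint S) ∈ Set.range (toMBar k) :=
    hspec.mem_open (inclusion k).isOpenEmbedding.isOpen_range ⟨_, rfl⟩
  obtain ⟨L, _, _, ξ, f, hξη, hξs, hf⟩ := exists_algHom_of_mem_range s hs hmem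
  obtain ⟨x, hx⟩ : ∃ x : PrimeSpectrum (CoordRing k HesseVertex), RingHom.ker f = x.asIdeal :=
    ⟨⟨RingHom.ker f, RingHom.ker_isPrime f⟩, rfl⟩
  have hxη : toMBar k x = h (genericPoint S) := by
    rw [← ker_comp_point f hx, hf]
    exact congrArg h hξη
  have hsub : Set.range h ⊆ closure {toMBar k x} := by
    rintro _ ⟨t, rfl⟩
    rw [hxη]
    exact specializes_iff_mem_closure.1 ((hηz t).map h.continuous)
  have hdim2 : 2 ≤ topologicalKrullDim (closure {toMBar k x}) := hdim ▸ topologicalKrullDim_mono hsub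
  let ι := {q : Fin 4 ↪ HesseVertex // ∃ j, ∀ i, q i ∈ hesseHypergraph j}
  obtain ⟨τ, hτ⟩ := exists_isAlgebraic_of_fibre p b hBdim.le (y := y)
    (fun q : ι => h ≫ MBar.crossRatio k q.1) (fun q t ht => by
      obtain ⟨j, hj⟩ := q.2
      exact crossRatio_mem_range_of_mem_hesseCurve h3 hw hj (hy ▸ Set.mem_image_of_mem h ht)) ξ
    (by rw [hp, hξs]) (by
      rw [hξη]
      exact (show p z = y from hz) ▸ (hηz z).map p.continuous)
    (c := fun q => f (CoordRing.crossRatio q.1)) (fun q => by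
      rw [← Category.assoc, ← hf, Category.assoc, inclusion_crossRatio, P1.map_ofElement])
  -- The classification applies once more, now over `k(τ)`; the image of the generic point of `S`
  -- would be a `hessePrime`, whose closure has dimension one instead of two.
  obtain ⟨w', hw', t, ht, hft⟩ := exists_eq_eval_of_not_isAlgebraic h3 f
    (IntermediateField.adjoin k {τ}) (fun j q hq => hτ ⟨q, j, hq⟩)
    (exists_not_isAlgebraic_of_two_le f hx hdim2 τ) (by
      intro h0
      have hnb : toMBar k x ∈ hesseNeighbourhood k := by
        rw [hxη]
        exact hspec.mem_open isOpen_hesseNeighbourhood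
          (hesseCurve_subset_hesseNeighbourhood h3 hw (subset_closure rfl))
      refine toMBar_mem_hesseNeighbourhood hnb ?_
      rw [← hx]
      exact h0)
  have hxp : x = hessePrime h3 hw' := by
    apply PrimeSpectrum.ext
    rw [← hx, hft]
    exact ker_eval_hesseVector h3 hw' ht
  have hc := topologicalKrullDim_hesseCurve h3 hw'
  rw [hesseCurve, ← hxp] at hc
  rw [hc] at hdim2
  exact absurd hdim2 (by decide)

theorem isRigidCurve_hesseCurve [IsAlgClosed k] (h3 : (3 : k) ≠ 0) {w : k} (hw : w ^ 2 + w + 1 = 0) :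
    IsRigidCurve (MBar.toBase k HesseVertex) (hesseCurve h3 hw) where
  isClosed := isClosed_closure
  isIrreducible := isIrreducible_singleton.closure
  dim_eq_one :=
    have : Infinite k := IsAlgClosed.instInfinite
    topologicalKrullDim_hesseCurve h3 hw
  not_moves := not_moves_hesseCurve h3 hw

theorem closure_image_points [Infinite k] (h3 : (3 : k) ≠ 0) {w : k} (hw : w ^ 2 + w + 1 = 0) :
    closure (M0.toMBar k HesseVertex '' {z | ∃ (s : k) (hv : IsConfiguration (hesseVector w s)),
      z = M0.point (hesseVector w s) hv}) = hesseCurve h3 hw := by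
  have hcont : Continuous (toMBar k) := (M0.toMBar k HesseVertex).continuous
  rw [hesseCurve, ← Set.image_singleton, ← closure_image_closure hcont, ← closure_points h3 hw,
    closure_image_closure hcont]
  rfl

end Rigidity

end HypergraphCurve

end

open HypergraphCurve in
theorem theorem7p8 (k : Type u) [Field k] [IsAlgClosed k] (h3 : (3 : k) ≠ 0) :
    (∃ P : HesseVertex → Fin 3 → k, IsDualHesseConfiguration P) ∧
    ∀ P : HesseVertex → Fin 3 → k, IsDualHesseConfiguration P →
      ∃ Q : MvPolynomial (Fin 3) k, IsConicThrough P conicEdge Q ∧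
        (∀ Q', IsConicThrough P conicEdge Q' → ∃ c : k, Q' = c • Q) ∧
        IsConnectedComponentOf (properTransform P Q)
          (closure (M0.toMBar k HesseVertex ''
            exceptionalLocus (hypergraphMorphism k hesseHypergraph))) ∧
        topologicalKrullDim (properTransform P Q) = 1 ∧
        IsIrreducible (properTransform P Q) ∧
        (properTransform P Q ∩ Set.range (M0.toMBar k HesseVertex)).Nonempty ∧
        IsRigidCurve (MBar.toBase k HesseVertex) (properTransform P Q) := by
  have : Infinite k := IsAlgClosed.instInfinite
  refine ⟨?_, fun P hP => ?_⟩
  · obtain ⟨w, hw⟩ := exists_cube_root (k := k)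
    exact ⟨_, isDualHesseConfiguration_hessePoint h3 hw⟩
  obtain ⟨w, hw, G, t, hG, ht, hPG⟩ := hP.exists_eq_smul
  obtain ⟨hQ, huniq⟩ := isConicThrough_and_unique hw h3 hG ht hPG
  refine ⟨_, hQ, huniq, ?_⟩
  -- All the assertions concern the proper transform only, which is the curve `hesseCurve` for the
  -- cube root of unity of the normal form.
  rw [properTransform_eq hw h3 hG ht hPG, closure_image_points h3 hw]
  have hrigid := isRigidCurve_hesseCurve h3 hw
  exact ⟨isConnectedComponentOf_hesseCurve h3 hw, hrigid.dim_eq_one, hrigid.isIrreducible,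
    ⟨_, subset_closure rfl, ⟨hessePrime h3 hw, rfl⟩⟩, hrigid⟩
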